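/- Let $m,n\ge 1$ be integers and let $\lambda\vdash mn$ be a partition with $l(\lambda)\le n$ and $\lambda_1=m+2$. Write $\lambda=(\lambda_1,\dots,\lambda_n)$ as a sequence of exactly $n$ parts by appending zeros if $l(\lambda)<n$ (zero is even). For partitions $\kappa,\nu,\mu$ let $a^\mu_{\kappa,\nu}=\langle s_\kappa\circ s_\nu,\,s_\mu\rangle$ denote the plethysm coefficient, i.e. the coefficient of the Schur function $s_\mu$ in the expansion of the plethysm $s_\kappa\circ s_\nu$ in Schur functions. (a) Suppose $m$ is even. If all of $\lambda_1,\dots,\lambda_n$ are even, then $a^\lambda_{(n),(m)}=1$. Otherwise $a^\lambda_{(n),(m)}=0$. (b) Suppose $m$ is odd. If all of $\lambda_1,\dots,\lambda_n$ are odd (in particular $l(\lambda)=n$), then $a^\lambda_{(1^n),(m)}=1$. Otherwise $a^\lambda_{(1^n),(m)}=0$. -/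

import Mathlib

/-!
Partitions are identified with their Young diagrams (`YoungDiagram`, English convention):
`μ.card` is the size `|μ|`, `μ.rowLen i` is the part `μ_{i+1}` (zero beyond the length) and
`μ.colLen 0` is the length `l(μ)`.
-/

noncomputable section

namespace Plethysm

/-- The one-row partition `(n)`. -/
def rowShape (n : ℕ) : YoungDiagram :=
  YoungDiagram.ofRowLens [n] (List.pairwise_singleton _ n).sortedGE

/-- The one-column partition `(1^n)`. -/
def colShape (n : ℕ) : YoungDiagram :=
  YoungDiagram.ofRowLens (List.replicate n 1) (List.pairwise_replicate_of_refl).sortedGE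

/-- Semistandard Young tableaux of shape `μ` with entries in `{0, …, N - 1}`. -/
def BoundedSSYT (μ : YoungDiagram) (N : ℕ) : Type :=
  {T : SemistandardYoungTableau μ // ∀ c ∈ μ.cells, T c.1 c.2 < N}

/-- The entry of a bounded tableau in a given box. -/
def BoundedSSYT.entry {μ : YoungDiagram} {N : ℕ} (T : BoundedSSYT μ N)
    (c : {c : ℕ × ℕ // c ∈ μ.cells}) : Fin N :=
  ⟨T.1 c.1.1 c.1.2, T.2 c.1 c.2⟩

theorem BoundedSSYT.entry_injective (μ : YoungDiagram) (N : ℕ) :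
    Function.Injective (BoundedSSYT.entry : BoundedSSYT μ N → _ → Fin N) := by
  intro S T h
  apply Subtype.ext
  apply SemistandardYoungTableau.ext
  intro i j
  by_cases hc : (i, j) ∈ μ
  · exact congrArg Fin.val (congrFun h ⟨(i, j), (YoungDiagram.mem_cells _).2 hc⟩)
  · rw [S.1.zeros hc, T.1.zeros hc]

instance (μ : YoungDiagram) (N : ℕ) : Fintype (BoundedSSYT μ N) :=
  Fintype.ofInjective _ (BoundedSSYT.entry_injective μ N)

/-- The monomial `x^T`, the product of `x_{T(c)}` over all boxes `c`. -/
def BoundedSSYT.weight {μ : YoungDiagram} {N : ℕ} (T : BoundedSSYT μ N) :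
    MvPolynomial (Fin N) ℤ :=
  ∏ c : {c : ℕ × ℕ // c ∈ μ.cells}, MvPolynomial.X (T.entry c)

/-- The Schur function `s_μ` in `N` variables: the sum of `x^T` over all semistandard
tableaux `T` of shape `μ`. -/
def schur (μ : YoungDiagram) (N : ℕ) : MvPolynomial (Fin N) ℤ :=
  ∑ T : BoundedSSYT μ N, T.weight

/-- The plethysm `s_κ ∘ s_ν` in `N` variables: the Schur polynomial `s_κ` evaluated at the
monomials `x^T` whose sum is `s_ν(x_1, …, x_N)`, each of them taken as often as it occurs.
As `s_κ` is a symmetric polynomial, the order in which the monomials are listed is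
immaterial. -/
def plethysm (κ ν : YoungDiagram) (N : ℕ) : MvPolynomial (Fin N) ℤ :=
  MvPolynomial.aeval
    (fun i : Fin (Fintype.card (BoundedSSYT ν N)) =>
      ((Fintype.equivFin (BoundedSSYT ν N)).symm i).weight)
    (schur κ (Fintype.card (BoundedSSYT ν N)))

/-- `s_κ ∘ s_ν = ∑_μ c_μ s_μ` as symmetric functions, that is, in every number of variables;
`c` is a finitely supported family of integers indexed by all partitions. -/
def IsSchurExpansion (κ ν : YoungDiagram) (c : YoungDiagram →₀ ℤ) : Prop :=
  ∀ N : ℕ, plethysm κ ν N = c.sum fun μ a => a • schur μ N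

/-- `a` is the plethysm coefficient `a^μ_{κ,ν} = ⟨s_κ ∘ s_ν, s_μ⟩`: the function `s_κ ∘ s_ν`
has exactly one expansion in Schur functions, and the coefficient of `s_μ` in it is `a`. -/
def IsPlethysmCoeff (κ ν μ : YoungDiagram) (a : ℤ) : Prop :=
  ∃ c : YoungDiagram →₀ ℤ, IsSchurExpansion κ ν c ∧
    (∀ c' : YoungDiagram →₀ ℤ, IsSchurExpansion κ ν c' → c' = c) ∧ c μ = a

end Plethysm

end

/-! The coefficient of `s_μ` in a symmetric polynomial `f` in `N ≥ l(μ)` variables is the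
coefficient of `x^(μ+δ)` in `a_δ f`. This is `altCoeff (shifted N μ) f`; it rests on the bialternant
formula `alternant_rowLen` and does not depend on `N` (`altCoeff_shifted_killLast`). The theorem
thus asks for one such coefficient of `h_n ∘ h_m` or `e_n ∘ h_m`, and three moves make it
computable.

Duality. Encode `μ` by `N` beads and `M` holes on the positions `0, …, N+M-1`. Multiplication by
`p_r` moves a bead by `r` into a hole, and the exchange costs a sign. Hence `p_r` in `N` variables
corresponds to `-p_r` in `M` variables, with `μ` replaced by its conjugate
(`mul_psum_mem_dualPairs`, `dualPairs_shifted`). By Newton's recursion `h_m` goes to `(-1)^m e_m`.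
So `h_n ∘ h_m` (`m` even) and `e_n ∘ h_m` (`m` odd) both go to `h_n ∘ e_m`, up to a sign in the odd
case.

Complement. Take `M = m + 2`, enough to hold all columns of `λ`. A squarefree monomial of degree `m`
is then the complement of a pair `x_i x_j`, so `h_n ∘ e_m` turns into `h_n ∘ e_2` when each exponent
`v` is replaced by `n - v` (`altCoeff_hfam_compl`). The conjugate of `λ` is replaced by its
complement in an `(m+2) × n` box.

Littlewood. The sum over `n` of `a_δ (h_n ∘ e_2)` is the product over `i < j` of `(x_i - x_j)/(1 -
x_i x_j)`. A partial fraction identity expands it like a Pfaffian (`schurProd_insert_min`), and on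
strictly decreasing exponents only the pairing of consecutive indices survives
(`coeff_schurProd_tail`). The coefficient is therefore 1 or 0 according to whether the parts of the
complement agree in consecutive pairs, with an unpaired last part equal to zero. Translated back to
`λ`, this says that all rows have the parity of `m`. -/

noncomputable section

namespace Plethysm

open Finset

/-! ### Complete and elementary functions of a finite family; Newton's recursion. -/

section Families

variable {ι κ R S : Type*} [Fintype ι] [Fintype κ] [CommRing R] [CommRing S]

/-- The complete homogeneous symmetric function `h_n` evaluated at a finite family. -/
def hfam (w : ι → R) (n : ℕ) : R :=
  PowerSeries.coeff n (∏ i, PowerSeries.mk fun k => w i ^ k)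

/-- The elementary symmetric function `e_n` evaluated at a finite family. -/
def efam (w : ι → R) (n : ℕ) : R :=
  ∑ t ∈ powersetCard n (univ : Finset ι), ∏ i ∈ t, w i

theorem hfam_eq_sum [DecidableEq ι] (w : ι → R) (n : ℕ) :
    hfam w n = ∑ m ∈ (univ : Finset ι).finsuppAntidiag n, ∏ i, w i ^ m i := by
  simp [hfam, PowerSeries.coeff_prod]

theorem hfam_zero (w : ι → R) : hfam w 0 = 1 := by
  classical
  simp [hfam_eq_sum]

theorem efam_zero (w : ι → R) : efam w 0 = 1 := by
  simp [efam]

theorem hfam_comp_equiv (e : κ ≃ ι) (w : ι → R) (n : ℕ) : hfam (w ∘ e) n = hfam w n := by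
  unfold hfam
  congr 1
  exact Fintype.prod_equiv e _ _ fun _ => rfl

theorem efam_comp_equiv (e : κ ≃ ι) (w : ι → R) (n : ℕ) : efam (w ∘ e) n = efam w n := by
  classical
  unfold efam
  refine Finset.sum_equiv e.finsetCongr ?_ ?_
  · simp
  · intro s _
    simp

theorem hfam_eq_sum_sym [DecidableEq ι] (w : ι → R) (n : ℕ) :
    hfam w n = ∑ s : Sym ι n, ((s : Multiset ι).map w).prod := by
  rw [hfam_eq_sum]
  symm
  refine Finset.sum_bij (fun s _ => Multiset.toFinsupp (s : Multiset ι)) ?_ ?_ ?_ ?_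
  · intro s _
    simp only [mem_finsuppAntidiag, Finset.subset_univ, and_true]
    change ∑ a, Multiset.toFinsupp (s : Multiset ι) a = n
    simp only [Multiset.toFinsupp_apply]
    rw [Multiset.sum_count_eq_card (fun a _ => mem_univ a)]
    exact s.2
  · intro s _ t _ h
    exact Sym.coe_injective (Multiset.toFinsupp.injective h)
  · intro m hm
    simp only [mem_finsuppAntidiag, Finset.subset_univ, and_true] at hm
    refine ⟨Sym.mk (Finsupp.toMultiset m) ?_, mem_univ _, Finsupp.toMultiset_toFinsupp m⟩
    rw [Finsupp.card_toMultiset, Finsupp.sum_fintype _ _ (fun _ => rfl)]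
    exact hm
  · intro s _
    simp only [Multiset.toFinsupp_apply]
    rw [Finset.prod_multiset_map_count]
    refine Finset.prod_subset (Finset.subset_univ _) ?_
    intro x _ hx
    rw [Multiset.mem_toFinset] at hx
    rw [Multiset.count_eq_zero_of_notMem hx, pow_zero]

/-- Logarithmic derivative: each factor `F = 1/(1 - wt)` satisfies `F' = w F²`, so the derivative of
the product is the product times `∑ w F`, whose coefficients are the power sums. -/
theorem mul_hfam_succ (w : ι → R) (n : ℕ) :
    (n + 1 : ℕ) * hfam w (n + 1) =
      ∑ k ∈ range (n + 1), (∑ i, w i ^ (k + 1)) * hfam w (n - k) := by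
  classical
  set F : ι → PowerSeries R := fun i => PowerSeries.mk fun k => w i ^ k with hF
  have hd : ∀ i, PowerSeries.derivative R (F i) = F i * (F i * PowerSeries.C (w i)) := by
    intro i
    ext k
    rw [PowerSeries.coeff_derivative, ← mul_assoc, PowerSeries.coeff_mul_C,
      PowerSeries.coeff_mul]
    simp only [hF, PowerSeries.coeff_mk]
    rw [Finset.sum_congr rfl (g := fun _ => w i ^ k)]
    · rw [Finset.sum_const, Nat.card_antidiagonal, nsmul_eq_mul]
      push_cast
      ring
    · intro x hx
      rw [← pow_add, HasAntidiagonal.mem_antidiagonal.1 hx]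
  have hp : ∀ s : Finset ι, PowerSeries.derivative R (∏ i ∈ s, F i) =
      (∏ i ∈ s, F i) * ∑ i ∈ s, F i * PowerSeries.C (w i) := by
    intro s
    induction s using Finset.induction_on with
    | empty => simp
    | insert a s ha ih =>
      rw [Finset.prod_insert ha, Derivation.leibniz, ih, hd, Finset.sum_insert ha]
      simp only [smul_eq_mul]
      ring
  have h := congrArg (PowerSeries.coeff n) (hp univ)
  rw [PowerSeries.coeff_derivative, mul_comm (∏ i, F i), PowerSeries.coeff_mul,
    Finset.Nat.sum_antidiagonal_eq_sum_range_succ_mk] at h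
  rw [mul_comm]
  push_cast
  unfold hfam
  rw [h]
  refine Finset.sum_congr rfl fun k _ => ?_
  congr 1
  rw [map_sum]
  refine Finset.sum_congr rfl fun i _ => ?_
  rw [PowerSeries.coeff_mul_C]
  simp [hF, pow_succ]

theorem mul_efam_succ (w : ι → R) (n : ℕ) :
    (n + 1 : ℕ) * efam w (n + 1) =
      ∑ k ∈ range (n + 1), (-1) ^ k * (∑ i, w i ^ (k + 1)) * efam w (n - k) := by
  have h := congrArg (MvPolynomial.aeval (R := ℤ) w) (MvPolynomial.mul_esymm_eq_sum ι ℤ (n + 1))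
  have he : ∀ k, MvPolynomial.aeval (R := ℤ) w (MvPolynomial.esymm ι ℤ k) = efam w k := by
    intro k
    simp [MvPolynomial.esymm, efam]
  have hp : ∀ k, MvPolynomial.aeval (R := ℤ) w (MvPolynomial.psum ι ℤ k) = ∑ i, w i ^ k := by
    intro k
    simp [MvPolynomial.psum]
  simp only [map_mul, map_sum, map_pow, map_neg, map_one, map_natCast, he, hp] at h
  rw [h, Finset.mul_sum]
  symm
  refine Finset.sum_bij (fun k _ => (n - k, k + 1)) ?_ ?_ ?_ ?_
  · intro k hk
    simp only [mem_range] at hk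
    simp only [mem_filter, HasAntidiagonal.mem_antidiagonal]
    omega
  · intro a ha b hb hab
    simp only [Prod.mk.injEq] at hab
    omega
  · rintro ⟨a, b⟩ hab
    simp only [mem_filter, HasAntidiagonal.mem_antidiagonal] at hab
    refine ⟨b - 1, by simp only [mem_range]; omega, ?_⟩
    ext <;> simp <;> omega
  · intro k hk
    simp only [mem_range] at hk
    obtain ⟨d, rfl⟩ : ∃ d, n = k + d := ⟨n - k, by omega⟩
    have : (-1 : R) ^ (k + d + 1 + 1) * (-1) ^ d = (-1) ^ k := by
      have : k + d + 1 + 1 + d = k + 2 * (d + 1) := by ring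
      rw [← pow_add, this, pow_add, pow_mul]
      simp
    simp only [Nat.add_sub_cancel_left]
    rw [← this]
    ring

/-- Newton's recursion determines a sequence in a torsion-free ring. -/
theorem newton_unique [IsAddTorsionFree R] {p a b : ℕ → R} (h0 : a 0 = b 0)
    (ha : ∀ n, (n + 1 : ℕ) * a (n + 1) = ∑ k ∈ range (n + 1), p k * a (n - k))
    (hb : ∀ n, (n + 1 : ℕ) * b (n + 1) = ∑ k ∈ range (n + 1), p k * b (n - k)) (n : ℕ) :
    a n = b n := by
  induction n using Nat.strong_induction_on with
  | _ n ih =>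
    cases n with
    | zero => exact h0
    | succ n =>
      have h : (n + 1 : ℕ) * a (n + 1) = (n + 1 : ℕ) * b (n + 1) := by
        rw [ha, hb]
        refine Finset.sum_congr rfl fun k _ => ?_
        rw [ih (n - k) (by omega)]
      rw [← nsmul_eq_mul, ← nsmul_eq_mul] at h
      exact nsmul_right_injective (Nat.succ_ne_zero n) h

/-- A subring closed under division by positive integers contains every sequence obtained by
Newton's recursion from power sums in it. -/
theorem newton_mem (T : Subring R) (hT : ∀ (n : ℕ) (x : R), n ≠ 0 → (n : R) * x ∈ T → x ∈ T)
    {p a : ℕ → R} (h0 : a 0 ∈ T) (hp : ∀ k, p k ∈ T)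
    (ha : ∀ n, (n + 1 : ℕ) * a (n + 1) = ∑ k ∈ range (n + 1), p k * a (n - k)) (n : ℕ) :
    a n ∈ T := by
  induction n using Nat.strong_induction_on with
  | _ n ih =>
    cases n with
    | zero => exact h0
    | succ n =>
      refine hT (n + 1) _ (Nat.succ_ne_zero n) ?_
      rw [ha]
      exact T.sum_mem fun k _ => T.mul_mem (hp k) (ih _ (by omega))

theorem map_hfam (φ : R →+* S) (w : ι → R) (n : ℕ) : φ (hfam w n) = hfam (fun i => φ (w i)) n := by
  classical
  simp [hfam_eq_sum]

theorem map_efam (φ : R →+* S) (w : ι → R) (n : ℕ) : φ (efam w n) = efam (fun i => φ (w i)) n := by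
  simp [efam]

/-- Complete functions of two families agree if the power sums do. -/
theorem hfam_eq_of_psum [IsAddTorsionFree R] {v : ι → R} {w : κ → R}
    (h : ∀ k, ∑ i, v i ^ (k + 1) = ∑ i, w i ^ (k + 1)) (n : ℕ) : hfam v n = hfam w n := by
  refine newton_unique (p := fun k => ∑ i, v i ^ (k + 1)) (by simp [hfam_zero])
    (fun n => mul_hfam_succ v n) (fun n => ?_) n
  simp_rw [h]
  exact mul_hfam_succ w n

theorem efam_eq_of_psum [IsAddTorsionFree R] {v : ι → R} {w : κ → R}
    (h : ∀ k, ∑ i, v i ^ (k + 1) = ∑ i, w i ^ (k + 1)) (n : ℕ) : efam v n = efam w n := by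
  refine newton_unique (p := fun k => (-1) ^ k * ∑ i, v i ^ (k + 1)) (by simp [efam_zero])
    (fun n => mul_efam_succ v n) (fun n => ?_) n
  simp_rw [h]
  exact mul_efam_succ w n

end Families

/-! ### Tableaux of one row or column; plethysms as `h_n` or `e_n` of a family of monomials. -/

section RowColumn

variable {R : Type*} [CommRing R]

theorem mem_rowShape {n i j : ℕ} : (i, j) ∈ rowShape n ↔ i = 0 ∧ j < n := by
  simp [rowShape, YoungDiagram.mem_ofRowLens]

theorem mem_colShape {n i j : ℕ} : (i, j) ∈ colShape n ↔ i < n ∧ j = 0 := by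
  simp [colShape, YoungDiagram.mem_ofRowLens]

/-- A weakly increasing sequence is the sorted list of a multiset, and `h_n` is the sum over
multisets of size `n`. -/
theorem sum_monotone_prod {K n : ℕ} (w : Fin K → R) :
    ∑ f : {f : Fin n → Fin K // Monotone f}, ∏ i, w (f.1 i) = hfam w n := by
  rw [hfam_eq_sum_sym]
  refine Finset.sum_bij
    (fun f _ => Sym.mk ((univ : Finset (Fin n)).val.map f.1) (by simp)) ?_ ?_ ?_ ?_
  · simp
  · intro f _ g _ h
    have h' : (univ : Finset (Fin n)).val.map f.1 = (univ : Finset (Fin n)).val.map g.1 :=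
      congrArg (fun s : Sym (Fin K) n => (s : Multiset (Fin K))) h
    rw [Fin.univ_val_map, Fin.univ_val_map, Multiset.coe_eq_coe] at h'
    have hf : (List.ofFn f.1).Pairwise (· ≤ ·) := f.2.sortedLE_ofFn.pairwise
    have hg : (List.ofFn g.1).Pairwise (· ≤ ·) := g.2.sortedLE_ofFn.pairwise
    exact Subtype.ext (List.ofFn_injective (h'.eq_of_pairwise' hf hg))
  · intro s _
    have hlen : ((s : Multiset (Fin K)).sort (· ≤ ·)).length = n := by
      rw [Multiset.length_sort]
      exact s.2
    refine ⟨⟨fun i => ((s : Multiset (Fin K)).sort (· ≤ ·)).get (i.cast hlen.symm), ?_⟩,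
      mem_univ _, ?_⟩
    · intro i j hij
      exact (Multiset.pairwise_sort (s : Multiset (Fin K)) (· ≤ ·)).sortedLE.monotone_get hij
    · apply Sym.coe_injective
      change (univ : Finset (Fin n)).val.map _ = _
      rw [Fin.univ_val_map]
      conv_rhs => rw [← Multiset.sort_eq (s : Multiset (Fin K)) (· ≤ ·)]
      congr 1
      apply List.ext_get
      · simp [hlen]
      · simp
  · intro f _
    change _ = (((univ : Finset (Fin n)).val.map f.1).map w).prod
    rw [Multiset.map_map]
    rfl

theorem sum_strictMono_prod {K n : ℕ} (w : Fin K → R) :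
    ∑ f : {f : Fin n → Fin K // StrictMono f}, ∏ i, w (f.1 i) = efam w n := by
  unfold efam
  refine Finset.sum_bij (fun f _ => univ.image f.1) ?_ ?_ ?_ ?_
  · intro f _
    rw [mem_powersetCard]
    exact ⟨Finset.subset_univ _, by rw [card_image_of_injective _ f.2.injective]; simp⟩
  · intro f _ g _ h
    have h' := congrArg (fun s : Finset (Fin K) => (s : Set (Fin K))) h
    simp only [coe_image, coe_univ, Set.image_univ] at h'
    exact Subtype.ext ((f.2.range_inj g.2).1 h')
  · intro s hs
    rw [mem_powersetCard] at hs
    refine ⟨⟨s.orderEmbOfFin hs.2, (s.orderEmbOfFin hs.2).strictMono⟩, mem_univ _, ?_⟩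
    simp
  · intro f _
    rw [prod_image]
    intro a _ b _ h
    exact f.2.injective h

theorem sum_rowShape_prod {K n : ℕ} (w : Fin K → R) :
    ∑ T : BoundedSSYT (rowShape n) K, ∏ c, w (T.entry c) = hfam w n := by
  rw [← sum_monotone_prod]
  have hc : ∀ i : Fin n, ((0, (i : ℕ)) : ℕ × ℕ) ∈ (rowShape n).cells := fun i =>
    (YoungDiagram.mem_cells _).2 (mem_rowShape.2 ⟨rfl, i.2⟩)
  refine Finset.sum_bij (fun T _ => ⟨fun i => T.entry ⟨(0, i), hc i⟩, ?_⟩) ?_ ?_ ?_ ?_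
  · intro i j hij
    exact T.1.row_weak_of_le hij (mem_rowShape.2 ⟨rfl, j.2⟩)
  · simp
  · intro S _ T _ h
    apply BoundedSSYT.entry_injective
    funext ⟨⟨i, j⟩, hij⟩
    obtain ⟨rfl, hj⟩ := mem_rowShape.1 ((YoungDiagram.mem_cells _).1 hij)
    exact congrFun (congrArg Subtype.val h) ⟨j, hj⟩
  · intro f _
    refine ⟨⟨⟨fun i j => if h : i = 0 ∧ j < n then f.1 ⟨j, h.2⟩ else 0, ?_, ?_, ?_⟩, ?_⟩,
      mem_univ _, ?_⟩
    · intro i j1 j2 hj hm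
      obtain ⟨rfl, h2⟩ := mem_rowShape.1 hm
      rw [dif_pos ⟨rfl, hj.trans h2⟩, dif_pos ⟨rfl, h2⟩]
      exact f.2 hj.le
    · intro i1 i2 j hi hm
      obtain ⟨rfl, h2⟩ := mem_rowShape.1 hm
      exact absurd hi (Nat.not_lt_zero _)
    · intro i j hm
      rw [dif_neg (fun h => hm (mem_rowShape.2 h))]
    · rintro ⟨i, j⟩ hm
      obtain ⟨rfl, h2⟩ := mem_rowShape.1 ((YoungDiagram.mem_cells _).1 hm)
      change (if h : (0 : ℕ) = 0 ∧ j < n then ((f.1 ⟨j, h.2⟩ : Fin K) : ℕ) else 0) < K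
      rw [dif_pos ⟨rfl, h2⟩]
      exact (f.1 _).2
    · apply Subtype.ext
      funext i
      apply Fin.ext
      change (if h : (0 : ℕ) = 0 ∧ (i : ℕ) < n then ((f.1 ⟨i, h.2⟩ : Fin K) : ℕ) else 0) = _
      rw [dif_pos ⟨rfl, i.2⟩]
  · intro T _
    symm
    refine Finset.prod_bij (fun i _ => ⟨(0, i), hc i⟩) ?_ ?_ ?_ ?_
    · simp
    · intro i _ j _ h
      simpa [Fin.ext_iff] using h
    · rintro ⟨⟨i, j⟩, hij⟩ _
      obtain ⟨rfl, hj⟩ := mem_rowShape.1 ((YoungDiagram.mem_cells _).1 hij)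
      exact ⟨⟨j, hj⟩, mem_univ _, rfl⟩
    · intros
      rfl

theorem sum_colShape_prod {K n : ℕ} (w : Fin K → R) :
    ∑ T : BoundedSSYT (colShape n) K, ∏ c, w (T.entry c) = efam w n := by
  rw [← sum_strictMono_prod]
  have hc : ∀ i : Fin n, (((i : ℕ), 0) : ℕ × ℕ) ∈ (colShape n).cells := fun i =>
    (YoungDiagram.mem_cells _).2 (mem_colShape.2 ⟨i.2, rfl⟩)
  refine Finset.sum_bij (fun T _ => ⟨fun i => T.entry ⟨(i, 0), hc i⟩, ?_⟩) ?_ ?_ ?_ ?_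
  · intro i j hij
    exact T.1.col_strict hij (mem_colShape.2 ⟨j.2, rfl⟩)
  · simp
  · intro S _ T _ h
    apply BoundedSSYT.entry_injective
    funext ⟨⟨i, j⟩, hij⟩
    obtain ⟨hi, rfl⟩ := mem_colShape.1 ((YoungDiagram.mem_cells _).1 hij)
    exact congrFun (congrArg Subtype.val h) ⟨i, hi⟩
  · intro f _
    refine ⟨⟨⟨fun i j => if h : i < n ∧ j = 0 then f.1 ⟨i, h.1⟩ else 0, ?_, ?_, ?_⟩, ?_⟩,
      mem_univ _, ?_⟩
    · intro i j1 j2 hj hm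
      obtain ⟨h2, rfl⟩ := mem_colShape.1 hm
      exact absurd hj (Nat.not_lt_zero _)
    · intro i1 i2 j hi hm
      obtain ⟨h2, rfl⟩ := mem_colShape.1 hm
      rw [dif_pos ⟨hi.trans h2, rfl⟩, dif_pos ⟨h2, rfl⟩]
      exact f.2 hi
    · intro i j hm
      rw [dif_neg (fun h => hm (mem_colShape.2 h))]
    · rintro ⟨i, j⟩ hm
      obtain ⟨h2, rfl⟩ := mem_colShape.1 ((YoungDiagram.mem_cells _).1 hm)
      change (if h : i < n ∧ (0 : ℕ) = 0 then ((f.1 ⟨i, h.1⟩ : Fin K) : ℕ) else 0) < K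
      rw [dif_pos ⟨h2, rfl⟩]
      exact (f.1 _).2
    · apply Subtype.ext
      funext i
      apply Fin.ext
      change (if h : (i : ℕ) < n ∧ (0 : ℕ) = 0 then ((f.1 ⟨i, h.1⟩ : Fin K) : ℕ) else 0) = _
      rw [dif_pos ⟨i.2, rfl⟩]
  · intro T _
    symm
    refine Finset.prod_bij (fun i _ => ⟨(i, 0), hc i⟩) ?_ ?_ ?_ ?_
    · simp
    · intro i _ j _ h
      simpa [Fin.ext_iff] using h
    · rintro ⟨⟨i, j⟩, hij⟩ _
      obtain ⟨hi, rfl⟩ := mem_colShape.1 ((YoungDiagram.mem_cells _).1 hij)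
      exact ⟨⟨i, hi⟩, mem_univ _, rfl⟩
    · intros
      rfl

theorem plethysm_rowShape (n : ℕ) (ν : YoungDiagram) (N : ℕ) :
    plethysm (rowShape n) ν N = hfam (fun T : BoundedSSYT ν N => T.weight) n := by
  rw [← hfam_comp_equiv (Fintype.equivFin (BoundedSSYT ν N)).symm, ← sum_rowShape_prod]
  simp only [plethysm, schur, BoundedSSYT.weight, map_sum, map_prod, MvPolynomial.aeval_X,
    Function.comp_apply]

theorem plethysm_colShape (n : ℕ) (ν : YoungDiagram) (N : ℕ) :
    plethysm (colShape n) ν N = efam (fun T : BoundedSSYT ν N => T.weight) n := by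
  rw [← efam_comp_equiv (Fintype.equivFin (BoundedSSYT ν N)).symm, ← sum_colShape_prod]
  simp only [plethysm, schur, BoundedSSYT.weight, map_sum, map_prod, MvPolynomial.aeval_X,
    Function.comp_apply]

/-- The power sums of the monomials of degree `m`. -/
theorem sum_rowShape_weight_pow (m N k : ℕ) :
    ∑ T : BoundedSSYT (rowShape m) N, T.weight ^ k =
      hfam (fun i : Fin N => (MvPolynomial.X i : MvPolynomial (Fin N) ℤ) ^ k) m := by
  rw [← sum_rowShape_prod]
  simp only [BoundedSSYT.weight, Finset.prod_pow]

theorem isHomogeneous_weight {μ : YoungDiagram} {N : ℕ} (T : BoundedSSYT μ N) :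
    T.weight.IsHomogeneous μ.card := by
  have := MvPolynomial.IsHomogeneous.prod (R := ℤ) univ
    (fun c => (MvPolynomial.X (T.entry c) : MvPolynomial (Fin N) ℤ)) (fun _ => 1)
    (fun c _ => MvPolynomial.isHomogeneous_X ℤ _)
  simpa [BoundedSSYT.weight, YoungDiagram.card] using this

theorem isHomogeneous_schur (μ : YoungDiagram) (N : ℕ) :
    (schur μ N).IsHomogeneous μ.card :=
  MvPolynomial.IsHomogeneous.sum _ _ _ fun T _ => isHomogeneous_weight T

theorem isHomogeneous_plethysm (κ ν : YoungDiagram) (N : ℕ) :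
    (plethysm κ ν N).IsHomogeneous (ν.card * κ.card) :=
  (isHomogeneous_schur κ _).aeval _ fun _ => isHomogeneous_weight _

/-- A ring homomorphism compatible with power sums is compatible with `h_n ∘ h_m`. -/
theorem map_plethysm_rowShape {N N' : ℕ}
    (φ : MvPolynomial (Fin N) ℤ →+* MvPolynomial (Fin N') ℤ)
    (h : ∀ k, φ (∑ i, MvPolynomial.X i ^ (k + 1)) = ∑ i, MvPolynomial.X i ^ (k + 1))
    (m k : ℕ) :
    φ (∑ T : BoundedSSYT (rowShape m) N, T.weight ^ (k + 1)) =
      ∑ T : BoundedSSYT (rowShape m) N', T.weight ^ (k + 1) := by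
  rw [sum_rowShape_weight_pow, sum_rowShape_weight_pow, map_hfam]
  refine hfam_eq_of_psum (fun j => ?_) m
  -- The power sums of the family `x_i^(k+1)` are again power sums of the variables. The subtraction
  -- undoes the shift by which `h` starts at exponent 1.
  have := h ((k + 1) * (j + 1) - 1)
  rw [Nat.sub_add_cancel (Nat.succ_le_of_lt (by positivity))] at this
  simpa [← pow_mul] using this

/-- Used with `φ` a permutation of the variables, which gives symmetry, and with `φ` killing the
last variable, which gives stability. -/
theorem map_plethysm_row_row {N N' : ℕ}
    (φ : MvPolynomial (Fin N) ℤ →+* MvPolynomial (Fin N') ℤ)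
    (h : ∀ k, φ (∑ i, MvPolynomial.X i ^ (k + 1)) = ∑ i, MvPolynomial.X i ^ (k + 1))
    (n m : ℕ) :
    φ (plethysm (rowShape n) (rowShape m) N) = plethysm (rowShape n) (rowShape m) N' := by
  rw [plethysm_rowShape, plethysm_rowShape, map_hfam]
  refine hfam_eq_of_psum (fun j => ?_) n
  rw [← map_plethysm_rowShape φ h]
  simp

theorem map_plethysm_col_row {N N' : ℕ}
    (φ : MvPolynomial (Fin N) ℤ →+* MvPolynomial (Fin N') ℤ)
    (h : ∀ k, φ (∑ i, MvPolynomial.X i ^ (k + 1)) = ∑ i, MvPolynomial.X i ^ (k + 1))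
    (n m : ℕ) :
    φ (plethysm (colShape n) (rowShape m) N) = plethysm (colShape n) (rowShape m) N' := by
  rw [plethysm_colShape, plethysm_colShape, map_efam]
  refine efam_eq_of_psum (fun j => ?_) n
  rw [← map_plethysm_rowShape φ h]
  simp

end RowColumn

/-! ### Coefficients of `a_δ f`. -/

section AltCoeff

variable {N M : ℕ}

/-- The coefficient of `x^v`, zero if `v` has a negative entry. -/
def zcoeff (v : Fin N → ℤ) : MvPolynomial (Fin N) ℤ →ₗ[ℤ] ℤ where
  -- Integer exponents keep the subtraction of `δ` and of `r` from truncating.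
  toFun f := if ∀ i, 0 ≤ v i then
    f.coeff (Finsupp.equivFunOnFinite.symm fun i => (v i).toNat) else 0
  map_add' f g := by split_ifs <;> simp
  map_smul' c f := by split_ifs <;> simp [MvPolynomial.coeff_smul, -zsmul_eq_mul]

theorem zcoeff_natCast (d : Fin N →₀ ℕ) (f : MvPolynomial (Fin N) ℤ) :
    zcoeff (fun i => (d i : ℤ)) f = f.coeff d := by
  simp only [zcoeff, LinearMap.coe_mk, AddHom.coe_mk]
  rw [if_pos (fun i => by positivity)]
  congr 1
  ext i
  simp

theorem zcoeff_of_neg {v : Fin N → ℤ} {i : Fin N} (h : v i < 0) (f : MvPolynomial (Fin N) ℤ) :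
    zcoeff v f = 0 := by
  simp only [zcoeff, LinearMap.coe_mk, AddHom.coe_mk]
  rw [if_neg (fun h' => absurd (h' i) (not_le.2 h))]

theorem zcoeff_monomial (v : Fin N → ℤ) (d : Fin N →₀ ℕ) (c : ℤ) :
    zcoeff v (MvPolynomial.monomial d c) = if ∀ i, v i = d i then c else 0 := by
  by_cases h : ∀ i, 0 ≤ v i
  · obtain ⟨w, rfl⟩ : ∃ w : Fin N →₀ ℕ, v = fun i => (w i : ℤ) :=
      ⟨Finsupp.equivFunOnFinite.symm fun i => (v i).toNat, by
        funext i
        simp [h i]⟩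
    rw [zcoeff_natCast, MvPolynomial.coeff_monomial]
    congr 1
    simp [Finsupp.ext_iff, eq_comm]
  · push Not at h
    obtain ⟨i, hi⟩ := h
    rw [zcoeff_of_neg hi, if_neg]
    intro h
    have := h i
    omega

theorem zcoeff_mul_monomial (v : Fin N → ℤ) (f : MvPolynomial (Fin N) ℤ) (d : Fin N →₀ ℕ) :
    zcoeff v (f * MvPolynomial.monomial d 1) = zcoeff (fun i => v i - d i) f := by
  induction f using MvPolynomial.induction_on' with
  | monomial e c =>
    rw [MvPolynomial.monomial_mul, zcoeff_monomial, zcoeff_monomial, mul_one]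
    congr 1
    simp only [Finsupp.add_apply, Nat.cast_add, sub_eq_iff_eq_add]
  | add p q hp hq => rw [add_mul, map_add, map_add, hp, hq]

theorem zcoeff_rename (v : Fin N → ℤ) (f : MvPolynomial (Fin N) ℤ) (σ : Equiv.Perm (Fin N)) :
    zcoeff v (MvPolynomial.rename σ f) = zcoeff (v ∘ σ) f := by
  induction f using MvPolynomial.induction_on' with
  | monomial e c =>
    rw [MvPolynomial.rename_monomial, zcoeff_monomial, zcoeff_monomial]
    congr 1
    rw [← Finsupp.equivMapDomain_eq_mapDomain]
    simp only [Finsupp.equivMapDomain_apply, Function.comp_apply, eq_iff_iff]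
    constructor
    · intro h i
      simpa using h (σ i)
    · intro h i
      simpa using h (σ.symm i)
  | add p q hp hq => rw [map_add, map_add, map_add, hp, hq]

theorem zcoeff_comp {f : MvPolynomial (Fin N) ℤ} (hf : f.IsSymmetric) (v : Fin N → ℤ)
    (σ : Equiv.Perm (Fin N)) : zcoeff (v ∘ σ) f = zcoeff v f := by
  rw [← zcoeff_rename, hf]

/-- The staircase `δ = (N - 1, …, 1, 0)`. -/
def stair (N : ℕ) (i : Fin N) : ℤ := N - 1 - i

theorem stair_nonneg (i : Fin N) : 0 ≤ stair N i := by
  have := i.2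
  unfold stair
  omega

theorem stair_rev (i : Fin N) : stair N i.rev = i := by
  have := i.2
  unfold stair
  rw [Fin.val_rev]
  omega

theorem stair_injective : Function.Injective (stair N) := by
  intro i j h
  unfold stair at h
  exact Fin.ext (by omega)

/-- The coefficient of `x^l` in `a_δ f`. -/
def altCoeff (l : Fin N → ℤ) : MvPolynomial (Fin N) ℤ →ₗ[ℤ] ℤ :=
  ∑ σ : Equiv.Perm (Fin N), (Equiv.Perm.sign σ : ℤ) • zcoeff (fun i => l i - stair N (σ i))

theorem altCoeff_apply (l : Fin N → ℤ) (f : MvPolynomial (Fin N) ℤ) :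
    altCoeff l f = ∑ σ : Equiv.Perm (Fin N),
      (Equiv.Perm.sign σ : ℤ) * zcoeff (fun i => l i - stair N (σ i)) f := by
  simp [altCoeff, LinearMap.sum_apply]

/-- `a_δ` is antisymmetric and `f` symmetric; the sign appears on reindexing the sum by `σ ↦ σ τ⁻¹`.
-/
theorem altCoeff_comp {f : MvPolynomial (Fin N) ℤ} (hf : f.IsSymmetric) (l : Fin N → ℤ)
    (τ : Equiv.Perm (Fin N)) :
    altCoeff (l ∘ τ) f = (Equiv.Perm.sign τ : ℤ) * altCoeff l f := by
  rw [altCoeff_apply, altCoeff_apply, Finset.mul_sum]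
  refine Fintype.sum_equiv (Equiv.mulRight τ⁻¹) _ _ fun σ => ?_
  conv_rhs => rw [← zcoeff_comp hf _ τ, ← mul_assoc]
  congr 1
  · have h : (Equiv.Perm.sign τ : ℤ) * Equiv.Perm.sign τ = 1 := by
      rw [← Units.val_mul, Int.units_mul_self, Units.val_one]
    simp only [Equiv.coe_mulRight, Equiv.Perm.sign_mul, Equiv.Perm.sign_inv, Units.val_mul]
    rw [mul_comm (Equiv.Perm.sign σ : ℤ), ← mul_assoc, h, one_mul]
  · congr 1
    congr 1
    funext i
    simp

theorem altCoeff_eq_zero {f : MvPolynomial (Fin N) ℤ} (hf : f.IsSymmetric) {l : Fin N → ℤ}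
    {i j : Fin N} (hij : i ≠ j) (h : l i = l j) : altCoeff l f = 0 := by
  have h1 : l ∘ Equiv.swap i j = l := by
    funext k
    simp only [Function.comp_apply, Equiv.swap_apply_def]
    split_ifs with h1 h2
    · rw [h1, h]
    · rw [h2, h]
    · rfl
  have h2 := altCoeff_comp hf l (Equiv.swap i j)
  rw [h1, Equiv.Perm.sign_swap hij] at h2
  simp at h2
  omega

theorem altCoeff_of_neg {l : Fin N → ℤ} {i : Fin N} (h : l i < 0)
    (f : MvPolynomial (Fin N) ℤ) : altCoeff l f = 0 := by
  rw [altCoeff_apply]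
  refine Finset.sum_eq_zero fun σ _ => ?_
  rw [zcoeff_of_neg (i := i), mul_zero]
  have := stair_nonneg (σ i)
  omega

/-- The Murnaghan–Nakayama rule before straightening: each summand `x_i^r` lowers one exponent, that
is, moves one bead down by `r`. -/
theorem altCoeff_mul_psum (l : Fin N → ℤ) (f : MvPolynomial (Fin N) ℤ) (r : ℕ) :
    altCoeff l (f * ∑ i, MvPolynomial.X i ^ r) =
      ∑ i, altCoeff (Function.update l i (l i - r)) f := by
  simp_rw [altCoeff_apply]
  rw [Finset.sum_comm]
  refine Finset.sum_congr rfl fun σ _ => ?_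
  rw [Finset.mul_sum, map_sum, Finset.mul_sum]
  refine Finset.sum_congr rfl fun i _ => ?_
  rw [MvPolynomial.X_pow_eq_monomial, zcoeff_mul_monomial]
  congr 2
  refine congrArg zcoeff ?_
  funext j
  by_cases hj : j = i
  · subst hj
    simp
    ring
  · simp [hj]

theorem altCoeff_one (l : Fin N → ℤ) :
    altCoeff l 1 = ∑ σ : Equiv.Perm (Fin N),
      if ∀ i, l i = stair N (σ i) then (Equiv.Perm.sign σ : ℤ) else 0 := by
  rw [altCoeff_apply]
  refine Finset.sum_congr rfl fun σ _ => ?_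
  have : (1 : MvPolynomial (Fin N) ℤ) = MvPolynomial.monomial 0 1 := rfl
  rw [this, zcoeff_monomial]
  simp [sub_eq_zero]

end AltCoeff

/-! ### Duality between beads and holes. -/

section Duality

variable {N M : ℕ}

/-- The position `N - 1, …, 0` of the `N` beads followed by those `N, …, N + M - 1` of the `M`
holes. -/
def bead (N M : ℕ) : Fin N ⊕ Fin M → ℤ
  | .inl i => stair N i
  | .inr j => N + j

theorem bead_injective : Function.Injective (bead N M) := by
  rintro (i | i) (j | j) h
  · exact congrArg _ (stair_injective h)
  · have := i.2
    simp only [bead, stair] at h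
    omega
  · have := j.2
    simp only [bead, stair] at h
    omega
  · simp only [bead] at h
    exact congrArg _ (Fin.ext (by omega))

theorem bead_nonneg (x : Fin N ⊕ Fin M) : 0 ≤ bead N M x := by
  rcases x with i | j
  · exact stair_nonneg i
  · simp only [bead]
    omega

theorem bead_lt (x : Fin N ⊕ Fin M) : bead N M x < N + M := by
  rcases x with i | j
  · have := i.2
    simp only [bead, stair]
    omega
  · have := j.2
    simp only [bead]
    omega

theorem exists_bead_eq {a : ℤ} (h0 : 0 ≤ a) (h : a < N + M) : ∃ x, bead N M x = a := by
  by_cases ha : a < N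
  · refine ⟨.inl ⟨(N - 1 - a).toNat, by omega⟩, ?_⟩
    simp only [bead, stair]
    omega
  · refine ⟨.inr ⟨(a - N).toNat, by omega⟩, ?_⟩
    simp only [bead]
    omega

/-- The exponents read off from the beads. -/
def beads (π : Equiv.Perm (Fin N ⊕ Fin M)) (i : Fin N) : ℤ := bead N M (π (.inl i))

/-- The exponents read off from the holes, from the other end. -/
def holes (π : Equiv.Perm (Fin N ⊕ Fin M)) (j : Fin M) : ℤ := N + M - 1 - bead N M (π (.inr j))

/-- Pairs of symmetric polynomials which correspond under the duality exchanging beads and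
holes. -/
def dualPairs (N M : ℕ) :
    AddSubgroup (MvPolynomial (Fin N) ℤ × MvPolynomial (Fin M) ℤ) where
  carrier := {p | p.1.IsSymmetric ∧ p.2.IsSymmetric ∧ ∀ π : Equiv.Perm (Fin N ⊕ Fin M),
    (Equiv.Perm.sign π : ℤ) * altCoeff (beads π) p.1 = altCoeff (holes π) p.2}
  zero_mem' := ⟨MvPolynomial.IsSymmetric.zero, MvPolynomial.IsSymmetric.zero, by simp⟩
  add_mem' := by
    rintro p q ⟨hp1, hp2, hp⟩ ⟨hq1, hq2, hq⟩
    refine ⟨hp1.add hq1, hp2.add hq2, fun π => ?_⟩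
    simp only [Prod.fst_add, Prod.snd_add, map_add, mul_add, hp, hq]
  neg_mem' := by
    rintro p ⟨hp1, hp2, hp⟩
    refine ⟨hp1.neg, hp2.neg, fun π => ?_⟩
    simp only [Prod.fst_neg, Prod.snd_neg, map_neg, mul_neg, hp]

/-- Both sides vanish unless `π` preserves the beads. Then `π` is a sum `σ ⊕ τ`, the left side is
`sign π · sign σ`, and this equals `sign τ`. -/
theorem one_mem_dualPairs : (1 : MvPolynomial (Fin N) ℤ × MvPolynomial (Fin M) ℤ) ∈
    dualPairs N M := by
  refine ⟨MvPolynomial.IsSymmetric.one, MvPolynomial.IsSymmetric.one, fun π => ?_⟩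
  simp only [Prod.fst_one, Prod.snd_one, altCoeff_one]
  have hl : ∀ σ : Equiv.Perm (Fin N), (∀ i, beads π i = stair N (σ i)) ↔
      ∀ i, π (.inl i) = .inl (σ i) := fun σ =>
    forall_congr' fun i => (bead_injective.eq_iff (a := π (.inl i)) (b := .inl (σ i)))
  have hr : ∀ τ : Equiv.Perm (Fin M), (∀ j, holes π j = stair M (τ j)) ↔
      ∀ j, π (.inr j) = .inr (τ j) := fun τ => forall_congr' fun j => by
    rw [← bead_injective.eq_iff (a := π (.inr j)) (b := .inr (τ j))]
    simp only [holes, bead, stair]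
    constructor <;> intro h <;> omega
  simp_rw [hl, hr]
  by_cases h : ∃ (σ : Equiv.Perm (Fin N)) (τ : Equiv.Perm (Fin M)), π = Equiv.sumCongr σ τ
  · obtain ⟨σ, τ, rfl⟩ := h
    have h1 : ∀ σ' : Equiv.Perm (Fin N), (∀ i, σ i = σ' i) ↔ σ = σ' := fun σ' =>
      Equiv.ext_iff.symm
    have h2 : ∀ τ' : Equiv.Perm (Fin M), (∀ i, τ i = τ' i) ↔ τ = τ' := fun τ' =>
      Equiv.ext_iff.symm
    simp only [Equiv.sumCongr_apply, Sum.map_inl, Sum.map_inr, Sum.inl.injEq, Sum.inr.injEq,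
      h1, h2, Finset.sum_ite_eq, Finset.mem_univ, if_true]
    have h3 : Equiv.Perm.sign (Equiv.sumCongr σ τ) = Equiv.Perm.sign σ * Equiv.Perm.sign τ :=
      Equiv.Perm.sign_sumCongr σ τ
    have h4 : (Equiv.Perm.sign σ : ℤ) * Equiv.Perm.sign σ = 1 := by
      rw [← Units.val_mul, Int.units_mul_self, Units.val_one]
    rw [h3, Units.val_mul, mul_right_comm, h4, one_mul]
  · have key : ¬ Set.MapsTo π (Set.range Sum.inl) (Set.range Sum.inl) := by
      intro hm
      obtain ⟨⟨σ, τ⟩, hst⟩ := Equiv.Perm.mem_sumCongrHom_range_of_perm_mapsTo_inl hm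
      exact h ⟨σ, τ, hst.symm⟩
    rw [Finset.sum_eq_zero, Finset.sum_eq_zero, mul_zero]
    · intro τ _
      rw [if_neg]
      intro hτ
      apply key
      rintro _ ⟨i, rfl⟩
      rcases hx : π (.inl i) with a | b
      · exact ⟨a, rfl⟩
      · have := hτ (τ.symm b)
        rw [Equiv.apply_symm_apply, ← hx] at this
        simpa using π.injective this
    · intro σ _
      rw [if_neg]
      intro hσ
      apply key
      rintro _ ⟨i, rfl⟩
      exact ⟨σ i, (hσ i).symm⟩

/-- Moving a bead into a hole composes `π` with a transposition; all signs of the duality come from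
here. -/
theorem update_beads (π : Equiv.Perm (Fin N ⊕ Fin M)) (i : Fin N) (j : Fin M) :
    Function.update (beads π) i (bead N M (π (.inr j))) =
      beads (π * Equiv.swap (.inl i) (.inr j)) := by
  funext k
  by_cases hk : k = i
  · subst hk
    simp [beads]
  · rw [Function.update_of_ne hk]
    simp [beads, Equiv.swap_apply_of_ne_of_ne, hk]

theorem update_holes (π : Equiv.Perm (Fin N ⊕ Fin M)) (i : Fin N) (j : Fin M) :
    Function.update (holes π) j (N + M - 1 - bead N M (π (.inl i))) =
      holes (π * Equiv.swap (.inl i) (.inr j)) := by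
  funext k
  by_cases hk : k = j
  · subst hk
    simp [holes]
  · rw [Function.update_of_ne hk]
    simp [holes, Equiv.swap_apply_of_ne_of_ne, hk]

/-- A bead moved down by `r` lands in a hole, on another bead (two equal exponents, contribution
zero) or below `0` (contribution zero). -/
theorem altCoeff_beads_mul_psum {f : MvPolynomial (Fin N) ℤ} (hf : f.IsSymmetric)
    (π : Equiv.Perm (Fin N ⊕ Fin M)) {r : ℕ} (hr : 0 < r) :
    altCoeff (beads π) (f * ∑ i, MvPolynomial.X i ^ r) =
      ∑ i, ∑ j, if bead N M (π (.inl i)) - r = bead N M (π (.inr j)) then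
        altCoeff (beads (π * Equiv.swap (.inl i) (.inr j))) f else 0 := by
  rw [altCoeff_mul_psum]
  refine Finset.sum_congr rfl fun i _ => ?_
  change altCoeff (Function.update (beads π) i (bead N M (π (.inl i)) - r)) f = _
  by_cases h : ∃ j, bead N M (π (.inl i)) - r = bead N M (π (.inr j))
  · obtain ⟨j, hj⟩ := h
    rw [Finset.sum_eq_single j, if_pos hj, hj, update_beads]
    · intro j' _ hj'
      rw [if_neg]
      intro h
      rw [hj] at h
      exact hj' (by simpa using (π.injective (bead_injective h)).symm)
    · simp
  · push Not at h
    rw [Finset.sum_eq_zero (fun j _ => if_neg (h j))]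
    by_cases h0 : bead N M (π (.inl i)) - r < 0
    · exact altCoeff_of_neg (i := i) (by simpa using h0) f
    · push Not at h0
      obtain ⟨x, hx⟩ := exists_bead_eq (N := N) (M := M) h0
        (by have := bead_lt (π (.inl i)); omega)
      obtain ⟨y, rfl⟩ := π.surjective x
      rcases y with k | j
      · have hk : i ≠ k := by
          rintro rfl
          omega
        refine altCoeff_eq_zero hf hk ?_
        rw [Function.update_self, Function.update_of_ne hk.symm, ← hx]
        rfl
      · exact absurd hx.symm (h j)

/-- The same moves seen from the holes, which go up by `r`. A hole pushed past `N + M - 1` gets a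
negative exponent, so the surviving pairs are those of `altCoeff_beads_mul_psum`. -/
theorem altCoeff_holes_mul_psum {g : MvPolynomial (Fin M) ℤ} (hg : g.IsSymmetric)
    (π : Equiv.Perm (Fin N ⊕ Fin M)) {r : ℕ} (hr : 0 < r) :
    altCoeff (holes π) (g * ∑ i, MvPolynomial.X i ^ r) =
      ∑ i, ∑ j, if bead N M (π (.inl i)) - r = bead N M (π (.inr j)) then
        altCoeff (holes (π * Equiv.swap (.inl i) (.inr j))) g else 0 := by
  rw [altCoeff_mul_psum, Finset.sum_comm]
  refine Finset.sum_congr rfl fun j _ => ?_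
  by_cases h : ∃ i, bead N M (π (.inl i)) - r = bead N M (π (.inr j))
  · obtain ⟨i, hi⟩ := h
    have hj : holes π j - r = N + M - 1 - bead N M (π (.inl i)) := by
      simp only [holes]
      omega
    rw [Finset.sum_eq_single i, if_pos hi, ← update_holes, hj]
    · intro i' _ hi'
      rw [if_neg]
      intro h
      rw [← hi, sub_left_inj] at h
      exact hi' (by simpa using (π.injective (bead_injective h)))
    · simp
  · push Not at h
    rw [Finset.sum_eq_zero (fun i _ => if_neg (h i))]
    by_cases h0 : holes π j - r < 0
    · exact altCoeff_of_neg (i := j) (by simpa using h0) g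
    · obtain ⟨x, hx⟩ := exists_bead_eq (N := N) (M := M)
        (a := bead N M (π (.inr j)) + r)
        (by have := bead_nonneg (π (.inr j)); omega)
        (by simp only [holes] at h0; omega)
      obtain ⟨y, rfl⟩ := π.surjective x
      rcases y with i | k
      · exact (h i (by rw [hx]; ring)).elim
      · have hk : j ≠ k := by
          rintro rfl
          omega
        refine altCoeff_eq_zero hg hk ?_
        rw [Function.update_self, Function.update_of_ne hk.symm]
        simp only [holes]
        omega

theorem isSymmetric_sum_pow (N r : ℕ) :
    (∑ i : Fin N, (MvPolynomial.X i : MvPolynomial (Fin N) ℤ) ^ r).IsSymmetric :=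
  MvPolynomial.psum_isSymmetric (Fin N) ℤ r

/-- The two expansions match term by term except for the sign of the transposition, which forces
`-p_r` in the second component. -/
theorem mul_psum_mem_dualPairs {p : MvPolynomial (Fin N) ℤ × MvPolynomial (Fin M) ℤ}
    (hp : p ∈ dualPairs N M) {r : ℕ} (hr : 0 < r) :
    (∑ i, MvPolynomial.X i ^ r, -∑ i, MvPolynomial.X i ^ r) * p ∈ dualPairs N M := by
  obtain ⟨h1, h2, h⟩ := hp
  rw [mul_comm]
  refine ⟨h1.mul (isSymmetric_sum_pow N r), h2.mul (isSymmetric_sum_pow M r).neg, fun π => ?_⟩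
  simp only [Prod.fst_mul, Prod.snd_mul, mul_neg, map_neg]
  rw [altCoeff_beads_mul_psum h1 π hr, altCoeff_holes_mul_psum h2 π hr, ← Finset.sum_neg_distrib,
    Finset.mul_sum]
  refine Finset.sum_congr rfl fun i _ => ?_
  rw [← Finset.sum_neg_distrib, Finset.mul_sum]
  refine Finset.sum_congr rfl fun j _ => ?_
  split_ifs
  · rw [← h, Equiv.Perm.sign_mul, Equiv.Perm.sign_swap (by simp)]
    simp
  · simp

/-- The multipliers of `dualPairs`. -/
def dualMultipliers (N M : ℕ) :
    Subring (MvPolynomial (Fin N) ℤ × MvPolynomial (Fin M) ℤ) where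
  -- Newton's recursion needs products, and `dualPairs` is given only as an additive group; its
  -- multipliers form a ring.
  carrier := {a | ∀ p ∈ dualPairs N M, a * p ∈ dualPairs N M}
  mul_mem' ha hb p hp := by
    rw [mul_assoc]
    exact ha _ (hb _ hp)
  one_mem' p hp := by rwa [one_mul]
  add_mem' ha hb p hp := by
    rw [add_mul]
    exact add_mem (ha _ hp) (hb _ hp)
  zero_mem' p hp := by
    rw [zero_mul]
    exact zero_mem _
  neg_mem' ha p hp := by
    rw [neg_mul]
    exact neg_mem (ha _ hp)

/-- The defining conditions are linear equations in torsion-free groups. This permits the division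
by `n + 1` in `newton_mem`. -/
theorem mem_dualPairs_of_natCast_mul {p : MvPolynomial (Fin N) ℤ × MvPolynomial (Fin M) ℤ} {n : ℕ}
    (hn : n ≠ 0) (h : (n : MvPolynomial (Fin N) ℤ × MvPolynomial (Fin M) ℤ) * p ∈ dualPairs N M) :
    p ∈ dualPairs N M := by
  rw [← nsmul_eq_mul] at h
  obtain ⟨h1, h2, h3⟩ := h
  refine ⟨fun σ => ?_, fun σ => ?_, fun π => ?_⟩
  · have := h1 σ
    rw [Prod.smul_fst, map_nsmul] at this
    exact nsmul_right_injective hn this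
  · have := h2 σ
    rw [Prod.smul_snd, map_nsmul] at this
    exact nsmul_right_injective hn this
  · have := h3 π
    rw [Prod.smul_fst, Prod.smul_snd, map_nsmul, map_nsmul, mul_smul_comm] at this
    exact nsmul_right_injective hn this

theorem mem_dualMultipliers_of_natCast_mul (n : ℕ)
    (a : MvPolynomial (Fin N) ℤ × MvPolynomial (Fin M) ℤ)
    (hn : n ≠ 0) (h : (n : MvPolynomial (Fin N) ℤ × MvPolynomial (Fin M) ℤ) * a ∈
      dualMultipliers N M) : a ∈ dualMultipliers N M := fun p hp =>
  mem_dualPairs_of_natCast_mul hn (by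
    rw [← mul_assoc]
    exact h p hp)

theorem psum_mem_dualMultipliers (N M : ℕ) {r : ℕ} (hr : 0 < r) :
    (∑ i, MvPolynomial.X i ^ r, -∑ i, MvPolynomial.X i ^ r) ∈ dualMultipliers N M :=
  fun _ hp => mul_psum_mem_dualPairs hp hr

/-- Replacing every `p_r` by `-p_r` inverts the generating function of the `h_m`, which leaves `∑
(-1)^m e_m t^m`. The version in `x_i^(k+1)` is needed for the power sums of the monomials of degree
`m`. -/
theorem hfam_pow_mem_dualMultipliers (N M k m : ℕ) :
    (hfam (fun i : Fin N => (MvPolynomial.X i : MvPolynomial (Fin N) ℤ) ^ (k + 1)) m,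
      (-1) ^ m * efam (fun i : Fin M => (MvPolynomial.X i : MvPolynomial (Fin M) ℤ) ^ (k + 1)) m) ∈
      dualMultipliers N M := by
  refine newton_mem (dualMultipliers N M) mem_dualMultipliers_of_natCast_mul
    (p := fun j => (∑ i, MvPolynomial.X i ^ ((k + 1) * (j + 1)),
      -∑ i, MvPolynomial.X i ^ ((k + 1) * (j + 1))))
    (a := fun m => (hfam (fun i : Fin N => (MvPolynomial.X i : MvPolynomial (Fin N) ℤ) ^ (k + 1)) m,
      (-1) ^ m * efam (fun i : Fin M => (MvPolynomial.X i : MvPolynomial (Fin M) ℤ) ^ (k + 1)) m))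
    ?_ (fun j => psum_mem_dualMultipliers N M (by positivity)) (fun n => ?_) m
  · simp only [hfam_zero, efam_zero, pow_zero, mul_one]
    exact (dualMultipliers N M).one_mem
  · apply Prod.ext
    · simp only [Prod.fst_mul, Prod.fst_natCast, mul_hfam_succ, Prod.fst_sum, pow_mul]
    · simp only [Prod.snd_mul, Prod.snd_natCast, Prod.snd_sum, pow_mul]
      rw [mul_left_comm, mul_efam_succ, Finset.mul_sum]
      refine Finset.sum_congr rfl fun j hj => ?_
      have hj' := Finset.mem_range.1 hj
      obtain ⟨d, rfl⟩ : ∃ d, n = j + d := ⟨n - j, by omega⟩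
      have : (-1 : MvPolynomial (Fin M) ℤ) ^ (j + d + 1) * (-1) ^ j = - (-1) ^ d := by
        have : j + d + 1 + j = 2 * j + (d + 1) := by ring
        rw [← pow_add, this, pow_add, pow_mul]
        simp [pow_succ]
      rw [Nat.add_sub_cancel_left, ← mul_assoc, ← mul_assoc, this]
      ring

end Duality

/-! ### Removing one variable from an alternant. -/

section Telescope

variable {R : Type*} [CommRing R]

/-- The alternant `det (x_i ^ (l_j + N - 1 - j))`. -/
def alternant {N : ℕ} (x : Fin N → R) (l : Fin N → ℕ) : R :=
  (Matrix.of fun i j : Fin N => x i ^ (l j + (N - 1 - j))).det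

theorem pow_sub_pow_eq_mul_sum_Icc (x q : R) {a b : ℕ} (h : b ≤ a) :
    x ^ (a + 1) - q ^ (a - b + 1) * x ^ b = (x - q) * ∑ r ∈ Icc b a, x ^ r * q ^ (a - r) := by
  obtain ⟨d, rfl⟩ := Nat.exists_eq_add_of_le h
  have h1 : ∑ r ∈ Icc b (b + d), x ^ r * q ^ (b + d - r) =
      x ^ b * ∑ k ∈ range (d + 1), x ^ k * q ^ (d - k) := by
    rw [← Finset.Ico_add_one_right_eq_Icc, Finset.sum_Ico_eq_sum_range, Finset.mul_sum]
    have : b + d + 1 - b = d + 1 := by omega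
    rw [this]
    refine Finset.sum_congr rfl fun k _ => ?_
    rw [Nat.add_sub_add_left, pow_add, mul_assoc]
  have h2 := Commute.mul_geom_sum₂ (Commute.all x q) (d + 1)
  simp only [Nat.add_sub_cancel] at h2
  rw [h1, mul_left_comm, h2, Nat.add_sub_cancel_left]
  ring

theorem det_sum_columns {N : ℕ} (t : Fin N → Finset ℕ) (F : Fin N → Fin N → ℕ → R) :
    (Matrix.of fun i j => ∑ r ∈ t j, F i j r).det =
      ∑ r ∈ Fintype.piFinset t, (Matrix.of fun i j => F i j (r j)).det := by
  simp only [Matrix.det_apply', Matrix.of_apply, Finset.prod_univ_sum, Finset.mul_sum]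
  rw [Finset.sum_comm]

/-- Let `q` be the last variable. Subtracting from each column a multiple of its neighbour clears
the row of `q` but for one entry, and `x_i - q` splits off every other row. The quotients are
geometric sums, which produce the sequences `r` interlacing with `l`. -/
theorem alternant_succ {N : ℕ} (x : Fin (N + 1) → R) {l : Fin (N + 1) → ℕ} (hl : Antitone l) :
    alternant x l = (∏ i : Fin N, (x i.castSucc - x (Fin.last N))) *
      ∑ r ∈ Fintype.piFinset fun j : Fin N => Icc (l j.succ) (l j.castSucc),
        x (Fin.last N) ^ (l (Fin.last N) + ∑ j : Fin N, (l j.castSucc - r j)) *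
          alternant (fun i : Fin N => x i.castSucc) r := by
  set q := x (Fin.last N) with hq
  -- Reversing rows and columns puts `q` in row `0` and makes the column operations refer to the
  -- preceding column.
  let A : Matrix (Fin (N + 1)) (Fin (N + 1)) R :=
    Matrix.of fun i j => x i.rev ^ (l j.rev + j)
  let G : Fin N → Fin N → R := fun i j =>
    ∑ r ∈ Icc (l j.rev.succ) (l j.rev.castSucc), x i.rev.castSucc ^ (r + j) *
      q ^ (l j.rev.castSucc - r)
  let g : R → Fin N → R := fun y j =>
    ∑ r ∈ Icc (l j.rev.succ) (l j.rev.castSucc), y ^ (r + j) *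
      q ^ (l j.rev.castSucc - r)
  let B : Matrix (Fin (N + 1)) (Fin (N + 1)) R :=
    Matrix.of fun i => Fin.cases (A i 0) fun j => (x i.rev - q) * g (x i.rev) j
  have h1 : alternant x l = A.det := by
    rw [alternant, ← Matrix.det_submatrix_equiv_self Fin.revPerm]
    congr 1
    ext i j
    simp only [Matrix.submatrix_apply, Matrix.of_apply, Fin.revPerm_apply, A, Fin.val_rev]
    congr 2
    have := j.2
    omega
  have h2 : A.det = B.det := by
    refine Matrix.det_eq_of_forall_col_eq_smul_add_pred
      (fun j => q ^ (l j.rev.castSucc - l j.rev.succ + 1)) (fun i => by simp [B]) ?_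
    intro i j
    simp only [B, A, g, Matrix.of_apply, Fin.cases_succ, Fin.rev_succ, Fin.rev_castSucc]
    have h := pow_sub_pow_eq_mul_sum_Icc (x i.rev) q
      (hl (show j.rev.castSucc ≤ j.rev.succ from Fin.castSucc_lt_succ.le))
    have h' : ∑ r ∈ Icc (l j.rev.succ) (l j.rev.castSucc), x i.rev ^ (r + (j : ℕ)) *
        q ^ (l j.rev.castSucc - r) = x i.rev ^ (j : ℕ) *
        ∑ r ∈ Icc (l j.rev.succ) (l j.rev.castSucc), x i.rev ^ r *
        q ^ (l j.rev.castSucc - r) := by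
      rw [Finset.mul_sum]
      refine Finset.sum_congr rfl fun r _ => ?_
      rw [pow_add]
      ring
    rw [h', mul_left_comm, ← h]
    simp only [Fin.val_succ, Fin.val_castSucc]
    ring
  have h3 : B.det = q ^ l (Fin.last N) * ((∏ i : Fin N, (x i.castSucc - q)) *
      (Matrix.of G).det) := by
    rw [Matrix.det_succ_row_zero, Finset.sum_eq_single 0]
    · have : B.submatrix Fin.succ (Fin.succAbove 0) =
          Matrix.of fun i j => (x i.rev.castSucc - q) * Matrix.of G i j := by
        ext i j
        simp [B, G, g, Fin.rev_succ]
      rw [this, Matrix.det_mul_column]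
      have h4 : ∏ i : Fin N, (x i.rev.castSucc - q) = ∏ i : Fin N, (x i.castSucc - q) :=
        Fintype.prod_equiv Fin.revPerm _ _ fun i => rfl
      rw [h4]
      simp [B, A, hq]
    · intro j _ hj
      obtain ⟨k, rfl⟩ := Fin.exists_succ_eq.2 hj
      simp [B, hq]
    · simp
  have h4 : (Matrix.of G).det = ∑ r ∈ Fintype.piFinset fun j : Fin N =>
      Icc (l j.succ) (l j.castSucc), q ^ (∑ j : Fin N, (l j.castSucc - r j)) *
          alternant (fun i : Fin N => x i.castSucc) r := by
    rw [← Matrix.det_submatrix_equiv_self Fin.revPerm]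
    have h5 : (Matrix.of G).submatrix Fin.revPerm Fin.revPerm = Matrix.of fun i j : Fin N =>
        ∑ r ∈ Icc (l j.succ) (l j.castSucc), q ^ (l j.castSucc - r) *
          x i.castSucc ^ (r + (N - 1 - j)) := by
      ext i j
      simp only [Matrix.submatrix_apply, Matrix.of_apply, Fin.revPerm_apply, G, Fin.val_rev,
        Fin.rev_rev]
      refine Finset.sum_congr rfl fun r _ => ?_
      rw [mul_comm, Nat.sub_add_eq, Nat.sub_right_comm]
    rw [h5, det_sum_columns]
    refine Finset.sum_congr rfl fun r _ => ?_
    rw [← Finset.prod_pow_eq_pow_sum, alternant]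
    exact Matrix.det_mul_row (fun j => q ^ (l j.castSucc - r j))
      (Matrix.of fun i j : Fin N => x i.castSucc ^ (r j + (N - 1 - j)))
  rw [h1, h2, h3, h4, mul_left_comm, Finset.mul_sum]
  congr 1
  refine Finset.sum_congr rfl fun r _ => ?_
  rw [pow_add, mul_assoc]

theorem alternant_succ_zero {N : ℕ} (x : Fin (N + 1) → R) :
    alternant x 0 = (∏ i : Fin N, (x i.castSucc - x (Fin.last N))) *
      alternant (fun i : Fin N => x i.castSucc) 0 := by
  rw [alternant_succ x (l := 0) (fun _ _ _ => le_rfl)]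
  congr 1
  have : (Fintype.piFinset fun j : Fin N => Icc ((0 : Fin (N + 1) → ℕ) j.succ)
      ((0 : Fin (N + 1) → ℕ) j.castSucc)) = {0} := by
    ext r
    simp [funext_iff]
  rw [this, Finset.sum_singleton]
  simp

theorem map_alternant {S : Type*} [CommRing S] (φ : R →+* S) {N : ℕ} (x : Fin N → R)
    (l : Fin N → ℕ) : φ (alternant x l) = alternant (fun i => φ (x i)) l := by
  rw [alternant, alternant, RingHom.map_det]
  congr 1
  ext i j
  simp

end Telescope

/-! ### Diagrams with prescribed rows. -/

section Diagrams

/-- The diagram with rows `r_0, …, r_{N-1}` if `r` is weakly decreasing. -/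
def ofRows {N : ℕ} (r : Fin N → ℕ) : YoungDiagram where
  cells := (range N ×ˢ range (∑ i, r i)).filter fun c => ∀ i : Fin N, (i : ℕ) ≤ c.1 → c.2 < r i
  isLowerSet := by
    rintro ⟨a, b⟩ ⟨c, d⟩ ⟨hca, hdb⟩ h
    simp only [coe_filter, mem_product, mem_range, Set.mem_ofPred_eq] at h ⊢
    simp only at hca hdb
    exact ⟨⟨by omega, by omega⟩, fun i hi => lt_of_le_of_lt hdb (h.2 i (by omega))⟩

theorem mem_ofRows {N : ℕ} {r : Fin N → ℕ} (hr : Antitone r) {i j : ℕ} :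
    (i, j) ∈ ofRows r ↔ ∃ h : i < N, j < r ⟨i, h⟩ := by
  rw [← YoungDiagram.mem_cells]
  simp only [ofRows, mem_filter, mem_product, mem_range]
  constructor
  · rintro ⟨⟨h, _⟩, h2⟩
    exact ⟨h, h2 ⟨i, h⟩ le_rfl⟩
  · rintro ⟨h, hj⟩
    refine ⟨⟨h, hj.trans_le ?_⟩, fun k hk => hj.trans_le (hr (show k ≤ ⟨i, h⟩ from hk))⟩
    exact Finset.single_le_sum (f := r) (fun _ _ => Nat.zero_le _) (mem_univ _)

theorem rowLen_ofRows {N : ℕ} {r : Fin N → ℕ} (hr : Antitone r) (i : Fin N) :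
    (ofRows r).rowLen i = r i := by
  apply le_antisymm
  · by_contra h
    push Not at h
    rw [← YoungDiagram.mem_iff_lt_rowLen, mem_ofRows hr] at h
    exact absurd h.2 (lt_irrefl _)
  · by_contra h
    push Not at h
    exact absurd (YoungDiagram.mem_iff_lt_rowLen.1 ((mem_ofRows hr).2 ⟨i.2, h⟩)) (lt_irrefl _)

theorem colLen_le_iff {μ : YoungDiagram} {N : ℕ} :
    μ.colLen 0 ≤ N ↔ ∀ i j, (i, j) ∈ μ → i < N := by
  constructor
  · intro h i j hm
    have := YoungDiagram.mem_iff_lt_colLen.1 hm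
    have := μ.colLen_anti 0 j (Nat.zero_le j)
    omega
  · intro h
    by_contra hN
    push Not at hN
    exact absurd (h _ _ (YoungDiagram.mem_iff_lt_colLen.2 hN)) (lt_irrefl _)

theorem colLen_ofRows {N : ℕ} {r : Fin N → ℕ} (hr : Antitone r) :
    (ofRows r).colLen 0 ≤ N :=
  colLen_le_iff.2 fun _ _ h => ((mem_ofRows hr).1 h).1

theorem card_eq_sum_rowLen {μ : YoungDiagram} {N : ℕ} (h : μ.colLen 0 ≤ N) :
    μ.card = ∑ i : Fin N, μ.rowLen i := by
  have h1 := Finset.card_eq_sum_card_fiberwise (s := μ.cells) (t := range N) (f := Prod.fst)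
    (fun c hc => mem_coe.2 (mem_range.2 (colLen_le_iff.1 h c.1 c.2 ((YoungDiagram.mem_cells _).1 hc))))
  rw [YoungDiagram.card, h1, Finset.sum_range]
  refine Finset.sum_congr rfl fun i _ => ?_
  rw [YoungDiagram.rowLen_eq_card]
  rfl

theorem eq_of_rowLen_eq {μ ν : YoungDiagram} {N : ℕ} (hμ : μ.colLen 0 ≤ N) (hν : ν.colLen 0 ≤ N)
    (h : ∀ i : Fin N, μ.rowLen i = ν.rowLen i) : μ = ν := by
  ext ⟨i, j⟩
  rw [YoungDiagram.mem_cells, YoungDiagram.mem_cells]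
  constructor
  · intro hm
    have := h ⟨i, colLen_le_iff.1 hμ _ _ hm⟩
    rw [YoungDiagram.mem_iff_lt_rowLen] at hm ⊢
    exact this ▸ hm
  · intro hm
    have := h ⟨i, colLen_le_iff.1 hν _ _ hm⟩
    rw [YoungDiagram.mem_iff_lt_rowLen] at hm ⊢
    exact this ▸ hm

end Diagrams

/-! ### Branching of tableaux and the bialternant formula. -/

section Branching

variable {μ : YoungDiagram} {N : ℕ}

theorem eq_range_card {S : Finset ℕ} (h : ∀ a ∈ S, ∀ b < a, b ∈ S) : S = range S.card := by
  ext b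
  rw [mem_range]
  constructor
  · intro hb
    have : range (b + 1) ⊆ S := by
      intro c hc
      rw [mem_range] at hc
      rcases Nat.lt_succ_iff_lt_or_eq.1 hc with h1 | h1
      · exact h b hb c h1
      · exact h1 ▸ hb
    have := card_le_card this
    rw [card_range] at this
    omega
  · intro hb
    by_contra hn
    have : S ⊆ range b := by
      intro c hc
      rw [mem_range]
      by_contra hcb
      rcases Nat.lt_or_eq_of_le (not_lt.1 hcb) with h1 | h1
      · exact hn (h c hc b h1)
      · exact hn (h1 ▸ hc)
    have := card_le_card this
    rw [card_range] at this
    omega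

/-- The number of entries less than `N` in row `j`. -/
def smallLen (T : BoundedSSYT μ (N + 1)) (j : Fin N) : ℕ :=
  ((range (μ.rowLen j)).filter fun b => T.1 j b < N).card

theorem filter_eq_range_smallLen (T : BoundedSSYT μ (N + 1)) (j : Fin N) :
    ((range (μ.rowLen j)).filter fun b => T.1 j b < N) = range (smallLen T j) := by
  refine eq_range_card fun a ha b hb => ?_
  rw [mem_filter, mem_range] at ha ⊢
  exact ⟨hb.trans ha.1, (T.1.row_weak hb (YoungDiagram.mem_iff_lt_rowLen.2 ha.1)).trans_lt ha.2⟩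

theorem entry_lt_iff (T : BoundedSSYT μ (N + 1)) {j : Fin N} {b : ℕ} (h : ((j : ℕ), b) ∈ μ) :
    T.1 j b < N ↔ b < smallLen T j := by
  have h1 := Finset.ext_iff.1 (filter_eq_range_smallLen T j) b
  rw [mem_filter, mem_range, mem_range] at h1
  have h2 := YoungDiagram.mem_iff_lt_rowLen.1 h
  tauto

theorem le_entry (T : SemistandardYoungTableau μ) {i j : ℕ} (h : (i, j) ∈ μ) : i ≤ T i j := by
  induction i with
  | zero => exact Nat.zero_le _
  | succ i ih =>
    have h1 := ih (μ.up_left_mem (Nat.le_succ i) le_rfl h)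
    have h2 := T.col_strict (show i < i + 1 by omega) h
    omega

theorem BoundedSSYT.apply_lt {N : ℕ} (T : BoundedSSYT μ N) {i j : ℕ} (h : (i, j) ∈ μ) :
    T.1 i j < N :=
  T.2 (i, j) ((YoungDiagram.mem_cells _).2 h)

/-- The numbers of entries less than `N` interlace with the row lengths. -/
theorem smallLen_mem (T : BoundedSSYT μ (N + 1)) : smallLen T ∈
    Fintype.piFinset fun j : Fin N => Icc (μ.rowLen (j + 1)) (μ.rowLen j) := by
  rw [Fintype.mem_piFinset]
  intro j
  rw [mem_Icc]
  constructor
  · by_contra h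
    push Not at h
    have h1 : ((j : ℕ) + 1, smallLen T j) ∈ μ := YoungDiagram.mem_iff_lt_rowLen.2 h
    have h2 : ((j : ℕ), smallLen T j) ∈ μ := μ.up_left_mem (Nat.le_succ _) le_rfl h1
    have h3 := T.1.col_strict (show (j : ℕ) < j + 1 by omega) h1
    have h4 := T.apply_lt h1
    exact absurd ((entry_lt_iff T h2).1 (by omega)) (lt_irrefl _)
  · exact (card_filter_le _ _).trans (card_range _).le

theorem antitone_of_mem_interlace {r : Fin N → ℕ}
    (hr : r ∈ Fintype.piFinset fun j : Fin N => Icc (μ.rowLen (j + 1)) (μ.rowLen j)) :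
    Antitone r := by
  intro i j hij
  rcases hij.eq_or_lt with rfl | h
  · exact le_rfl
  · rw [Fintype.mem_piFinset] at hr
    exact (mem_Icc.1 (hr j)).2.trans ((μ.rowLen_anti _ _ h).trans (mem_Icc.1 (hr i)).1)

theorem mem_of_mem_ofRows {r : Fin N → ℕ}
    (hr : r ∈ Fintype.piFinset fun j : Fin N => Icc (μ.rowLen (j + 1)) (μ.rowLen j))
    {i j : ℕ} (h : (i, j) ∈ ofRows r) : (i, j) ∈ μ := by
  obtain ⟨hi, hj⟩ := (mem_ofRows (antitone_of_mem_interlace hr)).1 h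
  rw [Fintype.mem_piFinset] at hr
  exact YoungDiagram.mem_iff_lt_rowLen.2 (hj.trans_le (mem_Icc.1 (hr ⟨i, hi⟩)).2)

theorem mem_ofRows_of_succ_mem {r : Fin N → ℕ}
    (hr : r ∈ Fintype.piFinset fun j : Fin N => Icc (μ.rowLen (j + 1)) (μ.rowLen j))
    {i j : ℕ} (hi : i < N) (h : (i + 1, j) ∈ μ) :
    (i, j) ∈ ofRows r := by
  refine (mem_ofRows (antitone_of_mem_interlace hr)).2 ⟨hi, ?_⟩
  rw [Fintype.mem_piFinset] at hr
  exact (YoungDiagram.mem_iff_lt_rowLen.1 h).trans_le (mem_Icc.1 (hr ⟨i, hi⟩)).1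

/-- Filling the boxes outside the rows `r` with the largest entry `N`. -/
def extendSSYT (hμ : μ.colLen 0 ≤ N + 1) {r : Fin N → ℕ}
    (hr : r ∈ Fintype.piFinset fun j : Fin N => Icc (μ.rowLen (j + 1)) (μ.rowLen j))
    (T : BoundedSSYT (ofRows r) N) : BoundedSSYT μ (N + 1) :=
  ⟨{ entry := fun i j => if (i, j) ∈ ofRows r then T.1 i j else if (i, j) ∈ μ then N else 0
     row_weak' := by
      intro i j1 j2 hj h
      have h1 := μ.up_left_mem le_rfl hj.le h
      by_cases h2 : (i, j2) ∈ ofRows r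
      · rw [if_pos h2, if_pos ((ofRows r).up_left_mem le_rfl hj.le h2)]
        exact T.1.row_weak hj h2
      · rw [if_neg h2, if_pos h]
        split_ifs with h3
        · exact (T.apply_lt h3).le
        · exact le_rfl
     col_strict' := by
      intro i1 i2 j hi h
      by_cases h2 : (i2, j) ∈ ofRows r
      · rw [if_pos h2, if_pos ((ofRows r).up_left_mem hi.le le_rfl h2)]
        exact T.1.col_strict hi h2
      · have h4 := colLen_le_iff.1 hμ _ _ h
        -- By interlacing, every box of `μ` that has a box of `μ` below it lies in `ofRows r`, so no
        -- column contains the entry `N` twice.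
        have h3 := mem_ofRows_of_succ_mem hr (show i1 < N by omega) (μ.up_left_mem hi le_rfl h)
        rw [if_neg h2, if_pos h, if_pos h3]
        exact T.apply_lt h3
     zeros' := by
      intro i j h
      rw [if_neg (fun h' => h (mem_of_mem_ofRows hr h')), if_neg h] }, by
    rintro ⟨i, j⟩ h
    change (if (i, j) ∈ ofRows r then T.1 i j else if (i, j) ∈ μ then N else 0) < N + 1
    split_ifs with h1
    · exact (T.apply_lt h1).trans (Nat.lt_succ_self N)
    · exact Nat.lt_succ_self N
    · exact Nat.succ_pos N⟩

theorem extendSSYT_apply (hμ : μ.colLen 0 ≤ N + 1) {r : Fin N → ℕ}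
    (hr : r ∈ Fintype.piFinset fun j : Fin N => Icc (μ.rowLen (j + 1)) (μ.rowLen j))
    (T : BoundedSSYT (ofRows r) N) (i j : ℕ) : (extendSSYT hμ hr T).1 i j =
      if (i, j) ∈ ofRows r then T.1 i j else if (i, j) ∈ μ then N else 0 :=
  rfl

/-- The entries less than `N`. -/
def restrictSSYT {r : Fin N → ℕ}
    (hr : r ∈ Fintype.piFinset fun j : Fin N => Icc (μ.rowLen (j + 1)) (μ.rowLen j))
    (T : BoundedSSYT μ (N + 1)) (hT : smallLen T = r) : BoundedSSYT (ofRows r) N :=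
  ⟨{ entry := fun i j => if (i, j) ∈ ofRows r then T.1 i j else 0
     row_weak' := by
      intro i j1 j2 hj h
      rw [if_pos h, if_pos ((ofRows r).up_left_mem le_rfl hj.le h)]
      exact T.1.row_weak hj (mem_of_mem_ofRows hr h)
     col_strict' := by
      intro i1 i2 j hi h
      rw [if_pos h, if_pos ((ofRows r).up_left_mem hi.le le_rfl h)]
      exact T.1.col_strict hi (mem_of_mem_ofRows hr h)
     zeros' := fun h => if_neg h }, by
    rintro ⟨i, j⟩ h
    rw [YoungDiagram.mem_cells] at h
    change (if (i, j) ∈ ofRows r then T.1 i j else 0) < N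
    rw [if_pos h]
    obtain ⟨hi, hj⟩ := (mem_ofRows (antitone_of_mem_interlace hr)).1 h
    exact (entry_lt_iff T (j := ⟨i, hi⟩) (mem_of_mem_ofRows hr h)).2 (hT ▸ hj)⟩

theorem restrictSSYT_apply {r : Fin N → ℕ}
    (hr : r ∈ Fintype.piFinset fun j : Fin N => Icc (μ.rowLen (j + 1)) (μ.rowLen j))
    (T : BoundedSSYT μ (N + 1)) (hT : smallLen T = r) (i j : ℕ) :
    (restrictSSYT hr T hT).1 i j = if (i, j) ∈ ofRows r then T.1 i j else 0 :=
  rfl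

theorem smallLen_extendSSYT (hμ : μ.colLen 0 ≤ N + 1) {r : Fin N → ℕ}
    (hr : r ∈ Fintype.piFinset fun j : Fin N => Icc (μ.rowLen (j + 1)) (μ.rowLen j))
    (T : BoundedSSYT (ofRows r) N) : smallLen (extendSSYT hμ hr T) = r := by
  funext j
  have h : ((range (μ.rowLen j)).filter fun b => (extendSSYT hμ hr T).1 j b < N) =
      range (r j) := by
    ext b
    rw [mem_filter, mem_range, mem_range, extendSSYT_apply]
    constructor
    · rintro ⟨h1, h2⟩
      by_contra h3
      rw [if_neg, if_pos (YoungDiagram.mem_iff_lt_rowLen.2 h1)] at h2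
      · exact absurd h2 (lt_irrefl _)
      · rw [mem_ofRows (antitone_of_mem_interlace hr)]
        rintro ⟨_, h4⟩
        exact h3 h4
    · intro h1
      have h2 : ((j : ℕ), b) ∈ ofRows r := (mem_ofRows (antitone_of_mem_interlace hr)).2 ⟨j.2, h1⟩
      refine ⟨YoungDiagram.mem_iff_lt_rowLen.1 (mem_of_mem_ofRows hr h2), ?_⟩
      rw [if_pos h2]
      exact T.apply_lt h2
  rw [smallLen, h, card_range]

theorem extendSSYT_restrictSSYT (hμ : μ.colLen 0 ≤ N + 1) {r : Fin N → ℕ}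
    (hr : r ∈ Fintype.piFinset fun j : Fin N => Icc (μ.rowLen (j + 1)) (μ.rowLen j))
    (T : BoundedSSYT μ (N + 1)) (hT : smallLen T = r) :
    extendSSYT hμ hr (restrictSSYT hr T hT) = T := by
  apply Subtype.ext
  apply SemistandardYoungTableau.ext
  intro i j
  rw [extendSSYT_apply, restrictSSYT_apply]
  split_ifs with h1 h2
  · rfl
  · have h3 := T.apply_lt h2
    have h4 : ¬ T.1 i j < N := by
      by_cases hi : i < N
      · rw [entry_lt_iff T (j := ⟨i, hi⟩) h2, hT]
        intro h
        exact h1 ((mem_ofRows (antitone_of_mem_interlace hr)).2 ⟨hi, h⟩)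
      -- Row `N` is not recorded by `smallLen`, but column strictness makes its entries at least
      -- `N`.
      · have := le_entry T.1 h2
        omega
    omega
  · exact (T.1.zeros h2).symm

theorem restrictSSYT_extendSSYT (hμ : μ.colLen 0 ≤ N + 1) {r : Fin N → ℕ}
    (hr : r ∈ Fintype.piFinset fun j : Fin N => Icc (μ.rowLen (j + 1)) (μ.rowLen j))
    (T : BoundedSSYT (ofRows r) N) :
    restrictSSYT hr (extendSSYT hμ hr T) (smallLen_extendSSYT hμ hr T) = T := by
  apply Subtype.ext
  apply SemistandardYoungTableau.ext
  intro i j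
  rw [restrictSSYT_apply, extendSSYT_apply]
  split_ifs with h1
  · rfl
  · exact (T.1.zeros h1).symm

/-- The variable with a natural number as index, zero out of range. -/
def natVar (N k : ℕ) : MvPolynomial (Fin N) ℤ :=
  if h : k < N then MvPolynomial.X ⟨k, h⟩ else 0

theorem weight_eq_prod {N : ℕ} (T : BoundedSSYT μ N) :
    T.weight = ∏ c ∈ μ.cells, natVar N (T.1 c.1 c.2) := by
  rw [← Finset.prod_coe_sort, BoundedSSYT.weight]
  refine Finset.prod_congr rfl fun c _ => ?_
  rw [natVar, dif_pos (T.2 c.1 c.2)]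
  rfl

theorem rename_natVar {k : ℕ} (h : k < N) :
    MvPolynomial.rename Fin.castSucc (natVar N k) = natVar (N + 1) k := by
  rw [natVar, natVar, dif_pos h, dif_pos (h.trans (Nat.lt_succ_self N)), MvPolynomial.rename_X]
  rfl

theorem natVar_last : natVar (N + 1) N = MvPolynomial.X (Fin.last N) := by
  rw [natVar, dif_pos (Nat.lt_succ_self N)]
  rfl

theorem weight_extendSSYT (hμ : μ.colLen 0 ≤ N + 1) {r : Fin N → ℕ}
    (hr : r ∈ Fintype.piFinset fun j : Fin N => Icc (μ.rowLen (j + 1)) (μ.rowLen j))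
    (T : BoundedSSYT (ofRows r) N) : (extendSSYT hμ hr T).weight =
      MvPolynomial.X (Fin.last N) ^ (μ.card - (ofRows r).card) *
        MvPolynomial.rename Fin.castSucc T.weight := by
  have hsub : (ofRows r).cells ⊆ μ.cells := fun c hc =>
    (YoungDiagram.mem_cells _).2 (mem_of_mem_ofRows hr ((YoungDiagram.mem_cells _).1 hc))
  rw [weight_eq_prod, weight_eq_prod, ← Finset.prod_sdiff hsub, map_prod]
  congr 1
  · rw [Finset.prod_congr rfl (g := fun _ => MvPolynomial.X (Fin.last N)), Finset.prod_const,
      Finset.card_sdiff_of_subset hsub]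
    intro c hc
    rw [mem_sdiff, YoungDiagram.mem_cells, YoungDiagram.mem_cells] at hc
    rw [extendSSYT_apply, if_neg hc.2, if_pos hc.1, natVar_last]
  · refine Finset.prod_congr rfl fun c hc => ?_
    rw [YoungDiagram.mem_cells] at hc
    rw [extendSSYT_apply, if_pos hc, rename_natVar (T.apply_lt hc)]

/-- The branching rule for Schur polynomials. -/
theorem schur_succ (hμ : μ.colLen 0 ≤ N + 1) :
    schur μ (N + 1) =
      ∑ r ∈ Fintype.piFinset fun j : Fin N => Icc (μ.rowLen (j + 1)) (μ.rowLen j),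
        MvPolynomial.X (Fin.last N) ^ (μ.card - (ofRows r).card) *
          MvPolynomial.rename Fin.castSucc (schur (ofRows r) N) := by
  rw [schur, ← Finset.sum_fiberwise_of_maps_to (fun T _ => smallLen_mem T)]
  refine Finset.sum_congr rfl fun r hr => ?_
  rw [schur, map_sum, Finset.mul_sum]
  symm
  refine Finset.sum_bij' (fun T _ => extendSSYT hμ hr T)
    (fun T hT => restrictSSYT hr T (mem_filter.1 hT).2) ?_ ?_ ?_ ?_ ?_
  · intro T _
    exact mem_filter.2 ⟨mem_univ _, smallLen_extendSSYT hμ hr T⟩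
  · intro T _
    exact mem_univ _
  · intro T _
    exact restrictSSYT_extendSSYT hμ hr T
  · intro T hT
    exact extendSSYT_restrictSSYT hμ hr T _
  · intro T _
    exact (weight_extendSSYT hμ hr T).symm

theorem schur_of_cells_eq_empty (h : μ.cells = ∅) : schur μ N = 1 := by
  have h1 : μ = ⊥ := by
    ext c
    rw [h]
    simp
  subst h1
  have h2 : ∀ T : BoundedSSYT ⊥ N, T.weight = 1 := fun T => by
    rw [weight_eq_prod]
    simp
  have : Subsingleton (BoundedSSYT ⊥ N) := by
    refine ⟨fun S T => BoundedSSYT.entry_injective _ _ (funext fun c => ?_)⟩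
    exact (YoungDiagram.notMem_bot _ ((YoungDiagram.mem_cells _).1 c.2)).elim
  let T₀ : BoundedSSYT ⊥ N := ⟨SemistandardYoungTableau.highestWeight ⊥, fun c hc => by
    simp at hc⟩
  rw [schur, Finset.sum_congr rfl (fun T _ => h2 T)]
  have : (univ : Finset (BoundedSSYT ⊥ N)) = {T₀} := by
    ext T
    simp [Subsingleton.elim T T₀]
  rw [this]
  simp

/-- The bialternant formula. -/
theorem alternant_rowLen (N : ℕ) (μ : YoungDiagram) (hμ : μ.colLen 0 ≤ N) :
    alternant (fun i : Fin N => (MvPolynomial.X i : MvPolynomial (Fin N) ℤ))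
      (fun j => μ.rowLen j) =
    alternant (fun i : Fin N => (MvPolynomial.X i : MvPolynomial (Fin N) ℤ)) 0 * schur μ N := by
  induction N generalizing μ with
  | zero =>
    have h : μ.cells = ∅ := by
      rw [Finset.eq_empty_iff_forall_notMem]
      rintro ⟨i, j⟩ h
      exact absurd (colLen_le_iff.1 hμ _ _ ((YoungDiagram.mem_cells _).1 h)) (Nat.not_lt_zero _)
    rw [schur_of_cells_eq_empty h]
    simp [alternant]
  | succ N ih =>
    have hanti : Antitone fun j : Fin (N + 1) => μ.rowLen j := fun i j h => μ.rowLen_anti _ _ h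
    -- Alternants and tableaux branch over the same interlacing sequences; the product of the `x_i -
    -- x_N` is common to both sides.
    rw [alternant_succ _ hanti, alternant_succ_zero, schur_succ hμ, mul_assoc]
    refine congrArg (_ * ·) ?_
    rw [Finset.mul_sum]
    simp only [Fin.val_succ, Fin.val_castSucc, Fin.val_last]
    refine Finset.sum_congr rfl fun r hr => ?_
    have hr' := antitone_of_mem_interlace hr
    have h0 : ∀ l : Fin N → ℕ, alternant
        (fun i : Fin N => (MvPolynomial.X i.castSucc : MvPolynomial (Fin (N + 1)) ℤ)) l =
        MvPolynomial.rename Fin.castSucc (alternant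
          (fun i : Fin N => (MvPolynomial.X i : MvPolynomial (Fin N) ℤ)) l) := by
      intro l
      have := map_alternant (MvPolynomial.rename (R := ℤ) (Fin.castSucc (n := N))).toRingHom
        (fun i : Fin N => (MvPolynomial.X i : MvPolynomial (Fin N) ℤ)) l
      simpa using this.symm
    have h1 := ih (ofRows r) (colLen_ofRows hr')
    simp only [rowLen_ofRows hr'] at h1
    have h2 : μ.rowLen N + ∑ j : Fin N, (μ.rowLen j - r j) = μ.card - (ofRows r).card := by
      rw [card_eq_sum_rowLen hμ, card_eq_sum_rowLen (colLen_ofRows hr'), Fin.sum_univ_castSucc]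
      simp only [rowLen_ofRows hr', Fin.val_castSucc, Fin.val_last]
      rw [Finset.sum_tsub_distrib]
      · have : ∑ j : Fin N, r j ≤ ∑ j : Fin N, μ.rowLen j :=
          Finset.sum_le_sum fun j _ => (mem_Icc.1 (Fintype.mem_piFinset.1 hr j)).2
        omega
      · intro j _
        exact (mem_Icc.1 (Fintype.mem_piFinset.1 hr j)).2
    rw [h0, h0, h1, h2, map_mul]
    ring

end Branching

/-! ### Schur coefficients: extraction, completeness and stability. -/

section Expansion

variable {N : ℕ}

/-- The strictly decreasing sequence `μ + δ`. -/
def shifted (N : ℕ) (μ : YoungDiagram) (i : Fin N) : ℤ := μ.rowLen i + stair N i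

theorem shifted_strictAnti (N : ℕ) (μ : YoungDiagram) : StrictAnti (shifted N μ) := by
  intro i j h
  have h1 := μ.rowLen_anti i j (Fin.le_def.1 h.le)
  have h2 := Fin.lt_def.1 h
  simp only [shifted, stair]
  omega

theorem perm_eq_one_of_strictMono {σ : Equiv.Perm (Fin N)} (h : StrictMono σ) : σ = 1 := by
  have : (σ : Fin N → Fin N) = id := by
    refine (h.range_inj strictMono_id).1 ?_
    rw [σ.surjective.range_eq, Set.range_id]
  exact Equiv.ext (congrFun this)

theorem eq_one_of_strictAnti_comp {a b : Fin N → ℤ} (ha : StrictAnti a) (hb : StrictAnti b)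
    {σ : Equiv.Perm (Fin N)} (h : ∀ i, a i = b (σ i)) : σ = 1 := by
  refine perm_eq_one_of_strictMono fun i j hij => ?_
  rw [← hb.lt_iff_gt, ← h, ← h]
  exact ha hij

theorem alternant_X (l : Fin N → ℕ) :
    alternant (fun i : Fin N => (MvPolynomial.X i : MvPolynomial (Fin N) ℤ)) l =
      ∑ σ : Equiv.Perm (Fin N), (Equiv.Perm.sign σ : ℤ) • MvPolynomial.monomial
        (Finsupp.equivFunOnFinite.symm fun i => l (σ i) + (N - 1 - σ i)) 1 := by
  rw [alternant, ← Matrix.det_transpose, Matrix.det_apply']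
  refine Finset.sum_congr rfl fun σ _ => ?_
  rw [zsmul_eq_mul]
  congr 1
  rw [MvPolynomial.monomial_eq, Finsupp.prod_fintype _ _ (fun _ => pow_zero _)]
  simp

theorem coe_stair (i : Fin N) : ((N - 1 - (i : ℕ) : ℕ) : ℤ) = stair N i := by
  have := i.2
  unfold stair
  omega

theorem zcoeff_alternant_mul (v : Fin N → ℤ) (f : MvPolynomial (Fin N) ℤ) :
    zcoeff v (alternant (fun i : Fin N => (MvPolynomial.X i : MvPolynomial (Fin N) ℤ)) 0 * f) =
      altCoeff v f := by
  rw [alternant_X, altCoeff_apply, Finset.sum_mul, map_sum]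
  refine Finset.sum_congr rfl fun σ _ => ?_
  rw [smul_mul_assoc, map_smul, smul_eq_mul, mul_comm (MvPolynomial.monomial _ _),
    zcoeff_mul_monomial]
  simp [coe_stair]

theorem zcoeff_alternant (v : Fin N → ℤ) (μ : YoungDiagram) :
    zcoeff v (alternant (fun i : Fin N => (MvPolynomial.X i : MvPolynomial (Fin N) ℤ))
      (fun j => μ.rowLen j)) = ∑ σ : Equiv.Perm (Fin N),
        if ∀ i, v i = shifted N μ (σ i) then (Equiv.Perm.sign σ : ℤ) else 0 := by
  rw [alternant_X, map_sum]
  refine Finset.sum_congr rfl fun σ _ => ?_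
  rw [map_smul, zcoeff_monomial]
  rw [smul_eq_mul, mul_ite, mul_one, mul_zero]
  refine if_congr (forall_congr' fun i => ?_) rfl rfl
  rw [Finsupp.equivFunOnFinite_symm_apply_apply, Nat.cast_add, coe_stair, shifted]

theorem alternant_zero_ne_zero :
    alternant (fun i : Fin N => (MvPolynomial.X i : MvPolynomial (Fin N) ℤ)) 0 ≠ 0 := by
  intro h
  have h1 := zcoeff_alternant_mul (N := N) (stair N) 1
  rw [h, zero_mul, map_zero, altCoeff_one, Finset.sum_eq_single 1] at h1
  · simp at h1
  · intro σ _ hσ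
    rw [if_neg]
    intro h2
    exact hσ (Equiv.ext fun i => (stair_injective (h2 i)).symm)
  · simp

-- `a_δ s_μ` is the alternant of `μ + δ`, whose exponents are the permutations of one strictly
-- decreasing sequence; only the identity keeps it decreasing.
open scoped Classical in
theorem altCoeff_shifted_schur {μ ν : YoungDiagram} (hμ : μ.colLen 0 ≤ N)
    (hν : ν.colLen 0 ≤ N) : altCoeff (shifted N ν) (schur μ N) = if μ = ν then 1 else 0 := by
  rw [← zcoeff_alternant_mul, ← alternant_rowLen N μ hμ, zcoeff_alternant]
  split_ifs with h
  · subst h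
    rw [Finset.sum_eq_single 1]
    · simp
    · intro σ _ hσ
      rw [if_neg]
      intro h
      exact hσ (eq_one_of_strictAnti_comp (shifted_strictAnti N μ) (shifted_strictAnti N μ) h)
    · simp
  · refine Finset.sum_eq_zero fun σ _ => if_neg fun h1 => ?_
    have h2 := eq_one_of_strictAnti_comp (shifted_strictAnti N ν) (shifted_strictAnti N μ) h1
    subst h2
    refine h (eq_of_rowLen_eq hμ hν fun i => ?_)
    have := h1 i
    simp only [shifted, Equiv.Perm.coe_one, id_eq] at this
    omega

theorem rename_alternant (σ : Equiv.Perm (Fin N)) (l : Fin N → ℕ) :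
    MvPolynomial.rename σ (alternant
      (fun i : Fin N => (MvPolynomial.X i : MvPolynomial (Fin N) ℤ)) l) =
      (Equiv.Perm.sign σ : ℤ) * alternant
      (fun i : Fin N => (MvPolynomial.X i : MvPolynomial (Fin N) ℤ)) l := by
  have h := map_alternant (MvPolynomial.rename (R := ℤ) σ).toRingHom
    (fun i : Fin N => (MvPolynomial.X i : MvPolynomial (Fin N) ℤ)) l
  have h2 : ∀ i, (MvPolynomial.rename (R := ℤ) σ).toRingHom (MvPolynomial.X i) =
      MvPolynomial.X (σ i) := fun i => MvPolynomial.rename_X _ _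
  simp only [h2] at h
  refine h.trans ?_
  rw [alternant, alternant]
  have h3 := Matrix.det_permute σ (Matrix.of fun i j : Fin N =>
    (MvPolynomial.X i : MvPolynomial (Fin N) ℤ) ^ (l j + (N - 1 - j)))
  rw [← h3]
  rfl

theorem schur_eq_zero {μ : YoungDiagram} (h : N < μ.colLen 0) : schur μ N = 0 := by
  rw [schur]
  have : IsEmpty (BoundedSSYT μ N) := ⟨fun T => by
    have h1 : (N, 0) ∈ μ := YoungDiagram.mem_iff_lt_colLen.2 h
    exact absurd (T.apply_lt h1) (not_lt.2 (le_entry T.1 h1))⟩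
  exact Finset.sum_of_isEmpty _

/-- Schur polynomials are symmetric. -/
theorem isSymmetric_schur (μ : YoungDiagram) (N : ℕ) : (schur μ N).IsSymmetric := by
  rcases lt_or_ge N (μ.colLen 0) with h | h
  · rw [schur_eq_zero h]
    exact MvPolynomial.IsSymmetric.zero
  · intro σ
    -- Both alternants in the bialternant formula change by the same sign, so their quotient is
    -- invariant.
    have h1 := congrArg (MvPolynomial.rename σ) (alternant_rowLen N μ h)
    rw [map_mul, rename_alternant, rename_alternant, alternant_rowLen N μ h, mul_assoc] at h1
    have h2 : ((Equiv.Perm.sign σ : ℤ) : MvPolynomial (Fin N) ℤ) ≠ 0 := by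
      rcases Int.units_eq_one_or (Equiv.Perm.sign σ) with h | h <;> simp [h]
    exact (mul_left_cancel₀ alternant_zero_ne_zero (mul_left_cancel₀ h2 h1)).symm

theorem exists_comp_strictAnti {l : Fin N → ℤ} (hl : Function.Injective l) :
    ∃ τ : Equiv.Perm (Fin N), StrictAnti (l ∘ τ) := by
  refine ⟨Fin.revPerm.trans (Tuple.sort l), ?_⟩
  have h1 : StrictMono (l ∘ Tuple.sort l) :=
    (Tuple.monotone_sort l).strictMono_of_injective (hl.comp (Tuple.sort l).injective)
  intro i j h
  exact h1 (Fin.rev_lt_rev.2 h)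

theorem exists_eq_shifted {l : Fin N → ℤ} (hl : StrictAnti l) (h0 : ∀ i, 0 ≤ l i) :
    ∃ μ : YoungDiagram, μ.colLen 0 ≤ N ∧ l = shifted N μ := by
  have hstep : ∀ d : ℕ, ∀ i j : Fin N, (j : ℕ) = i + d → l j + d ≤ l i := by
    intro d
    induction d with
    | zero =>
      intro i j h
      have : j = i := Fin.ext (by simpa using h)
      simp [this]
    | succ d ih =>
      intro i j h
      have hk : (i : ℕ) + d < N := by omega
      have h1 := ih i ⟨i + d, hk⟩ rfl
      have h2 : l j < l ⟨i + d, hk⟩ := hl (Fin.lt_def.2 (by simp only; omega))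
      push_cast
      omega
  have hge : ∀ i, stair N i ≤ l i := by
    intro i
    have hi := i.2
    have h1 := hstep (N - 1 - i) i ⟨N - 1, by omega⟩ (by simp only; omega)
    have h2 := h0 ⟨N - 1, by omega⟩
    rw [coe_stair] at h1
    omega
  have hanti : Antitone fun i => (l i - stair N i).toNat := by
    intro i j h
    have h1 := hstep (j - i) i j (by have := Fin.le_def.1 h; omega)
    have h2 := Fin.le_def.1 h
    have h3 : stair N i = stair N j + (j - i : ℕ) := by
      unfold stair
      omega
    have h4 := hge j
    simp only
    omega
  refine ⟨ofRows fun i => (l i - stair N i).toNat, colLen_ofRows hanti, ?_⟩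
  funext i
  have := hge i
  rw [shifted, rowLen_ofRows hanti]
  omega

/-- In the antisymmetric polynomial `a_δ f` a repeated exponent has coefficient zero, and any other
exponent vector sorts to some `μ + δ`. Hence `a_δ f = 0`. -/
theorem eq_zero_of_altCoeff {f : MvPolynomial (Fin N) ℤ} (hf : f.IsSymmetric)
    (h : ∀ μ : YoungDiagram, μ.colLen 0 ≤ N → altCoeff (shifted N μ) f = 0) : f = 0 := by
  have h1 : ∀ d : Fin N →₀ ℕ, altCoeff (fun i => (d i : ℤ)) f = 0 := by
    intro d
    by_cases hd : Function.Injective fun i => (d i : ℤ)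
    · obtain ⟨τ, hτ⟩ := exists_comp_strictAnti hd
      obtain ⟨μ, hμ, h2⟩ := exists_eq_shifted hτ (fun i => Int.natCast_nonneg _)
      have h3 := altCoeff_comp hf (fun i => (d i : ℤ)) τ
      rw [h2, h μ hμ] at h3
      rcases Int.units_eq_one_or (Equiv.Perm.sign τ) with h | h <;> simp [h] at h3 <;> omega
    · simp only [Function.Injective, not_forall] at hd
      obtain ⟨i, j, hij, hne⟩ := hd
      exact altCoeff_eq_zero hf hne hij
  have h2 : alternant (fun i : Fin N => (MvPolynomial.X i : MvPolynomial (Fin N) ℤ)) 0 * f = 0 := by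
    ext d
    rw [← zcoeff_natCast, zcoeff_alternant_mul, h1, MvPolynomial.coeff_zero]
  exact (mul_eq_zero.1 h2).resolve_left alternant_zero_ne_zero

theorem zcoeff_eq_zero_of_isHomogeneous {f : MvPolynomial (Fin N) ℤ} {D : ℕ}
    (hf : f.IsHomogeneous D) {v : Fin N → ℤ} (h : ∑ i, v i ≠ D) : zcoeff v f = 0 := by
  by_cases h0 : ∀ i, 0 ≤ v i
  · obtain ⟨w, rfl⟩ : ∃ w : Fin N →₀ ℕ, v = fun i => (w i : ℤ) :=
      ⟨Finsupp.equivFunOnFinite.symm fun i => (v i).toNat, by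
        funext i
        simp [h0 i]⟩
    rw [zcoeff_natCast]
    refine hf.coeff_eq_zero ?_
    intro h1
    apply h
    rw [← h1, Finsupp.degree_eq_sum]
    push_cast
    rfl
  · push Not at h0
    obtain ⟨i, hi⟩ := h0
    exact zcoeff_of_neg hi f

theorem altCoeff_eq_zero_of_isHomogeneous {f : MvPolynomial (Fin N) ℤ} {D : ℕ}
    (hf : f.IsHomogeneous D) {μ : YoungDiagram} (hμ : μ.colLen 0 ≤ N) (h : μ.card ≠ D) :
    altCoeff (shifted N μ) f = 0 := by
  rw [altCoeff_apply]
  refine Finset.sum_eq_zero fun σ _ => ?_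
  rw [zcoeff_eq_zero_of_isHomogeneous hf, mul_zero]
  rw [Finset.sum_sub_distrib, Equiv.sum_comp σ (stair N)]
  simp only [shifted, Finset.sum_add_distrib, add_sub_cancel_right]
  rw [card_eq_sum_rowLen hμ] at h
  exact_mod_cast h

/-- Setting the last variable to zero. -/
def killLast (N : ℕ) : MvPolynomial (Fin (N + 1)) ℤ →ₐ[ℤ] MvPolynomial (Fin N) ℤ :=
  MvPolynomial.aeval (Fin.snoc (α := fun _ => MvPolynomial (Fin N) ℤ) MvPolynomial.X 0)

theorem killLast_X_castSucc (i : Fin N) :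
    killLast N (MvPolynomial.X i.castSucc) = MvPolynomial.X i := by
  simp [killLast]

theorem killLast_X_last : killLast N (MvPolynomial.X (Fin.last N)) = 0 := by
  simp [killLast]

theorem zcoeff_killLast (v : Fin N → ℤ) (f : MvPolynomial (Fin (N + 1)) ℤ) :
    zcoeff v (killLast N f) = zcoeff (Fin.snoc (α := fun _ => ℤ) v 0) f := by
  induction f using MvPolynomial.induction_on' with
  | monomial d c =>
    have h1 : MvPolynomial.monomial d c = c • (MvPolynomial.monomial d (1 : ℤ)) := by
      rw [MvPolynomial.smul_monomial, smul_eq_mul, mul_one]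
    have h2 : killLast N (MvPolynomial.monomial d 1) = if d (Fin.last N) = 0 then
        MvPolynomial.monomial (Finsupp.equivFunOnFinite.symm fun i => d i.castSucc) 1 else 0 := by
      rw [MvPolynomial.monomial_eq, Finsupp.prod_fintype _ _ (fun _ => pow_zero _),
        Fin.prod_univ_castSucc]
      simp only [map_one, one_mul, map_mul, map_prod, map_pow, killLast_X_castSucc,
        killLast_X_last]
      split_ifs with h
      · rw [h, pow_zero, mul_one, MvPolynomial.monomial_eq,
          Finsupp.prod_fintype _ _ (fun _ => pow_zero _)]
        simp
      · rw [zero_pow h, mul_zero]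
    rw [h1, map_smul, map_smul, map_smul, h2, zcoeff_monomial]
    congr 1
    split_ifs with h3 h4 h4
    · rw [zcoeff_monomial, if_pos]
      intro i
      have := h4 i.castSucc
      simpa using this
    · rw [zcoeff_monomial, if_neg]
      intro h5
      apply h4
      intro i
      refine Fin.lastCases ?_ (fun i => ?_) i
      · simp [h3]
      · simpa using h5 i
    · exfalso
      have := h4 (Fin.last N)
      simp at this
      omega
    · simp
  | add p q hp hq => rw [map_add, map_add, map_add, hp, hq]

/-- Coefficients with respect to Schur functions are stable. -/
theorem altCoeff_shifted_killLast (f : MvPolynomial (Fin (N + 1)) ℤ) {μ : YoungDiagram}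
    (hμ : μ.colLen 0 ≤ N) :
    altCoeff (shifted (N + 1) μ) f = altCoeff (shifted N μ) (killLast N f) := by
  have h0 : μ.rowLen N = 0 := by
    by_contra h
    exact absurd (colLen_le_iff.1 hμ N 0
      (YoungDiagram.mem_iff_lt_rowLen.2 (Nat.pos_of_ne_zero h))) (lt_irrefl _)
  have h1 : shifted (N + 1) μ = Fin.snoc (α := fun _ => ℤ) (fun i => shifted N μ i + 1) 0 := by
    funext i
    refine Fin.lastCases ?_ (fun i => ?_) i
    · simp [shifted, stair, h0]
    · simp [shifted, stair]
      ring
  rw [← zcoeff_alternant_mul, h1, ← zcoeff_killLast, map_mul]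
  -- At `x_N = 0` the Vandermonde product keeps the extra factor `x_0 ⋯ x_{N-1}`, which absorbs the
  -- shift of the staircase by one.
  have h2 : killLast N (alternant (fun i : Fin (N + 1) =>
      (MvPolynomial.X i : MvPolynomial (Fin (N + 1)) ℤ)) 0) =
      alternant (fun i : Fin N => (MvPolynomial.X i : MvPolynomial (Fin N) ℤ)) 0 *
        MvPolynomial.monomial (Finsupp.equivFunOnFinite.symm fun _ => 1) 1 := by
    have h3 := map_alternant (killLast N).toRingHom
      (fun i : Fin (N + 1) => (MvPolynomial.X i : MvPolynomial (Fin (N + 1)) ℤ)) 0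
    refine h3.trans ?_
    rw [alternant_succ_zero, mul_comm]
    congr 1
    · congr 1
      funext i
      exact killLast_X_castSucc i
    · rw [MvPolynomial.monomial_eq, Finsupp.prod_fintype _ _ (fun _ => pow_zero _)]
      have h4 : (killLast N).toRingHom (MvPolynomial.X (Fin.last N)) = 0 := killLast_X_last
      have h5 : ∀ i : Fin N, (killLast N).toRingHom (MvPolynomial.X i.castSucc) =
        MvPolynomial.X i := killLast_X_castSucc
      simp only [h4, h5]
      simp
  rw [h2, mul_right_comm, zcoeff_mul_monomial, zcoeff_alternant_mul]
  congr 2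
  funext i
  simp

theorem finite_card_eq (D : ℕ) : {μ : YoungDiagram | μ.card = D}.Finite := by
  refine Set.Finite.of_finite_image (f := YoungDiagram.cells) ?_
    (fun μ _ ν _ h => YoungDiagram.ext h)
  refine Set.Finite.subset (Finset.finite_toSet (range D ×ˢ range D).powerset) ?_
  rintro _ ⟨μ, hμ, rfl⟩
  rw [mem_coe, mem_powerset]
  rintro ⟨i, j⟩ h
  rw [YoungDiagram.mem_cells] at h
  rw [mem_product, mem_range, mem_range]
  have h1 : (range (i + 1)).image (fun k => (k, 0)) ⊆ μ.cells := by
    intro c hc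
    obtain ⟨k, hk, rfl⟩ := mem_image.1 hc
    rw [YoungDiagram.mem_cells]
    exact μ.up_left_mem (Nat.lt_succ_iff.1 (mem_range.1 hk)) (Nat.zero_le j) h
  have h2 : (range (j + 1)).image (fun k => (0, k)) ⊆ μ.cells := by
    intro c hc
    obtain ⟨k, hk, rfl⟩ := mem_image.1 hc
    rw [YoungDiagram.mem_cells]
    exact μ.up_left_mem (Nat.zero_le i) (Nat.lt_succ_iff.1 (mem_range.1 hk)) h
  have h3 := card_le_card h1
  have h4 := card_le_card h2
  rw [card_image_of_injective _ (fun a b h => (Prod.mk.inj h).1), card_range] at h3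
  rw [card_image_of_injective _ (fun a b h => (Prod.mk.inj h).2), card_range] at h4
  have h5 : μ.card = D := hμ
  rw [YoungDiagram.card] at h5
  omega

theorem altCoeff_sum_schur (c : YoungDiagram →₀ ℤ) {μ : YoungDiagram} (hμ : μ.colLen 0 ≤ N) :
    altCoeff (shifted N μ) (c.sum fun ν a => a • schur ν N) = c μ := by
  classical
  rw [Finsupp.sum, map_sum, Finset.sum_congr rfl (g := fun ν => if ν = μ then c ν else 0)]
  · rw [Finset.sum_ite_eq']
    split_ifs with h
    · rfl
    · exact (Finsupp.notMem_support_iff.1 h).symm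
  · intro ν _
    rw [map_smul]
    by_cases hν : ν.colLen 0 ≤ N
    · rw [altCoeff_shifted_schur hν hμ]
      simp
    · rw [schur_eq_zero (not_le.1 hν), map_zero, smul_zero, if_neg]
      rintro rfl
      exact hν hμ

/-- A plethysm compatible with restriction of the number of variables has Schur coefficients
given by the coefficients of its product with the Vandermonde determinant. -/
theorem isPlethysmCoeff_altCoeff {κ ν : YoungDiagram}
    (hsymm : ∀ N, (plethysm κ ν N).IsSymmetric)
    (hkill : ∀ N, killLast N (plethysm κ ν (N + 1)) = plethysm κ ν N)
    {μ : YoungDiagram} {n : ℕ} (hn : μ.colLen 0 ≤ n) :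
    IsPlethysmCoeff κ ν μ (altCoeff (shifted n μ) (plethysm κ ν n)) := by
  -- The coefficient is read off in `l(μ)` variables, the least number for which `s_μ` does not
  -- vanish; stability carries it to all larger numbers.
  set C : YoungDiagram → ℤ := fun μ =>
    altCoeff (shifted (μ.colLen 0) μ) (plethysm κ ν (μ.colLen 0)) with hC
  have hstable : ∀ (μ : YoungDiagram) (N : ℕ), μ.colLen 0 ≤ N →
      altCoeff (shifted N μ) (plethysm κ ν N) = C μ := by
    intro μ N h
    induction N, h using Nat.le_induction with
    | base => rfl
    | succ N h ih => rw [altCoeff_shifted_killLast _ h, hkill, ih]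
  have hfin : (Function.support C).Finite := by
    refine (finite_card_eq (ν.card * κ.card)).subset fun μ hμ => ?_
    by_contra h
    exact hμ (altCoeff_eq_zero_of_isHomogeneous (isHomogeneous_plethysm κ ν _) le_rfl h)
  refine ⟨Finsupp.ofSupportFinite C hfin, fun N => ?_, fun c' hc' => ?_, ?_⟩
  · rw [← sub_eq_zero]
    refine eq_zero_of_altCoeff ((hsymm N).sub ?_) fun μ hμ => ?_
    · exact (MvPolynomial.symmetricSubalgebra (Fin N) ℤ).sum_mem fun ν _ =>
        (MvPolynomial.symmetricSubalgebra (Fin N) ℤ).zsmul_mem (isSymmetric_schur ν N) _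
    · rw [map_sub, hstable μ N hμ, altCoeff_sum_schur _ hμ]
      exact sub_self _
  · ext μ
    rw [← altCoeff_sum_schur c' (le_refl (μ.colLen 0)), ← hc' (μ.colLen 0)]
    rfl
  · exact (hstable μ n hn).symm

theorem killLast_sum_pow (N k : ℕ) :
    killLast N (∑ i, MvPolynomial.X i ^ (k + 1)) = ∑ i, MvPolynomial.X i ^ (k + 1) := by
  rw [Fin.sum_univ_castSucc]
  simp [killLast_X_castSucc, killLast_X_last]

theorem isPlethysmCoeff_row_row (n m : ℕ) {μ : YoungDiagram} {N : ℕ} (h : μ.colLen 0 ≤ N) :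
    IsPlethysmCoeff (rowShape n) (rowShape m) μ
      (altCoeff (shifted N μ) (plethysm (rowShape n) (rowShape m) N)) :=
  isPlethysmCoeff_altCoeff
    (fun N σ => map_plethysm_row_row (MvPolynomial.rename (R := ℤ) σ).toRingHom
      (fun k => isSymmetric_sum_pow N (k + 1) σ) n m)
    (fun N => map_plethysm_row_row (killLast N).toRingHom (killLast_sum_pow N) n m) h

theorem isPlethysmCoeff_col_row (n m : ℕ) {μ : YoungDiagram} {N : ℕ} (h : μ.colLen 0 ≤ N) :
    IsPlethysmCoeff (colShape n) (rowShape m) μ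
      (altCoeff (shifted N μ) (plethysm (colShape n) (rowShape m) N)) :=
  isPlethysmCoeff_altCoeff
    (fun N σ => map_plethysm_col_row (MvPolynomial.rename (R := ℤ) σ).toRingHom
      (fun k => isSymmetric_sum_pow N (k + 1) σ) n m)
    (fun N => map_plethysm_col_row (killLast N).toRingHom (killLast_sum_pow N) n m) h

end Expansion

/-! ### The partial fraction identity behind Schur's Pfaffian. -/

section PartialFractions

variable {F : Type*} [Field F]

-- A residue theorem for `P(z) = (t - z) ∏ (1 - kz)` with nodes `1`, `-1`, `t⁻¹` and `S`. There are
-- `|S| + 3` nodes and `deg P ≤ |S| + 1`, so the sum of `P(z)/∏(z - node)` over the nodes is zero.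
-- The node `t⁻¹` gives `-t` times the product, the nodes of `S` give `t` times the sum, and `±1`
-- give `t/2` and `(-1)^|S| t/2`, the parity term.
open Polynomial in
theorem sum_prod_div_of_finset [DecidableEq F] (h2 : (2 : F) ≠ 0) (S : Finset F) {t : F}
    (ht : t ≠ 0) (ht1 : t ^ 2 ≠ 1) (hS1 : ∀ x ∈ S, x ^ 2 ≠ 1) (hS : ∀ x ∈ S, t * x ≠ 1) :
    ∏ x ∈ S, (t - x) / (1 - t * x) =
      ∑ x ∈ S, (∏ y ∈ S.erase x, (1 - x * y) / (x - y)) * ((t - x) / (1 - t * x)) +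
        (if Even S.card then 1 else 0) := by
  have h1S : (1 : F) ∉ S := fun h => hS1 1 h (one_pow 2)
  have hm1S : (-1 : F) ∉ S := fun h => hS1 (-1) h (by ring)
  have htS : t⁻¹ ∉ S := fun h => hS _ h (mul_inv_cancel₀ ht)
  have ht1' : t ≠ 1 := by
    rintro rfl
    exact ht1 (one_pow 2)
  have htm1 : t ≠ -1 := by
    rintro rfl
    exact ht1 (by ring)
  have hti1 : t⁻¹ ≠ 1 := fun h => ht1' (by rw [← inv_inv t, h, inv_one])
  have htim1 : t⁻¹ ≠ -1 := fun h => htm1 (by rw [← inv_inv t, h]; norm_num)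
  have h11 : (1 : F) ≠ -1 := fun h => h2 (by linear_combination h)
  have hm1T : (-1 : F) ∉ insert t⁻¹ S := by
    simp [hm1S, htim1.symm]
  have h1T : (1 : F) ∉ insert (-1 : F) (insert t⁻¹ S) := by
    simp [h1S, h11, hti1.symm]
  set T : Finset F := insert 1 (insert (-1) (insert t⁻¹ S)) with hT
  have hcard : T.card = S.card + 3 := by
    rw [hT, card_insert_of_notMem h1T, card_insert_of_notMem hm1T, card_insert_of_notMem htS]
  set P : F[X] := (∏ k ∈ S, (1 - C k * X)) * (C t - X) with hP
  have hdeg : P.natDegree ≤ S.card + 1 := by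
    refine natDegree_mul_le.trans (add_le_add ?_ ?_)
    · refine (natDegree_prod_le _ _).trans ?_
      refine (Finset.sum_le_card_nsmul S _ 1 fun k _ => ?_).trans (by simp)
      compute_degree
    · compute_degree
  have hev : ∀ z, P.eval z = (∏ k ∈ S, (1 - k * z)) * (t - z) := by
    intro z
    simp [hP, eval_prod]
  have key := Lagrange.coeff_eq_sum (s := T) (v := id) (P := P) Function.injective_id.injOn
    (degree_le_natDegree.trans_lt (by rw [hcard]; exact_mod_cast (by omega)))
  rw [coeff_eq_zero_of_natDegree_lt (by omega)] at key
  simp only [id_eq, hev] at key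
  rw [hT, Finset.sum_insert h1T, Finset.sum_insert hm1T, Finset.sum_insert htS] at key
  have e1 : T.erase 1 = insert (-1 : F) (insert t⁻¹ S) := erase_insert h1T
  have e2 : T.erase (-1) = insert (1 : F) (insert t⁻¹ S) := by
    rw [hT, erase_insert_of_ne h11, erase_insert hm1T]
  have e3 : T.erase t⁻¹ = insert (1 : F) (insert (-1) S) := by
    rw [hT, erase_insert_of_ne hti1.symm, erase_insert_of_ne htim1.symm, erase_insert htS]
  have e4 : ∀ x ∈ S, T.erase x = insert (1 : F) (insert (-1) (insert t⁻¹ (S.erase x))) := by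
    intro x hx
    rw [hT, erase_insert_of_ne (ne_of_mem_of_not_mem hx h1S).symm,
      erase_insert_of_ne (ne_of_mem_of_not_mem hx hm1S).symm,
      erase_insert_of_ne (ne_of_mem_of_not_mem hx htS).symm]
  have t1 : (∏ k ∈ S, (1 - k * 1)) * (t - 1) / ∏ j ∈ T.erase 1, (1 - j) = t / 2 := by
    have h0 : ∏ k ∈ S, (1 - k) ≠ 0 :=
      Finset.prod_ne_zero_iff.2 fun k hk => sub_ne_zero.2 fun h => h1S (h ▸ hk)
    rw [e1, Finset.prod_insert hm1T, Finset.prod_insert htS]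
    simp only [mul_one]
    have h3 : (1 : F) - t⁻¹ ≠ 0 := sub_ne_zero.2 hti1.symm
    have h4 : (1 : F) - -1 ≠ 0 := sub_ne_zero.2 h11
    have h5 : t - 1 ≠ 0 := sub_ne_zero.2 ht1'
    have h6 : (1 : F) - -1 = 2 := by ring
    rw [h6]
    field_simp
  have t2 : (∏ k ∈ S, (1 - k * -1)) * (t - -1) / ∏ j ∈ T.erase (-1), (-1 - j) =
      (-1) ^ S.card * (t / 2) := by
    have h0 : ∏ k ∈ S, (1 + k) ≠ 0 := Finset.prod_ne_zero_iff.2 fun k hk h =>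
      hm1S ((by linear_combination h : k = -1) ▸ hk)
    have h1T' : (1 : F) ∉ insert t⁻¹ S := by simp [h1S, hti1.symm]
    rw [e2, Finset.prod_insert h1T', Finset.prod_insert htS]
    have h7 : ∏ k ∈ S, (1 - k * -1) = ∏ k ∈ S, (1 + k) :=
      Finset.prod_congr rfl fun k _ => by ring
    have h8 : ∏ k ∈ S, (-1 - k) = (-1) ^ S.card * ∏ k ∈ S, (1 + k) := by
      rw [← Finset.prod_const, ← Finset.prod_mul_distrib]
      exact Finset.prod_congr rfl fun k _ => by ring
    rw [h7, h8]
    have h5 : t + 1 ≠ 0 := fun h => htm1 (by linear_combination h)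
    have h6 : (-1 : F) - 1 = -2 := by ring
    have h9 : (-1 : F) - t⁻¹ = -((t + 1) / t) := by
      field_simp
      ring
    have h10 : ((-1 : F) ^ S.card) * (-1) ^ S.card = 1 := by
      rw [← mul_pow]
      simp
    have h11' : ((-1 : F) ^ S.card) ≠ 0 := pow_ne_zero _ (by simp)
    rw [h6, h9, sub_neg_eq_add, div_eq_iff]
    · field_simp
      linear_combination (-1 : F) * h10
    · refine mul_ne_zero (neg_ne_zero.2 h2) (mul_ne_zero ?_ (mul_ne_zero h11' h0))
      exact neg_ne_zero.2 (div_ne_zero h5 ht)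
  have t3 : (∏ k ∈ S, (1 - k * t⁻¹)) * (t - t⁻¹) / ∏ j ∈ T.erase t⁻¹, (t⁻¹ - j) =
      -t * ∏ x ∈ S, (t - x) / (1 - t * x) := by
    have h1T' : (1 : F) ∉ insert (-1) S := by simp [h1S, h11]
    rw [e3, Finset.prod_insert h1T', Finset.prod_insert hm1S]
    have h7 : ∏ x ∈ S, (t - x) / (1 - t * x) =
        (∏ k ∈ S, (1 - k * t⁻¹)) / ∏ j ∈ S, (t⁻¹ - j) := by
      rw [← Finset.prod_div_distrib]
      refine Finset.prod_congr rfl fun x hx => ?_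
      have h8 : 1 - t * x ≠ 0 := sub_ne_zero.2 (hS x hx).symm
      have h9 : t⁻¹ - x = (1 - t * x) / t := by field_simp
      rw [h9]
      field_simp
    rw [h7]
    have h8 : t⁻¹ - 1 ≠ 0 := sub_ne_zero.2 hti1
    have h9 : t⁻¹ - -1 ≠ 0 := sub_ne_zero.2 htim1
    have h10 : ∏ j ∈ S, (t⁻¹ - j) ≠ 0 :=
      Finset.prod_ne_zero_iff.2 fun k hk => sub_ne_zero.2 fun h => htS (h ▸ hk)
    have h12 : t - t⁻¹ = -t * ((t⁻¹ - 1) * (t⁻¹ - -1)) := by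
      field_simp
      ring
    rw [h12]
    generalize ∏ k ∈ S, (1 - k * t⁻¹) = A
    generalize ∏ j ∈ S, (t⁻¹ - j) = B at h10 ⊢
    generalize t⁻¹ - 1 = u at h8 ⊢
    generalize t⁻¹ - -1 = v at h9 ⊢
    field_simp
  have t4 : ∀ x ∈ S, (∏ k ∈ S, (1 - k * x)) * (t - x) / ∏ j ∈ T.erase x, (x - j) =
      t * ((∏ y ∈ S.erase x, (1 - x * y) / (x - y)) * ((t - x) / (1 - t * x))) := by
    intro x hx
    have hts : t⁻¹ ∉ S.erase x := fun h => htS (mem_of_mem_erase h)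
    have hms : (-1 : F) ∉ insert t⁻¹ (S.erase x) := fun h =>
      hm1T (insert_subset_insert _ (erase_subset _ _) h)
    have h1s : (1 : F) ∉ insert (-1) (insert t⁻¹ (S.erase x)) := fun h =>
      h1T (insert_subset_insert _ (insert_subset_insert _ (erase_subset _ _)) h)
    rw [e4 x hx, Finset.prod_insert h1s, Finset.prod_insert hms, Finset.prod_insert hts,
      Finset.prod_div_distrib, ← Finset.mul_prod_erase S _ hx]
    have h7 : ∏ k ∈ S.erase x, (1 - k * x) = ∏ y ∈ S.erase x, (1 - x * y) :=
      Finset.prod_congr rfl fun y _ => by ring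
    rw [h7]
    have h8 : x - 1 ≠ 0 := sub_ne_zero.2 fun h => h1S (h ▸ hx)
    have h9 : x - -1 ≠ 0 := sub_ne_zero.2 fun h => hm1S (h ▸ hx)
    have h10 : ∏ y ∈ S.erase x, (x - y) ≠ 0 := Finset.prod_ne_zero_iff.2 fun k hk =>
      sub_ne_zero.2 (ne_of_mem_erase hk).symm
    have h12 : 1 - t * x ≠ 0 := sub_ne_zero.2 (hS x hx).symm
    have h13 : x - t⁻¹ = -((1 - t * x) / t) := by
      field_simp
      ring
    have h14 : 1 - x * x = -((x - 1) * (x - -1)) := by ring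
    rw [h13, h14]
    field_simp
  rw [← hT, t1, t2, t3, Finset.sum_congr rfl t4, ← Finset.mul_sum] at key
  have h3 : t * (∏ x ∈ S, (t - x) / (1 - t * x)) = t * (∑ x ∈ S,
      (∏ y ∈ S.erase x, (1 - x * y) / (x - y)) * ((t - x) / (1 - t * x)) +
        (if Even S.card then 1 else 0)) := by
    split_ifs with he
    · rw [he.neg_one_pow] at key
      have : t / 2 + t / 2 = t := by
        rw [← two_mul]
        field_simp
      linear_combination key + this
    · rw [(Nat.not_even_iff_odd.1 he).neg_one_pow] at key
      linear_combination key
  exact mul_left_cancel₀ ht h3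

/-- The partial fraction expansion of `∏ (t - x_j) / (1 - t x_j)`. -/
theorem prod_div_eq_sum {ι : Type*} [DecidableEq ι] (h2 : (2 : F) ≠ 0) (s : Finset ι) {x : ι → F}
    {t : F} (hx : Set.InjOn x s) (ht : t ≠ 0) (ht1 : t ^ 2 ≠ 1) (hx1 : ∀ j ∈ s, x j ^ 2 ≠ 1)
    (htx : ∀ j ∈ s, t * x j ≠ 1) :
    ∏ j ∈ s, (t - x j) / (1 - t * x j) =
      ∑ j ∈ s, (∏ k ∈ s.erase j, (1 - x j * x k) / (x j - x k)) * ((t - x j) / (1 - t * x j)) +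
        (if Even s.card then 1 else 0) := by
  classical
  have h := sum_prod_div_of_finset h2 (s.image x) ht ht1 (by simpa using hx1) (by simpa using htx)
  rw [Finset.prod_image hx, Finset.sum_image hx, card_image_of_injOn hx] at h
  rw [h]
  congr 1
  refine Finset.sum_congr rfl fun j hj => ?_
  congr 1
  have : (s.image x).erase (x j) = (s.erase j).image x := by
    ext y
    simp only [mem_erase, mem_image]
    constructor
    · rintro ⟨h1, k, hk, rfl⟩
      exact ⟨k, ⟨fun h => h1 (h ▸ rfl), hk⟩, rfl⟩
    · rintro ⟨k, ⟨hkj, hk⟩, rfl⟩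
      exact ⟨fun h => hkj (hx hk hj h), k, hk, rfl⟩
  rw [this, Finset.prod_image (hx.mono (coe_subset.2 (erase_subset _ _)))]

end PartialFractions

/-! ### The product of all `(x_i - x_j)/(1 - x_i x_j)` and its coefficients. -/

section PowerSeries

variable {M : ℕ}

open Classical in
/-- The geometric series `1 / (1 - x_i x_j)`. -/
def geomPair (i j : Fin M) : MvPowerSeries (Fin M) ℤ := fun d =>
  if d i = d j ∧ ∀ k, k ≠ i → k ≠ j → d k = 0 then 1 else 0

open Classical in
theorem coeff_geomPair (i j : Fin M) (d : Fin M →₀ ℕ) :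
    MvPowerSeries.coeff d (geomPair i j) =
      if d i = d j ∧ ∀ k, k ≠ i → k ≠ j → d k = 0 then 1 else 0 :=
  rfl

theorem X_mul_X_eq_monomial (i j : Fin M) :
    (MvPowerSeries.X i * MvPowerSeries.X j : MvPowerSeries (Fin M) ℤ) =
      MvPowerSeries.monomial (Finsupp.single i 1 + Finsupp.single j 1) 1 := by
  rw [MvPowerSeries.X, MvPowerSeries.X, MvPowerSeries.monomial_mul_monomial, mul_one]

theorem single_add_single_le_iff {i j : Fin M} (hij : i ≠ j) (d : Fin M →₀ ℕ) :
    Finsupp.single i 1 + Finsupp.single j 1 ≤ d ↔ 1 ≤ d i ∧ 1 ≤ d j := by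
  constructor
  · intro h
    have h1 := h i
    have h2 := h j
    simp [hij, hij.symm] at h1 h2
    omega
  · rintro ⟨h1, h2⟩ k
    by_cases hki : k = i
    · subst hki
      simpa [hij] using h1
    · by_cases hkj : k = j
      · subst hkj
        simpa [hij.symm] using h2
      · simp [Ne.symm hki, Ne.symm hkj]

theorem geomPair_mul {i j : Fin M} (hij : i ≠ j) :
    geomPair i j * (1 - MvPowerSeries.X i * MvPowerSeries.X j) = 1 := by
  classical
  rw [X_mul_X_eq_monomial, mul_sub, mul_one]
  ext d
  rw [map_sub, MvPowerSeries.coeff_mul_monomial, MvPowerSeries.coeff_one, coeff_geomPair,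
    coeff_geomPair]
  have e1 : (d - (Finsupp.single i 1 + Finsupp.single j 1) : Fin M →₀ ℕ) i = d i - 1 := by
    simp [hij]
  have e2 : (d - (Finsupp.single i 1 + Finsupp.single j 1) : Fin M →₀ ℕ) j = d j - 1 := by
    simp [hij.symm]
  have e3 : ∀ k, k ≠ i → k ≠ j → (d - (Finsupp.single i 1 + Finsupp.single j 1) : Fin M →₀ ℕ) k = d k := by
    intro k hki hkj
    simp [Ne.symm hki, Ne.symm hkj]
  have e4 : (∀ k, k ≠ i → k ≠ j → (d - (Finsupp.single i 1 + Finsupp.single j 1) : Fin M →₀ ℕ) k = 0) ↔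
      ∀ k, k ≠ i → k ≠ j → d k = 0 :=
    forall_congr' fun k => forall_congr' fun h1 => forall_congr' fun h2 => by rw [e3 k h1 h2]
  have e5 : d = 0 ↔ d i = 0 ∧ d j = 0 ∧ ∀ k, k ≠ i → k ≠ j → d k = 0 := by
    constructor
    · rintro rfl
      simp
    · rintro ⟨h1, h2, h3⟩
      ext k
      by_cases hki : k = i
      · rw [hki, h1]
        rfl
      · by_cases hkj : k = j
        · rw [hkj, h2]
          rfl
        · rw [h3 k hki hkj]
          rfl
  simp only [single_add_single_le_iff hij, e1, e2, e4, e5]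
  by_cases h : ∀ k, k ≠ i → k ≠ j → d k = 0
  · simp only [eq_true h, and_true, mul_one]
    split_ifs <;> omega
  · simp only [eq_false h, and_false, if_false, mul_one, ite_self, sub_zero]

/-- The series `(x_i - x_j) / (1 - x_i x_j)`. -/
def schurPair (i j : Fin M) : MvPowerSeries (Fin M) ℤ :=
  (MvPowerSeries.X i - MvPowerSeries.X j) * geomPair i j

/-- In `(x_i - x_j) ∑ (x_i x_j)^k` the exponents differ by one, and the negative terms have the
larger exponent at `j`. -/
theorem coeff_schurPair {i j : Fin M} (hij : i ≠ j) {d : Fin M →₀ ℕ} (h : d j < d i)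
    (hd : ∀ k, k ≠ i → k ≠ j → d k = 0) :
    MvPowerSeries.coeff d (schurPair i j) = if d i = d j + 1 then 1 else 0 := by
  classical
  rw [schurPair, sub_mul, map_sub, MvPowerSeries.X, MvPowerSeries.X,
    MvPowerSeries.coeff_monomial_mul, MvPowerSeries.coeff_monomial_mul, coeff_geomPair,
    coeff_geomPair]
  have e1 : (d - Finsupp.single i 1 : Fin M →₀ ℕ) i = d i - 1 := by simp
  have e2 : (d - Finsupp.single i 1 : Fin M →₀ ℕ) j = d j := by simp [hij]
  have e3 : (d - Finsupp.single j 1 : Fin M →₀ ℕ) j = d j - 1 := by simp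
  have e4 : (d - Finsupp.single j 1 : Fin M →₀ ℕ) i = d i := by simp [hij.symm]
  have e5 : ∀ k, k ≠ i → k ≠ j → (d - Finsupp.single i 1 : Fin M →₀ ℕ) k = 0 := fun k h1 h2 => by
    simp [hd k h1 h2]
  have e6 : ¬ (d i = d j - 1) := by omega
  have e7 : (Finsupp.single i 1 : Fin M →₀ ℕ) ≤ d := by
    rw [Finsupp.single_le_iff]
    omega
  rw [e1, e2, e3, e4, if_pos e7]
  simp only [e6, false_and, if_false, mul_zero, ite_self, sub_zero, one_mul]
  refine if_congr ?_ rfl rfl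
  constructor
  · rintro ⟨h1, _⟩
    omega
  · intro h1
    exact ⟨by omega, e5⟩

/-- The series `U` only involves the variables with index in `A`. -/
def HasSupport (A : Finset (Fin M)) (U : MvPowerSeries (Fin M) ℤ) : Prop :=
  ∀ d, MvPowerSeries.coeff d U ≠ 0 → d.support ⊆ A

namespace HasSupport

variable {A B : Finset (Fin M)} {U V : MvPowerSeries (Fin M) ℤ}

theorem one : HasSupport A 1 := by
  classical
  intro d hd
  rw [MvPowerSeries.coeff_one] at hd
  have : d = 0 := by
    by_contra h
    exact hd (if_neg h)
  simp [this]

theorem mul (hU : HasSupport A U) (hV : HasSupport A V) : HasSupport A (U * V) := by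
  classical
  intro d hd
  rw [MvPowerSeries.coeff_mul] at hd
  obtain ⟨p, hp, hne⟩ := Finset.exists_ne_zero_of_sum_ne_zero hd
  rw [HasAntidiagonal.mem_antidiagonal] at hp
  rw [← hp]
  exact Finsupp.support_add.trans
    (union_subset (hU _ (left_ne_zero_of_mul hne)) (hV _ (right_ne_zero_of_mul hne)))

theorem sub (hU : HasSupport A U) (hV : HasSupport A V) : HasSupport A (U - V) := by
  intro d hd
  by_cases h : MvPowerSeries.coeff d U = 0
  · refine hV d fun h' => hd ?_
    rw [map_sub, h, h', sub_zero]
  · exact hU d h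

theorem prod {ι : Type*} {s : Finset ι} {f : ι → MvPowerSeries (Fin M) ℤ}
    (h : ∀ i ∈ s, HasSupport A (f i)) : HasSupport A (∏ i ∈ s, f i) :=
  Finset.prod_induction f (HasSupport A) (fun _ _ => mul) one h

theorem X {i : Fin M} (hi : i ∈ A) : HasSupport A (MvPowerSeries.X i) := by
  classical
  intro d hd
  rw [MvPowerSeries.coeff_X] at hd
  have : d = Finsupp.single i 1 := by
    by_contra h
    exact hd (if_neg h)
  rw [this]
  refine Finsupp.support_single_subset.trans ?_
  simpa using hi

theorem geomPair {i j : Fin M} (hi : i ∈ A) (hj : j ∈ A) :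
    HasSupport A (Plethysm.geomPair i j) := by
  intro d hd k hk
  rw [coeff_geomPair] at hd
  rw [Finsupp.mem_support_iff] at hk
  by_contra hkA
  apply hd
  rw [if_neg]
  rintro ⟨_, h⟩
  exact hk (h k (fun h => hkA (h ▸ hi)) (fun h => hkA (h ▸ hj)))

theorem schurPair {i j : Fin M} (hi : i ∈ A) (hj : j ∈ A) :
    HasSupport A (Plethysm.schurPair i j) :=
  ((X hi).sub (X hj)).mul (geomPair hi hj)

theorem coeff_mul_add (hU : HasSupport A U) (hV : HasSupport B V) (hAB : Disjoint A B)
    {a b : Fin M →₀ ℕ} (ha : a.support ⊆ A) (hb : b.support ⊆ B) :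
    MvPowerSeries.coeff (a + b) (U * V) = MvPowerSeries.coeff a U * MvPowerSeries.coeff b V := by
  classical
  rw [MvPowerSeries.coeff_mul, Finset.sum_eq_single (a, b)]
  · rintro ⟨p, q⟩ hpq hne
    replace hpq : p + q = a + b := HasAntidiagonal.mem_antidiagonal.1 hpq
    by_contra h0
    have hp := hU p (left_ne_zero_of_mul h0)
    have hq := hV q (right_ne_zero_of_mul h0)
    have hz : ∀ {e : Fin M →₀ ℕ} {C : Finset (Fin M)}, e.support ⊆ C → ∀ k, k ∉ C → e k = 0 := by
      intro e C he k hk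
      by_contra h
      exact hk (he (Finsupp.mem_support_iff.2 h))
    apply hne
    have hk : ∀ k, p k = a k ∧ q k = b k := by
      intro k
      have h1 : (p + q) k = (a + b) k := by rw [hpq]
      rw [Finsupp.add_apply, Finsupp.add_apply] at h1
      by_cases hkA : k ∈ A
      · have hkB := Finset.disjoint_left.1 hAB hkA
        have h2 := hz hq k hkB
        have h3 := hz hb k hkB
        omega
      · have h2 := hz hp k hkA
        have h3 := hz ha k hkA
        omega
    have hpa : p = a := Finsupp.ext fun k => (hk k).1
    have hqb : q = b := Finsupp.ext fun k => (hk k).2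
    rw [hpa, hqb]
  · intro h
    exact (h (HasAntidiagonal.mem_antidiagonal.2 (rfl : a + b = a + b))).elim

end HasSupport

/-- The product of `(x_i - x_j) / (1 - x_i x_j)` over all `i < j` in `I`. -/
def schurProd (I : Finset (Fin M)) : MvPowerSeries (Fin M) ℤ :=
  ∏ i ∈ I, ∏ j ∈ I, if i < j then schurPair i j else 1

theorem HasSupport.schurProd (I : Finset (Fin M)) : HasSupport I (schurProd I) := by
  refine HasSupport.prod fun i hi => HasSupport.prod fun j hj => ?_
  split_ifs
  · exact HasSupport.schurPair hi hj
  · exact HasSupport.one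

theorem schurProd_insert {I : Finset (Fin M)} {a : Fin M} (ha : a ∉ I) :
    schurProd (insert a I) =
      (∏ k ∈ I, if k < a then schurPair k a else schurPair a k) * schurProd I := by
  rw [schurProd, Finset.prod_insert ha, Finset.prod_insert ha, if_neg (lt_irrefl a), one_mul]
  have h : ∀ i ∈ I, (∏ j ∈ insert a I, if i < j then schurPair i j else 1) =
      (if i < a then schurPair i a else 1) * ∏ j ∈ I, if i < j then schurPair i j else 1 :=
    fun i _ => Finset.prod_insert ha
  rw [Finset.prod_congr rfl h, Finset.prod_mul_distrib, ← mul_assoc, ← Finset.prod_mul_distrib]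
  congr 1
  refine Finset.prod_congr rfl fun k hk => ?_
  have hka : k ≠ a := fun h => ha (h ▸ hk)
  rcases lt_or_gt_of_ne hka with h | h
  · rw [if_neg (not_lt.2 h.le), if_pos h, if_pos h, one_mul]
  · rw [if_pos h, if_neg (not_lt.2 h.le), if_neg (not_lt.2 h.le), mul_one]

/-- Expansion of a Pfaffian along its first row: `prod_div_eq_sum` with `t = x_a`, in the fraction
field, multiplied by `schurProd J`. The parity term accounts for an odd number of indices. -/
theorem schurProd_insert_min {J : Finset (Fin M)} {a : Fin M} (ha : ∀ j ∈ J, a < j) :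
    schurProd (insert a J) = (∑ j ∈ J, (∏ k ∈ J.erase j, if k < j then (-1 : ℤ) else 1) •
      (schurPair a j * schurProd (J.erase j))) + if Even J.card then schurProd J else 0 := by
  classical
  let K := FractionRing (MvPowerSeries (Fin M) ℤ)
  let φ : MvPowerSeries (Fin M) ℤ →+* K := algebraMap _ K
  have hφ : Function.Injective φ := IsFractionRing.injective _ K
  let x : Fin M → K := fun i => φ (MvPowerSeries.X i)
  have hx : Function.Injective x := fun i j h => MvPowerSeries.X_inj.1 (hφ h)
  have hcc : ∀ i j : Fin M, x i * x j ≠ 1 := by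
    intro i j h
    have h1 : (MvPowerSeries.X i * MvPowerSeries.X j : MvPowerSeries (Fin M) ℤ) = 1 :=
      hφ (by rw [map_mul, map_one]; exact h)
    have h2 := congrArg (MvPowerSeries.constantCoeff (σ := Fin M) (R := ℤ)) h1
    simp at h2
  have hcc' : ∀ i j : Fin M, 1 - x i * x j ≠ 0 := fun i j => sub_ne_zero.2 (hcc i j).symm
  have h2 : (2 : K) ≠ 0 := by
    have : φ 2 ≠ φ 0 := fun h => by
      have h2 := congrArg (MvPowerSeries.constantCoeff (σ := Fin M) (R := ℤ)) (hφ h)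
      rw [map_ofNat, map_zero] at h2
      norm_num at h2
    rwa [map_ofNat, map_zero] at this
  have hx0 : ∀ i, x i ≠ 0 := fun i h => by
    have h1 : (MvPowerSeries.X i : MvPowerSeries (Fin M) ℤ) = 0 := hφ (by rw [map_zero]; exact h)
    have h2 := congrArg (MvPowerSeries.coeff (R := ℤ) (Finsupp.single i 1)) h1
    rw [MvPowerSeries.coeff_index_single_self_X] at h2
    simp at h2
  have hpair : ∀ i j : Fin M, i ≠ j → φ (schurPair i j) = (x i - x j) / (1 - x i * x j) := by
    intro i j hij
    rw [eq_div_iff (hcc' i j)]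
    have := congrArg φ (geomPair_mul hij)
    rw [map_mul, map_sub, map_mul, map_one] at this
    rw [schurPair, map_mul, map_sub, mul_assoc]
    change (x i - x j) * (φ (geomPair i j) * (1 - φ (MvPowerSeries.X i) * φ (MvPowerSeries.X j))) = _
    rw [this, mul_one]
  apply hφ
  have haJ : a ∉ J := fun h => lt_irrefl _ (ha a h)
  rw [schurProd_insert haJ, map_mul, map_prod]
  have e1 : ∏ k ∈ J, φ (if k < a then schurPair k a else schurPair a k) =
      ∏ k ∈ J, (x a - x k) / (1 - x a * x k) :=
    Finset.prod_congr rfl fun k hk => by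
      rw [if_neg (not_lt.2 (ha k hk).le), hpair a k (ha k hk).ne]
  rw [e1, prod_div_eq_sum h2 J hx.injOn (hx0 a) (by rw [pow_two]; exact hcc a a)
    (fun j _ => by rw [pow_two]; exact hcc j j) (fun j _ => hcc a j), add_mul, Finset.sum_mul,
    map_add, map_sum]
  congr 1
  · refine Finset.sum_congr rfl fun j hj => ?_
    rw [map_zsmul, map_mul, hpair a j (ha j hj).ne]
    conv_lhs => rw [← insert_erase hj, schurProd_insert (notMem_erase j J), map_mul, map_prod,
      erase_insert (notMem_erase j J)]
    rw [zsmul_eq_mul, Int.cast_prod]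
    -- The weights of the partial fractions are inverse, up to order of indices, to the factors of
    -- `schurProd J` that involve `j`; only signs remain.
    have e2 : (∏ k ∈ J.erase j, (1 - x j * x k) / (x j - x k)) *
        (∏ k ∈ J.erase j, φ (if k < j then schurPair k j else schurPair j k)) =
        ∏ k ∈ J.erase j, (((if k < j then (-1 : ℤ) else 1) : ℤ) : K) := by
      rw [← Finset.prod_mul_distrib]
      refine Finset.prod_congr rfl fun k hk => ?_
      have hkj : k ≠ j := ne_of_mem_erase hk
      have h3 : x j - x k ≠ 0 := sub_ne_zero.2 fun h => hkj (hx h).symm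
      have h4 := hcc' j k
      split_ifs with h
      · rw [hpair k j hkj, mul_comm (x k)]
        push_cast
        rw [div_mul_div_comm, div_eq_iff (mul_ne_zero h3 h4)]
        ring
      · rw [hpair j k hkj.symm]
        push_cast
        rw [div_mul_div_comm, div_eq_iff (mul_ne_zero h3 h4)]
        ring
    rw [← e2]
    ring
  · split_ifs
    · rw [one_mul]
    · rw [zero_mul, map_zero]

/-- The exponents `l` on `I`, zero elsewhere. -/
def cut (l : Fin M → ℕ) (I : Finset (Fin M)) : Fin M →₀ ℕ :=
  Finsupp.equivFunOnFinite.symm fun i => if i ∈ I then l i else 0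

theorem cut_apply (l : Fin M → ℕ) (I : Finset (Fin M)) (i : Fin M) :
    cut l I i = if i ∈ I then l i else 0 :=
  rfl

theorem support_cut (l : Fin M → ℕ) (I : Finset (Fin M)) : (cut l I).support ⊆ I := by
  intro i hi
  rw [Finsupp.mem_support_iff, cut_apply] at hi
  by_contra h
  exact hi (if_neg h)

theorem cut_union (l : Fin M → ℕ) {A B : Finset (Fin M)} (h : Disjoint A B) :
    cut l (A ∪ B) = cut l A + cut l B := by
  ext i
  rw [Finsupp.add_apply, cut_apply, cut_apply, cut_apply]
  by_cases hA : i ∈ A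
  · simp [hA, Finset.disjoint_left.1 h hA]
  · simp [hA]

theorem coeff_schurPair_mul {l : Fin M → ℕ} {i j : Fin M} {I : Finset (Fin M)} (hij : i ≠ j)
    (hi : i ∉ I) (hj : j ∉ I) (h : l j < l i) :
    MvPowerSeries.coeff (cut l (insert i (insert j I))) (schurPair i j * schurProd I) =
      (if l i = l j + 1 then 1 else 0) * MvPowerSeries.coeff (cut l I) (schurProd I) := by
  have hd : Disjoint ({i, j} : Finset (Fin M)) I := by
    rw [Finset.disjoint_left]
    intro k hk
    rcases mem_insert.1 hk with rfl | hk
    · exact hi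
    · exact mem_singleton.1 hk ▸ hj
  have hu : insert i (insert j I) = {i, j} ∪ I := by
    ext k
    simp
  rw [hu, cut_union l hd, (HasSupport.schurPair (A := {i, j}) (by simp) (by simp)).coeff_mul_add
    (HasSupport.schurProd I) hd (support_cut l _) (support_cut l _)]
  congr 1
  have e1 : cut l {i, j} i = l i := by simp [cut_apply]
  have e2 : cut l {i, j} j = l j := by simp [cut_apply]
  rw [coeff_schurPair hij, e1, e2]
  · rw [e1, e2]
    exact h
  · intro k h1 h2
    simp [cut_apply, h1, h2]

/-- The indices `r, …, M - 1`. -/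
def tail (M r : ℕ) : Finset (Fin M) := univ.filter fun i => r ≤ (i : ℕ)

theorem mem_tail {r : ℕ} {i : Fin M} : i ∈ tail M r ↔ r ≤ (i : ℕ) := by
  simp [tail]

theorem tail_eq_insert {r : ℕ} (h : r < M) : tail M r = insert ⟨r, h⟩ (tail M (r + 1)) := by
  ext i
  rw [mem_insert, mem_tail, mem_tail, Fin.ext_iff]
  simp only
  omega

theorem tail_eq_empty {r : ℕ} (h : M ≤ r) : tail M r = ∅ := by
  ext i
  have := i.2
  simp only [mem_tail, notMem_empty, iff_false]
  omega

/-- One more than the following entry of `l`, zero for the last entry. -/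
def nextSucc (l : Fin M → ℕ) (s : Fin M) : ℕ :=
  if h : (s : ℕ) + 1 < M then l ⟨s + 1, h⟩ + 1 else 0

/-- Expanding along the index `r`, its partner `j` must satisfy `l r = l j + 1`; as `l` decreases
strictly, `j = r + 1`, which carries the sign `+1`. Removing the two indices gives an induction in
steps of two, and a single remaining index must have exponent zero. -/
theorem coeff_schurProd_tail {l : Fin M → ℕ} (hl : StrictAnti l) (k r : ℕ) (hk : M ≤ r + k) :
    MvPowerSeries.coeff (cut l (tail M r)) (schurProd (tail M r)) =
      if ∀ s : Fin M, r ≤ (s : ℕ) → Even ((s : ℕ) - r) → l s = nextSucc l s then 1 else 0 := by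
  induction k using Nat.strong_induction_on generalizing r with
  | _ k ih =>
    classical
    rcases Nat.lt_or_ge r M with hr | hr
    swap
    · rw [tail_eq_empty hr, if_pos]
      · rw [schurProd, Finset.prod_empty, MvPowerSeries.coeff_one, if_pos]
        ext i
        simp [cut_apply]
      · intro s hs
        have := s.2
        omega
    rcases Nat.lt_or_ge (r + 1) M with hr1 | hr1
    swap
    · have ht : tail M r = {⟨r, hr⟩} := by
        rw [tail_eq_insert hr, tail_eq_empty hr1]
        rfl
      rw [ht, schurProd, Finset.prod_singleton, Finset.prod_singleton, if_neg (lt_irrefl _),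
        MvPowerSeries.coeff_one]
      refine if_congr ?_ rfl rfl
      constructor
      · intro h s hs _
        have hs' : s = ⟨r, hr⟩ := Fin.ext (by have := s.2; simp only; omega)
        have := DFunLike.congr_fun h ⟨r, hr⟩
        rw [cut_apply, if_pos (mem_singleton_self _)] at this
        rw [hs', this, nextSucc, dif_neg (by simp only; omega)]
        rfl
      · intro h
        have h1 := h ⟨r, hr⟩ le_rfl (by simp)
        rw [nextSucc, dif_neg (by simp only; omega)] at h1
        ext i
        rw [cut_apply]
        split_ifs with hi
        · rw [mem_singleton.1 hi, h1]
          rfl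
        · rfl
    have hlt : ∀ j ∈ tail M (r + 1), (⟨r, hr⟩ : Fin M) < j := fun j hj =>
      Fin.lt_def.2 (mem_tail.1 hj)
    have hi1 : (⟨r + 1, hr1⟩ : Fin M) ∈ tail M (r + 1) := mem_tail.2 le_rfl
    have herase : (tail M (r + 1)).erase ⟨r + 1, hr1⟩ = tail M (r + 2) := by
      rw [tail_eq_insert hr1, erase_insert]
      rw [mem_tail]
      simp
    have hno : (⟨r, hr⟩ : Fin M) ∉ tail M (r + 1) := fun h => lt_irrefl _ (hlt _ h)
    have hterm : ∀ j ∈ tail M (r + 1), MvPowerSeries.coeff (cut l (tail M r))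
        (schurPair ⟨r, hr⟩ j * schurProd ((tail M (r + 1)).erase j)) =
        (if l ⟨r, hr⟩ = l j + 1 then 1 else 0) *
          MvPowerSeries.coeff (cut l ((tail M (r + 1)).erase j))
            (schurProd ((tail M (r + 1)).erase j)) := by
      intro j hj
      rw [← coeff_schurPair_mul (hlt j hj).ne (fun h => hno (mem_of_mem_erase h))
        (notMem_erase _ _) (hl (hlt j hj)), insert_erase hj, ← tail_eq_insert hr]
    -- The parity term does not involve `x_r`, while `l r > l (r+1) ≥ 0`.
    have hlast : MvPowerSeries.coeff (cut l (tail M r))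
        (if Even (tail M (r + 1)).card then schurProd (tail M (r + 1)) else 0) = 0 := by
      split_ifs
      · by_contra h
        have h1 := HasSupport.schurProd _ _ h
        apply hno
        apply h1
        rw [Finsupp.mem_support_iff, cut_apply, if_pos (mem_tail.2 (le_refl r))]
        have := hl (hlt _ hi1)
        omega
      · exact map_zero _
    conv_lhs => arg 2; rw [tail_eq_insert hr, schurProd_insert_min hlt]
    rw [map_add, hlast, add_zero, map_sum, Finset.sum_eq_single_of_mem _ hi1]
    · rw [map_zsmul, hterm _ hi1, herase, Finset.prod_eq_one, one_smul,
        ih (k - 2) (by omega) (r + 2) (by omega), ite_mul, one_mul, zero_mul, ← ite_and]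
      · refine if_congr ?_ rfl rfl
        constructor
        · rintro ⟨h1, h2⟩ s hs he
          by_cases h3 : (s : ℕ) = r
          · have hs' : s = ⟨r, hr⟩ := Fin.ext h3
            rw [hs', h1, nextSucc, dif_pos hr1]
          · have h4 : (s : ℕ) ≠ r + 1 := fun h => by
              rw [h] at he
              simp at he
            refine h2 s (by omega) ?_
            rw [Nat.even_iff] at he ⊢
            omega
        · intro h
          refine ⟨?_, fun s hs he => h s (by omega) ?_⟩
          · rw [h ⟨r, hr⟩ le_rfl (by simp), nextSucc, dif_pos hr1]
          · rw [Nat.even_iff] at he ⊢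
            omega
      · intro j hj
        rw [if_neg]
        have := mem_tail.1 hj
        rw [Fin.lt_def]
        simp only
        omega
    · intro j hj hne
      rw [map_zsmul, hterm j hj, if_neg, zero_mul, smul_zero]
      have h1 : l j < l ⟨r + 1, hr1⟩ := hl (lt_of_le_of_ne (Fin.le_def.2 (mem_tail.1 hj)) hne.symm)
      have h2 : l ⟨r + 1, hr1⟩ < l ⟨r, hr⟩ := hl (hlt _ hi1)
      omega

end PowerSeries

/-! ### Littlewood's identity for `h_n ∘ e_2`. -/

section Littlewood

variable {M : ℕ}

/-- Pairs `i < j` of indices. -/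
abbrev IncPair (M : ℕ) : Type := {p : Fin M × Fin M // p.1 < p.2}

theorem prod_incPair {α : Type*} [CommMonoid α] (f : Fin M → Fin M → α) :
    ∏ p : IncPair M, f p.1.1 p.1.2 = ∏ i, ∏ j, if i < j then f i j else 1 := by
  rw [← Fintype.prod_prod_type' (f := fun i j => if i < j then f i j else 1), ← Finset.prod_filter]
  exact (Finset.prod_subtype (p := fun p : Fin M × Fin M => p.1 < p.2) _ (by simp)
    (fun p : Fin M × Fin M => f p.1 p.2)).symm

theorem alternant_zero_eq_prod {R : Type*} [CommRing R] {N : ℕ} (x : Fin N → R) :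
    alternant x 0 = ∏ i, ∏ j, if i < j then x i - x j else 1 := by
  induction N with
  | zero => simp [alternant]
  | succ N ih =>
    rw [alternant_succ_zero, ih, Fin.prod_univ_castSucc]
    simp only [Fin.prod_univ_castSucc, Fin.castSucc_lt_castSucc_iff, Fin.castSucc_lt_last, if_true,
      Finset.prod_mul_distrib]
    have h : ∀ i : Fin N, ¬ Fin.last N < i.castSucc := fun i => not_lt.2 (Fin.le_last _)
    simp [h, mul_comm]

/-- The monomial `x_i x_j` of a pair. -/
def pairMonomial (p : IncPair M) : MvPolynomial (Fin M) ℤ :=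
  MvPolynomial.X p.1.1 * MvPolynomial.X p.1.2

/-- Complete homogeneous functions in the monomials of the pairs in `A`. -/
def pairComplete (A : Finset (IncPair M)) (n : ℕ) : MvPolynomial (Fin M) ℤ :=
  PowerSeries.coeff n (∏ p ∈ A, PowerSeries.mk fun k => pairMonomial p ^ k)

theorem pairComplete_zero (A : Finset (IncPair M)) : pairComplete A 0 = 1 := by
  rw [pairComplete, PowerSeries.coeff_zero_eq_constantCoeff_apply, map_prod]
  refine Finset.prod_eq_one fun p _ => ?_
  rw [← PowerSeries.coeff_zero_eq_constantCoeff_apply, PowerSeries.coeff_mk, pow_zero]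

/-- From `1/(1 - yT) = 1 + yT/(1 - yT)` for the factor of the new pair. -/
theorem pairComplete_insert {A : Finset (IncPair M)} {p : IncPair M} (hp : p ∉ A) (n : ℕ) :
    pairComplete (insert p A) (n + 1) =
      pairComplete A (n + 1) + pairMonomial p * pairComplete (insert p A) n := by
  have h : (PowerSeries.mk fun k => pairMonomial p ^ k) =
      1 + PowerSeries.X * (PowerSeries.C (pairMonomial p) *
        PowerSeries.mk fun k => pairMonomial p ^ k) := by
    ext k
    cases k with
    | zero => simp
    | succ k => simp [PowerSeries.coeff_succ_X_mul, PowerSeries.coeff_one, pow_succ']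
  rw [pairComplete, pairComplete, pairComplete, Finset.prod_insert hp]
  conv_lhs => rw [h]
  rw [add_mul, one_mul, map_add, mul_assoc, PowerSeries.coeff_succ_X_mul, mul_assoc,
    PowerSeries.coeff_C_mul]

theorem pairComplete_univ (n : ℕ) :
    pairComplete (univ : Finset (IncPair M)) n = hfam pairMonomial n :=
  rfl

/-- The sum of all complete homogeneous functions in the monomials of the pairs in `A`. -/
def pairSeries (A : Finset (IncPair M)) : MvPowerSeries (Fin M) ℤ := fun d =>
  -- `h_n` of the pair monomials has degree `2n`, so `x^d` can occur only for `2n = deg d`.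
  (pairComplete A (d.degree / 2)).coeff d

theorem coeff_pairSeries (A : Finset (IncPair M)) (d : Fin M →₀ ℕ) :
    MvPowerSeries.coeff d (pairSeries A) = (pairComplete A (d.degree / 2)).coeff d :=
  rfl

theorem pairMonomial_eq (p : IncPair M) : pairMonomial p =
    MvPolynomial.monomial (Finsupp.single p.1.1 1 + Finsupp.single p.1.2 1) 1 := by
  rw [pairMonomial, MvPolynomial.X, MvPolynomial.X, MvPolynomial.monomial_mul, mul_one]

theorem pairSeries_insert {A : Finset (IncPair M)} {p : IncPair M} (hp : p ∉ A) :
    pairSeries (insert p A) * (1 - MvPowerSeries.X p.1.1 * MvPowerSeries.X p.1.2) =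
      pairSeries A := by
  ext d
  set e : Fin M →₀ ℕ := Finsupp.single p.1.1 1 + Finsupp.single p.1.2 1 with he
  have hdeg : e.degree = 2 := by
    rw [he, Finsupp.degree_eq_sum]
    simp [Finset.sum_add_distrib]
  rw [X_mul_X_eq_monomial, mul_sub, mul_one, map_sub, MvPowerSeries.coeff_mul_monomial, mul_one,
    ← he, coeff_pairSeries, coeff_pairSeries, coeff_pairSeries]
  rcases h : d.degree / 2 with _ | n
  · rw [pairComplete_zero, pairComplete_zero, if_neg, sub_zero]
    intro hle
    have h1 : d.degree = e.degree + (d - e).degree := by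
      rw [← map_add, add_tsub_cancel_of_le hle]
    omega
  · rw [pairComplete_insert hp, MvPolynomial.coeff_add, pairMonomial_eq, ← he,
      MvPolynomial.coeff_monomial_mul']
    split_ifs with hle
    · have h1 : d.degree = e.degree + (d - e).degree := by
        rw [← map_add, add_tsub_cancel_of_le hle]
      have h2 : (d - e).degree / 2 = n := by omega
      rw [h2, one_mul, add_sub_cancel_right]
    · rw [add_zero, sub_zero]

theorem pairSeries_mul_prod (A : Finset (IncPair M)) :
    pairSeries A * ∏ p ∈ A, (1 - MvPowerSeries.X p.1.1 * MvPowerSeries.X p.1.2) = 1 := by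
  induction A using Finset.induction_on with
  | empty =>
    rw [Finset.prod_empty, mul_one]
    ext d
    classical
    rw [coeff_pairSeries, MvPowerSeries.coeff_one, pairComplete, Finset.prod_empty,
      PowerSeries.coeff_one]
    split_ifs with h1 h2 h2
    · simp [h2]
    · rw [MvPolynomial.coeff_one, if_neg (Ne.symm h2)]
    · rw [h2] at h1
      simp at h1
    · rw [MvPolynomial.coeff_zero]
  | insert p A hp ih => rw [Finset.prod_insert hp, ← mul_assoc, pairSeries_insert hp, ih]

theorem prod_geomPair : ∏ p : IncPair M, geomPair p.1.1 p.1.2 = pairSeries univ := by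
  have h1 : (∏ p : IncPair M, geomPair p.1.1 p.1.2) *
      ∏ p : IncPair M, (1 - MvPowerSeries.X p.1.1 * MvPowerSeries.X p.1.2) = 1 := by
    rw [← Finset.prod_mul_distrib]
    exact Finset.prod_eq_one fun p _ => geomPair_mul p.2.ne
  have h2 := pairSeries_mul_prod (univ : Finset (IncPair M))
  rw [mul_comm] at h2
  exact left_inv_eq_right_inv h1 h2

theorem schurProd_univ : schurProd (univ : Finset (Fin M)) =
    ((alternant (fun i : Fin M => (MvPolynomial.X i : MvPolynomial (Fin M) ℤ)) 0 :
      MvPolynomial (Fin M) ℤ) : MvPowerSeries (Fin M) ℤ) * pairSeries univ := by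
  have h1 := map_alternant (MvPolynomial.coeToMvPowerSeries.ringHom (σ := Fin M) (R := ℤ))
    (fun i : Fin M => (MvPolynomial.X i : MvPolynomial (Fin M) ℤ)) 0
  rw [MvPolynomial.coeToMvPowerSeries.ringHom_apply, alternant_zero_eq_prod
    (fun i => MvPolynomial.coeToMvPowerSeries.ringHom (MvPolynomial.X i))] at h1
  simp only [MvPolynomial.coeToMvPowerSeries.ringHom_apply, MvPolynomial.coe_X] at h1
  rw [h1, ← prod_geomPair, prod_incPair (fun i j => geomPair i j), schurProd,
    ← Finset.prod_mul_distrib]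
  refine Finset.prod_congr rfl fun i _ => ?_
  rw [← Finset.prod_mul_distrib]
  refine Finset.prod_congr rfl fun j _ => ?_
  split_ifs
  · rfl
  · rw [one_mul]

/-- The series is `a_δ ∏ 1/(1 - x_i x_j)`; the degree condition `hd` selects the summand `h_n ∘ e_2`
of the second factor. -/
theorem coeff_schurProd_univ (d : Fin M →₀ ℕ) (n : ℕ)
    (hd : ∑ i, (d i : ℤ) = 2 * n + ∑ i, stair M i) :
    MvPowerSeries.coeff d (schurProd (univ : Finset (Fin M))) =
      altCoeff (fun i => (d i : ℤ)) (hfam pairMonomial n) := by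
  rw [schurProd_univ, alternant_X, altCoeff_apply]
  have h1 := map_sum (MvPolynomial.coeToMvPowerSeries.ringHom (σ := Fin M) (R := ℤ))
    (fun σ : Equiv.Perm (Fin M) => (Equiv.Perm.sign σ : ℤ) • MvPolynomial.monomial
        (Finsupp.equivFunOnFinite.symm fun i => (0 : Fin M → ℕ) (σ i) + (M - 1 - σ i)) (1 : ℤ)) univ
  simp only [map_zsmul, MvPolynomial.coeToMvPowerSeries.ringHom_apply,
    MvPolynomial.coe_monomial] at h1
  rw [h1, Finset.sum_mul, map_sum]
  refine Finset.sum_congr rfl fun σ _ => ?_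
  rw [smul_mul_assoc, map_zsmul, smul_eq_mul, MvPowerSeries.coeff_monomial_mul, one_mul]
  congr 1
  set e : Fin M →₀ ℕ :=
    Finsupp.equivFunOnFinite.symm fun i => (0 : Fin M → ℕ) (σ i) + (M - 1 - σ i) with he
  have hei : ∀ i, (e i : ℤ) = stair M (σ i) := fun i => by
    rw [← coe_stair, he]
    simp
  split_ifs with hle
  · have h2 : (fun i => (d i : ℤ) - stair M (σ i)) = fun i => (((d - e) i : ℕ) : ℤ) := by
      funext i
      rw [← hei, Finsupp.tsub_apply, Nat.cast_sub (hle i)]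
    rw [h2, zcoeff_natCast, coeff_pairSeries, pairComplete_univ]
    have h3 : (((d - e).degree : ℕ) : ℤ) = 2 * n := by
      rw [Finsupp.degree_eq_sum, Nat.cast_sum, Finset.sum_congr rfl
        (fun i _ => (congrFun h2 i).symm), Finset.sum_sub_distrib, hd,
        Equiv.sum_comp σ (stair M), add_sub_cancel_right]
    have h4 : (d - e).degree / 2 = n := by omega
    rw [h4]
  · obtain ⟨i, hi⟩ : ∃ i, d i < e i := by
      by_contra h
      push Not at h
      exact hle h
    rw [zcoeff_of_neg (i := i)]
    rw [← hei]
    omega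

/-- Littlewood's identity for `h_n ∘ e_2`. -/
theorem altCoeff_hfam_pairMonomial {l : Fin M → ℕ} (hl : StrictAnti l) (n : ℕ)
    (hd : ∑ i, (l i : ℤ) = 2 * n + ∑ i, stair M i) :
    altCoeff (fun i => (l i : ℤ)) (hfam pairMonomial n) =
      if ∀ s : Fin M, Even (s : ℕ) → l s = nextSucc l s then 1 else 0 := by
  have h := coeff_schurProd_tail hl M 0 (by omega)
  have ht : tail M 0 = univ := by
    ext i
    simp [mem_tail]
  have hc : ∀ i, cut l univ i = l i := fun i => by simp [cut_apply]
  rw [ht, coeff_schurProd_univ (cut l univ) n (by simpa only [hc] using hd)] at h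
  simp only [hc, Nat.zero_le, true_implies, Nat.sub_zero] at h
  exact h

end Littlewood

/-! ### From `h_n ∘ e_m` in `m + 2` variables to `h_n ∘ e_2`. -/

section Complement

variable {M : ℕ} {ι : Type*} [Fintype ι]

/-- Squarefree monomials. -/
def setMonomial (A : Finset (Fin M)) : MvPolynomial (Fin M) ℤ := ∏ i ∈ A, MvPolynomial.X i

theorem hfam_setMonomial [DecidableEq ι] (A : ι → Finset (Fin M)) (n : ℕ) :
    hfam (fun t => setMonomial (A t)) n = ∑ c ∈ (univ : Finset ι).finsuppAntidiag n,
      MvPolynomial.monomial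
        (Finsupp.equivFunOnFinite.symm fun i => ∑ t, if i ∈ A t then c t else 0) 1 := by
  rw [hfam_eq_sum]
  refine Finset.sum_congr rfl fun c _ => ?_
  rw [MvPolynomial.monomial_eq, Finsupp.prod_fintype _ _ (fun _ => pow_zero _), map_one, one_mul]
  simp only [Finsupp.equivFunOnFinite_symm_apply_apply, ← Finset.prod_pow_eq_pow_sum]
  rw [Finset.prod_comm]
  refine Finset.prod_congr rfl fun t _ => ?_
  rw [setMonomial, ← Finset.prod_pow, ← Finset.prod_subset (Finset.subset_univ (A t))]
  · exact Finset.prod_congr rfl fun i hi => by rw [if_pos hi]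
  · intro i _ hi
    rw [if_neg hi, pow_zero]

/-- In a product of `n` squarefree monomials, each variable divides either a factor or its
complement, so its two exponents add up to `n`. -/
theorem zcoeff_hfam_compl (A : ι → Finset (Fin M)) (n : ℕ) (v : Fin M → ℤ) :
    zcoeff v (hfam (fun t => setMonomial (A t)) n) =
      zcoeff (fun i => n - v i) (hfam (fun t => setMonomial (A t)ᶜ) n) := by
  classical
  rw [hfam_setMonomial, hfam_setMonomial, map_sum, map_sum]
  refine Finset.sum_congr rfl fun c hc => ?_
  rw [zcoeff_monomial, zcoeff_monomial]
  refine if_congr (forall_congr' fun i => ?_) rfl rfl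
  have h1 : (∑ t, if i ∈ A t then c t else 0) + (∑ t, if i ∈ (A t)ᶜ then c t else 0) = n := by
    rw [← (mem_finsuppAntidiag.1 hc).1, ← Finset.sum_add_distrib]
    refine Finset.sum_congr rfl fun t _ => ?_
    by_cases h : i ∈ A t <;> simp [h]
  rw [Finsupp.equivFunOnFinite_symm_apply_apply, Finsupp.equivFunOnFinite_symm_apply_apply]
  omega

theorem sign_rev_conj (σ : Equiv.Perm (Fin M)) :
    Equiv.Perm.sign (Fin.revPerm.permCongr σ) = Equiv.Perm.sign σ :=
  Equiv.Perm.sign_permCongr _ _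

theorem stair_add_stair_rev (i : Fin M) : stair M i + stair M i.rev = M - 1 := by
  rw [stair_rev]
  unfold stair
  ring

/-- Complementing exponents reverses their order, and the reversal of the variables restores it.
Symmetry permits this reversal, and conjugating `σ` by it keeps the sign. -/
theorem altCoeff_hfam_compl (A : ι → Finset (Fin M)) (n : ℕ)
    (hs : (hfam (fun t => setMonomial (A t)) n).IsSymmetric) (l : Fin M → ℤ) :
    altCoeff l (hfam (fun t => setMonomial (A t)) n) =
      altCoeff (fun i => n + M - 1 - l i.rev) (hfam (fun t => setMonomial (A t)ᶜ) n) := by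
  rw [altCoeff_apply, altCoeff_apply]
  refine Fintype.sum_equiv Fin.revPerm.permCongr _ _ fun σ => ?_
  rw [sign_rev_conj]
  congr 1
  rw [← zcoeff_comp hs _ Fin.revPerm, zcoeff_hfam_compl]
  congr 2
  funext i
  have := stair_add_stair_rev (σ i.rev)
  simp only [Function.comp_apply, Fin.revPerm_apply, Equiv.permCongr_apply, Fin.revPerm_symm]
  omega

/-- The complement of a pair among `m + 2` indices. -/
def complPair {m : ℕ} (p : IncPair (m + 2)) : {A : Finset (Fin (m + 2)) // A.card = m} :=
  ⟨{p.1.1, p.1.2}ᶜ, by rw [card_compl, card_pair p.2.ne]; simp⟩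

theorem complPair_bijective (m : ℕ) : Function.Bijective (complPair (m := m)) := by
  constructor
  · rintro ⟨⟨a, b⟩, h⟩ ⟨⟨c, d⟩, h'⟩ he
    have h1 : ({a, b} : Finset (Fin (m + 2))) = {c, d} := compl_injective (congrArg Subtype.val he)
    simp only at h h'
    have ha : a ∈ ({c, d} : Finset (Fin (m + 2))) := h1 ▸ mem_insert_self _ _
    have hb : b ∈ ({c, d} : Finset (Fin (m + 2))) :=
      h1 ▸ mem_insert_of_mem (mem_singleton_self _)
    rw [mem_insert, mem_singleton] at ha hb
    apply Subtype.ext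
    rcases ha with rfl | rfl <;> rcases hb with rfl | rfl
    · exact absurd h (lt_irrefl _)
    · rfl
    · exact absurd h (not_lt.2 h'.le)
    · exact absurd h (lt_irrefl _)
  · rintro ⟨A, hA⟩
    have h1 : Aᶜ.card = 2 := by
      rw [card_compl, hA]
      simp
    obtain ⟨x, y, hxy, h2⟩ := card_eq_two.1 h1
    rcases lt_or_gt_of_ne hxy with h | h
    · refine ⟨⟨(x, y), h⟩, Subtype.ext ?_⟩
      simp only [complPair]
      rw [← h2, compl_compl]
    · refine ⟨⟨(y, x), h⟩, Subtype.ext ?_⟩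
      simp only [complPair]
      rw [pair_comm, ← h2, compl_compl]

theorem hfam_setMonomial_compl (m n : ℕ) :
    hfam (fun A : {A : Finset (Fin (m + 2)) // A.card = m} => setMonomial (A.1)ᶜ) n =
      hfam pairMonomial n := by
  rw [← hfam_comp_equiv (Equiv.ofBijective _ (complPair_bijective m))]
  congr 1
  funext p
  change setMonomial ({p.1.1, p.1.2}ᶜᶜ : Finset (Fin (m + 2))) = _
  rw [compl_compl, setMonomial, pairMonomial, Finset.prod_pair p.2.ne]

theorem sum_setMonomial_pow (M m k : ℕ) :
    ∑ A : {A : Finset (Fin M) // A.card = m}, setMonomial A.1 ^ k =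
      efam (fun i : Fin M => (MvPolynomial.X i : MvPolynomial (Fin M) ℤ) ^ k) m := by
  rw [efam, ← Finset.sum_subtype (p := fun A : Finset (Fin M) => A.card = m)
    (powersetCard m univ) (by simp) (fun A => setMonomial A ^ k)]
  refine Finset.sum_congr rfl fun A _ => ?_
  rw [setMonomial, Finset.prod_pow]

end Complement

/-! ### The plethysms under the duality. -/

section PlethysmDuality

variable {N M : ℕ}

theorem mem_dualPairs_of_mem_dualMultipliers
    {a : MvPolynomial (Fin N) ℤ × MvPolynomial (Fin M) ℤ} (h : a ∈ dualMultipliers N M) :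
    a ∈ dualPairs N M := by
  simpa using h 1 one_mem_dualPairs

theorem weight_pow_mem_dualMultipliers (N M m k : ℕ) :
    (∑ T : BoundedSSYT (rowShape m) N, T.weight ^ (k + 1),
      (-1) ^ m * ∑ A : {A : Finset (Fin M) // A.card = m}, setMonomial A.1 ^ (k + 1)) ∈
      dualMultipliers N M := by
  rw [sum_rowShape_weight_pow, sum_setMonomial_pow]
  exact hfam_pow_mem_dualMultipliers N M k m

/-- `p_k ∘ h_m` corresponds to `(-1)^m p_k ∘ e_m`. For even `m` the sign disappears and the same
Newton recursion holds in both components. -/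
theorem plethysm_row_row_mem_dualPairs (N M n : ℕ) {m : ℕ} (hm : Even m) :
    (plethysm (rowShape n) (rowShape m) N,
      hfam (fun A : {A : Finset (Fin M) // A.card = m} => setMonomial A.1) n) ∈
      dualPairs N M := by
  rw [plethysm_rowShape]
  refine mem_dualPairs_of_mem_dualMultipliers (newton_mem (dualMultipliers N M)
    mem_dualMultipliers_of_natCast_mul
    (a := fun n => (hfam (fun T : BoundedSSYT (rowShape m) N => T.weight) n,
      hfam (fun A : {A : Finset (Fin M) // A.card = m} => setMonomial A.1) n))
    (p := fun k => (∑ T : BoundedSSYT (rowShape m) N, T.weight ^ (k + 1),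
      (-1) ^ m * ∑ A : {A : Finset (Fin M) // A.card = m}, setMonomial A.1 ^ (k + 1)))
    ?_ (weight_pow_mem_dualMultipliers N M m) (fun n => ?_) n)
  · simp only [hfam_zero]
    exact (dualMultipliers N M).one_mem
  · apply Prod.ext
    · simp only [Prod.fst_mul, Prod.fst_natCast, mul_hfam_succ, Prod.fst_sum]
    · simp only [Prod.snd_mul, Prod.snd_natCast, mul_hfam_succ, Prod.snd_sum, hm.neg_one_pow,
        one_mul]

/-- For odd `m` every power sum changes sign, which turns the recursion of `e_n` into that of
`(-1)^n h_n`. -/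
theorem plethysm_col_row_mem_dualPairs (N M n : ℕ) {m : ℕ} (hm : Odd m) :
    (plethysm (colShape n) (rowShape m) N,
      (-1) ^ n * hfam (fun A : {A : Finset (Fin M) // A.card = m} => setMonomial A.1) n) ∈
      dualPairs N M := by
  rw [plethysm_colShape]
  refine mem_dualPairs_of_mem_dualMultipliers (newton_mem (dualMultipliers N M)
    mem_dualMultipliers_of_natCast_mul
    (a := fun n => (efam (fun T : BoundedSSYT (rowShape m) N => T.weight) n,
      (-1) ^ n * hfam (fun A : {A : Finset (Fin M) // A.card = m} => setMonomial A.1) n))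
    (p := fun k => (-1) ^ k * (∑ T : BoundedSSYT (rowShape m) N, T.weight ^ (k + 1),
      (-1) ^ m * ∑ A : {A : Finset (Fin M) // A.card = m}, setMonomial A.1 ^ (k + 1)))
    ?_ (fun k => (dualMultipliers N M).mul_mem
      ((dualMultipliers N M).pow_mem (neg_mem (one_mem _)) _)
      (weight_pow_mem_dualMultipliers N M m k)) (fun n => ?_) n)
  · simp only [hfam_zero, efam_zero, pow_zero, mul_one]
    exact (dualMultipliers N M).one_mem
  · apply Prod.ext
    · simp only [Prod.fst_mul, Prod.fst_natCast, mul_efam_succ, Prod.fst_sum, Prod.pow_fst,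
        Prod.fst_neg, Prod.fst_one]
    · simp only [Prod.snd_mul, Prod.snd_natCast, Prod.snd_sum, hm.neg_one_pow, Prod.pow_snd,
        Prod.snd_neg, Prod.snd_one]
      rw [mul_left_comm, mul_hfam_succ, Finset.mul_sum]
      refine Finset.sum_congr rfl fun k hk => ?_
      have hk' := Finset.mem_range.1 hk
      obtain ⟨d, rfl⟩ : ∃ d, n = k + d := ⟨n - k, by omega⟩
      rw [Nat.add_sub_cancel_left]
      ring

end PlethysmDuality

/-! ### The bead configuration of a partition. -/

section BeadConfiguration

variable {N M : ℕ}

/-- Numbering beads and holes by position makes `π` a permutation of `Fin (N + M)`, whose sign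
counts inversions. -/
theorem sign_eq_prod_bead (π : Equiv.Perm (Fin N ⊕ Fin M)) :
    Equiv.Perm.sign π = ∏ x, ∏ y,
      if bead N M y < bead N M x ∧ bead N M (π x) < bead N M (π y) then (-1 : ℤˣ) else 1 := by
  have hb : Function.Bijective
      (fun x : Fin N ⊕ Fin M => (⟨(bead N M x).toNat, by
        have := bead_lt x; have := bead_nonneg x; omega⟩ : Fin (N + M))) := by
    rw [Fintype.bijective_iff_injective_and_card]
    refine ⟨fun x y h => bead_injective ?_, by simp⟩
    have h1 := Fin.ext_iff.1 h
    have := bead_nonneg x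
    have := bead_nonneg y
    simp only at h1
    omega
  have hlt : ∀ x y, Equiv.ofBijective _ hb x < Equiv.ofBijective _ hb y ↔
      bead N M x < bead N M y := fun x y => by
    have := bead_nonneg x
    have := bead_nonneg y
    rw [Equiv.ofBijective_apply, Equiv.ofBijective_apply, Fin.mk_lt_mk]
    omega
  rw [← Equiv.Perm.sign_permCongr (Equiv.ofBijective _ hb), Equiv.Perm.sign_eq_prod_prod_Iio,
    ← Equiv.prod_comp (Equiv.ofBijective _ hb)]
  refine Finset.prod_congr rfl fun x _ => ?_
  have h1 : Finset.Iio (Equiv.ofBijective _ hb x) =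
      univ.filter (· < Equiv.ofBijective _ hb x) := by
    ext
    simp
  rw [h1, Finset.prod_filter, ← Equiv.prod_comp (Equiv.ofBijective _ hb)]
  refine Finset.prod_congr rfl fun y _ => ?_
  simp only [Equiv.permCongr_apply, Equiv.symm_apply_apply, hlt]
  by_cases h : bead N M y < bead N M x
  · have h2 : bead N M (π x) ≠ bead N M (π y) := fun h' => by
      rw [π.injective (bead_injective h')] at h
      exact lt_irrefl _ h
    rw [if_pos h]
    by_cases h3 : bead N M (π y) < bead N M (π x)
    · rw [if_pos h3, if_neg (fun h' => absurd h3 (not_lt.2 h'.2.le))]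
    · rw [if_neg h3, if_pos ⟨h, lt_of_le_of_ne (not_lt.1 h3) h2⟩]
  · rw [if_neg h, if_neg (fun h' => h h'.1)]

theorem lt_rowLen_iff_lt_colLen (μ : YoungDiagram) (i j : ℕ) :
    j < μ.rowLen i ↔ i < μ.colLen j := by
  rw [← YoungDiagram.mem_iff_lt_rowLen, YoungDiagram.mem_iff_lt_colLen]

theorem colLen_le (μ : YoungDiagram) (h : μ.colLen 0 ≤ N) (j : ℕ) : μ.colLen j ≤ N :=
  (μ.colLen_anti 0 j (Nat.zero_le j)).trans h

theorem rowLen_le (μ : YoungDiagram) (h : μ.rowLen 0 ≤ M) (i : ℕ) : μ.rowLen i ≤ M :=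
  (μ.rowLen_anti 0 i (Nat.zero_le i)).trans h

/-- The positions of the vertical and of the horizontal steps of the boundary of a partition. -/
def boundary (N M : ℕ) (μ : YoungDiagram) : Fin N ⊕ Fin M → ℤ
  | .inl i => shifted N μ i
  | .inr j => N + j - μ.colLen j

theorem boundary_inl_lt_inl (μ : YoungDiagram) {i i' : Fin N} (h : i < i') :
    boundary N M μ (.inl i') < boundary N M μ (.inl i) :=
  shifted_strictAnti N μ h

theorem boundary_inr_lt_inr (μ : YoungDiagram) {j j' : Fin M} (h : j < j') :
    boundary N M μ (.inr j) < boundary N M μ (.inr j') := by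
  have := μ.colLen_anti j j' (Fin.le_def.1 h.le)
  have := Fin.lt_def.1 h
  simp only [boundary]
  omega

theorem boundary_inr_lt_inl_iff (μ : YoungDiagram) (i : Fin N) (j : Fin M) :
    boundary N M μ (.inr j) < boundary N M μ (.inl i) ↔ (j : ℕ) < μ.rowLen i := by
  have := lt_rowLen_iff_lt_colLen μ i j
  simp only [boundary, shifted, stair]
  constructor
  · intro h
    by_contra h'
    omega
  · intro h
    omega

theorem boundary_inr_ne_inl (μ : YoungDiagram) (i : Fin N) (j : Fin M) :
    boundary N M μ (.inr j) ≠ boundary N M μ (.inl i) := by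
  have := lt_rowLen_iff_lt_colLen μ i j
  simp only [boundary, shifted, stair]
  intro h
  by_cases h' : (j : ℕ) < μ.rowLen i <;> omega

theorem boundary_injective (μ : YoungDiagram) :
    Function.Injective (boundary N M μ) := by
  rintro (i | j) (i' | j') h
  · exact congrArg _ ((shifted_strictAnti N μ).injective h)
  · exact absurd h.symm (boundary_inr_ne_inl μ i j')
  · exact absurd h (boundary_inr_ne_inl μ i' j)
  · rcases lt_trichotomy j j' with h' | h' | h'
    · exact absurd h (boundary_inr_lt_inr μ h').ne
    · rw [h']
    · exact absurd h (boundary_inr_lt_inr μ h').ne'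

/-- The boundary path of `μ` in an `N × M` box has `N + M` steps, at distinct positions in `0, …,
N+M-1`. -/
theorem exists_perm_boundary (μ : YoungDiagram) (hN : μ.colLen 0 ≤ N) (hM : μ.rowLen 0 ≤ M) :
    ∃ π : Equiv.Perm (Fin N ⊕ Fin M), ∀ x, bead N M (π x) = boundary N M μ x := by
  have h1 : ∀ x : Fin N ⊕ Fin M, 0 ≤ boundary N M μ x ∧ boundary N M μ x < N + M := by
    rintro (i | j)
    · have := rowLen_le μ hM i
      have := i.2
      simp only [boundary, shifted, stair]
      omega
    · have := colLen_le μ hN j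
      have := j.2
      simp only [boundary]
      omega
  choose f hf using fun x : Fin N ⊕ Fin M => exists_bead_eq (h1 x).1 (h1 x).2
  refine ⟨Equiv.ofBijective f (Finite.injective_iff_bijective.1 fun x y h => ?_), hf⟩
  apply boundary_injective μ
  rw [← hf, ← hf, h]

/-- The inversions are the boxes: bead `i` starts below hole `j` and ends above it exactly when `(i,
j)` is in `μ`. -/
theorem sign_boundary {μ : YoungDiagram} (hN : μ.colLen 0 ≤ N) (hM : μ.rowLen 0 ≤ M)
    {π : Equiv.Perm (Fin N ⊕ Fin M)} (hπ : ∀ x, bead N M (π x) = boundary N M μ x) :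
    Equiv.Perm.sign π = (-1) ^ μ.card := by
  have hll : ∀ i i' : Fin N, ¬ (bead N M (.inl i') < bead N M (.inl i) ∧
      boundary N M μ (.inl i) < boundary N M μ (.inl i')) := by
    rintro i i' ⟨h1, h2⟩
    refine absurd h2 (not_lt.2 (boundary_inl_lt_inl μ ?_).le)
    simp only [bead, stair] at h1
    exact Fin.lt_def.2 (by omega)
  have hlr : ∀ (i : Fin N) (j : Fin M), ¬ (bead N M (.inr j) < bead N M (.inl i) ∧
      boundary N M μ (.inl i) < boundary N M μ (.inr j)) := by
    rintro i j ⟨h1, -⟩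
    simp only [bead, stair] at h1
    omega
  have hrr : ∀ j j' : Fin M, ¬ (bead N M (.inr j') < bead N M (.inr j) ∧
      boundary N M μ (.inr j) < boundary N M μ (.inr j')) := by
    rintro j j' ⟨h1, h2⟩
    refine absurd h2 (not_lt.2 (boundary_inr_lt_inr μ ?_).le)
    simp only [bead] at h1
    exact Fin.lt_def.2 (by omega)
  have hrl : ∀ (i : Fin N) (j : Fin M), (bead N M (.inl i) < bead N M (.inr j) ∧
      boundary N M μ (.inr j) < boundary N M μ (.inl i)) ↔ (j : ℕ) < μ.rowLen i := by
    intro i j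
    rw [boundary_inr_lt_inl_iff, and_iff_right]
    simp only [bead, stair]
    omega
  simp only [sign_eq_prod_bead, hπ, Fintype.prod_sum_type, hll, hlr, hrr, hrl, if_false,
    Finset.prod_const_one, mul_one, one_mul]
  rw [Finset.prod_comm, card_eq_sum_rowLen hN, ← Finset.prod_pow_eq_pow_sum]
  refine Finset.prod_congr rfl fun i _ => ?_
  rw [← Finset.prod_filter, Finset.prod_const, Fin.card_filter_val_lt,
    min_eq_right (rowLen_le μ hM i)]

theorem dualPairs_shifted {μ : YoungDiagram} (hN : μ.colLen 0 ≤ N) (hM : μ.rowLen 0 ≤ M)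
    {p : MvPolynomial (Fin N) ℤ × MvPolynomial (Fin M) ℤ} (hp : p ∈ dualPairs N M) :
    (-1) ^ μ.card * altCoeff (shifted N μ) p.1 =
      altCoeff (fun j : Fin M => μ.colLen j + stair M j) p.2 := by
  obtain ⟨π, hπ⟩ := exists_perm_boundary μ hN hM
  have h := hp.2.2 π
  have h1 : beads π = shifted N μ := funext fun i => hπ (.inl i)
  have h2 : holes π = fun j : Fin M => μ.colLen j + stair M j := funext fun j => by
    rw [holes, hπ]
    simp only [boundary, stair]
    ring
  rw [h1, h2, sign_boundary hN hM hπ] at h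
  rw [← h]
  simp

end BeadConfiguration

/-! ### Parity of the rows in terms of the columns. -/

section Parity

variable {n : ℕ}

/-- A row of length `2k + 1` meets column `2k` but not column `2k + 1`, so odd rows are exactly what
makes these columns differ. -/
theorem forall_even_rowLen_iff {μ : YoungDiagram} (h : μ.colLen 0 ≤ n) :
    (∀ i < n, Even (μ.rowLen i)) ↔ ∀ k, μ.colLen (2 * k) = μ.colLen (2 * k + 1) := by
  constructor
  · intro he k
    refine le_antisymm (not_lt.1 fun hlt => ?_) (μ.colLen_anti _ _ (Nat.le_succ _))
    have h1 := he (μ.colLen (2 * k + 1)) (hlt.trans_le (colLen_le μ h _))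
    have h2 := (lt_rowLen_iff_lt_colLen μ _ _).2 hlt
    have h3 := (lt_rowLen_iff_lt_colLen μ (μ.colLen (2 * k + 1)) (2 * k + 1)).not.2 (lt_irrefl _)
    rw [Nat.even_iff] at h1
    omega
  · intro hc i _
    by_contra ho
    rw [Nat.not_even_iff_odd] at ho
    obtain ⟨k, hk⟩ := ho
    have h1 := (lt_rowLen_iff_lt_colLen μ i (2 * k)).1 (by omega)
    rw [hc, ← lt_rowLen_iff_lt_colLen] at h1
    omega

theorem forall_odd_rowLen_iff {μ : YoungDiagram} (h : μ.colLen 0 ≤ n) :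
    (∀ i < n, Odd (μ.rowLen i)) ↔
      μ.colLen 0 = n ∧ ∀ k, μ.colLen (2 * k + 1) = μ.colLen (2 * k + 2) := by
  constructor
  · intro ho
    refine ⟨le_antisymm h (not_lt.1 fun hlt => ?_), fun k =>
      le_antisymm (not_lt.1 fun hlt => ?_) (μ.colLen_anti _ _ (Nat.le_succ _))⟩
    · have h1 := ho _ hlt
      have h3 := (lt_rowLen_iff_lt_colLen μ (μ.colLen 0) 0).not.2 (lt_irrefl _)
      rw [Nat.odd_iff] at h1
      omega
    · have h1 := ho (μ.colLen (2 * k + 2)) (hlt.trans_le (colLen_le μ h _))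
      have h2 := (lt_rowLen_iff_lt_colLen μ _ _).2 hlt
      have h3 := (lt_rowLen_iff_lt_colLen μ (μ.colLen (2 * k + 2)) (2 * k + 2)).not.2
        (lt_irrefl _)
      rw [Nat.odd_iff] at h1
      omega
  · rintro ⟨h0, hc⟩ i hi
    by_contra he
    rw [Nat.not_odd_iff_even, even_iff_exists_two_mul] at he
    obtain ⟨k, hk⟩ := he
    cases k with
    | zero =>
      have := (lt_rowLen_iff_lt_colLen μ i 0).2 (by omega)
      omega
    | succ k =>
      have h1 := (lt_rowLen_iff_lt_colLen μ i (2 * k + 1)).1 (by omega)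
      rw [hc, ← lt_rowLen_iff_lt_colLen] at h1
      omega

theorem colLen_eq_zero {μ : YoungDiagram} {M j : ℕ} (h : μ.rowLen 0 ≤ M) (hj : M ≤ j) :
    μ.colLen j = 0 := by
  have := lt_rowLen_iff_lt_colLen μ 0 j
  omega

theorem sum_colLen {μ : YoungDiagram} {M : ℕ} (h : μ.rowLen 0 ≤ M) :
    ∑ j : Fin M, μ.colLen j = μ.card := by
  have := card_eq_sum_rowLen (μ := μ.transpose) (N := M) (by simpa using h)
  simp only [YoungDiagram.rowLen_transpose] at this
  rw [← this, YoungDiagram.card, YoungDiagram.card, YoungDiagram.transpose]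
  simp

/-- The columns of the complement of a partition with at most `n` rows, plus the staircase. -/
def complShifted (n : ℕ) (μ : YoungDiagram) {M : ℕ} (i : Fin M) : ℕ :=
  n - μ.colLen i.rev + i.rev

theorem complShifted_strictAnti (n : ℕ) (μ : YoungDiagram) (M : ℕ) :
    StrictAnti (complShifted n μ : Fin M → ℕ) := by
  intro i j hij
  have h1 : j.rev < i.rev := Fin.rev_lt_rev.2 hij
  have := μ.colLen_anti j.rev i.rev (Fin.le_def.1 h1.le)
  have := Fin.lt_def.1 h1
  unfold complShifted
  omega

/-- Entry `s` comes from column `M - 1 - s` and the next one from column `M - 2 - s`; the staircase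
supplies the difference 1, so the columns must be equal. For odd `M` the last entry is unpaired, and
its vanishing says that column `0` has length `n`. -/
theorem forall_complShifted_iff {μ : YoungDiagram} (h : μ.colLen 0 ≤ n) {M : ℕ} :
    (∀ s : Fin M, Even (s : ℕ) →
        complShifted n μ s = nextSucc (complShifted n μ) s) ↔
      (Odd M → μ.colLen 0 = n) ∧
        ∀ j, j + 2 ≤ M → (Even (j + M)) → μ.colLen j = μ.colLen (j + 1) := by
  constructor
  · intro hs
    refine ⟨fun hM => ?_, fun j hj he => ?_⟩
    · have hM' : 0 < M := hM.pos
      have := hs ⟨M - 1, by omega⟩ (by rw [Nat.odd_iff] at hM; rw [Nat.even_iff]; simp; omega)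
      rw [nextSucc, dif_neg (by simp; omega)] at this
      simp only [complShifted, Fin.val_rev] at this
      rw [show M - (M - 1 + 1) = 0 by omega] at this
      omega
    · have := hs ⟨M - 2 - j, by omega⟩ (by rw [Nat.even_iff] at he ⊢; simp; omega)
      rw [nextSucc, dif_pos (by simp; omega)] at this
      simp only [complShifted, Fin.val_rev] at this
      rw [show M - (M - 2 - j + 1) = j + 1 by omega,
        show M - (M - 2 - j + 1 + 1) = j by omega] at this
      have := colLen_le μ h j
      have := colLen_le μ h (j + 1)
      omega
  · rintro ⟨h0, hc⟩ s hs
    have hs' := s.2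
    rw [nextSucc]
    split_ifs with h1
    · have := hc (M - 2 - s) (by omega) (by rw [Nat.even_iff] at hs ⊢; omega)
      simp only [complShifted, Fin.val_rev]
      rw [show M - ((s : ℕ) + 1) = M - 2 - s + 1 by omega,
        show M - ((s : ℕ) + 1 + 1) = M - 2 - s by omega]
      omega
    · have := h0 (by rw [Nat.even_iff] at hs; rw [Nat.odd_iff]; omega)
      simp only [complShifted, Fin.val_rev]
      rw [show M - ((s : ℕ) + 1) = 0 by omega]
      omega

theorem forall_complShifted_iff_even {μ : YoungDiagram} (h : μ.colLen 0 ≤ n) {M : ℕ}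
    (hM : μ.rowLen 0 ≤ M) (he : Even M) :
    (∀ s : Fin M, Even (s : ℕ) → complShifted n μ s = nextSucc (complShifted n μ) s) ↔
      ∀ i < n, Even (μ.rowLen i) := by
  rw [forall_complShifted_iff h, forall_even_rowLen_iff h]
  rw [Nat.even_iff] at he
  constructor
  · rintro ⟨-, hc⟩ k
    by_cases hk : 2 * k + 2 ≤ M
    · exact hc (2 * k) hk (by rw [Nat.even_iff]; omega)
    · rw [colLen_eq_zero hM (by omega), colLen_eq_zero hM (by omega)]
  · intro hc
    refine ⟨fun ho => by rw [Nat.odd_iff] at ho; omega, fun j _ hj => ?_⟩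
    obtain ⟨k, rfl⟩ : ∃ k, j = 2 * k := ⟨j / 2, by rw [Nat.even_iff] at hj; omega⟩
    exact hc k

theorem forall_complShifted_iff_odd {μ : YoungDiagram} (h : μ.colLen 0 ≤ n) {M : ℕ}
    (hM : μ.rowLen 0 ≤ M) (ho : Odd M) :
    (∀ s : Fin M, Even (s : ℕ) → complShifted n μ s = nextSucc (complShifted n μ) s) ↔
      ∀ i < n, Odd (μ.rowLen i) := by
  rw [forall_complShifted_iff h, forall_odd_rowLen_iff h, forall_prop_of_true ho]
  rw [Nat.odd_iff] at ho
  refine and_congr_right fun _ => ⟨fun hc k => ?_, fun hc j _ hj => ?_⟩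
  · by_cases hk : 2 * k + 1 + 2 ≤ M
    · exact hc (2 * k + 1) hk (by rw [Nat.even_iff]; omega)
    · rw [colLen_eq_zero hM (by omega), colLen_eq_zero hM (by omega)]
  · obtain ⟨k, rfl⟩ : ∃ k, j = 2 * k + 1 := ⟨j / 2, by rw [Nat.even_iff] at hj; omega⟩
    exact hc k

end Parity

/-! ### Evaluation of the two coefficients. -/

section Evaluation

variable {m n : ℕ}

theorem altCoeff_hfam_setMonomial {μ : YoungDiagram} (hcard : μ.card = m * n)
    (hlen : μ.colLen 0 ≤ n) (hfirst : μ.rowLen 0 ≤ m + 2)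
    (hs : (hfam (fun A : {A : Finset (Fin (m + 2)) // A.card = m} => setMonomial A.1)
      n).IsSymmetric) :
    altCoeff (fun j : Fin (m + 2) => μ.colLen j + stair (m + 2) j)
        (hfam (fun A : {A : Finset (Fin (m + 2)) // A.card = m} => setMonomial A.1) n) =
      if ∀ s : Fin (m + 2), Even (s : ℕ) →
        complShifted n μ s = nextSucc (complShifted n μ) s then 1 else 0 := by
  have hl : (fun i : Fin (m + 2) => (n : ℤ) + (m + 2 : ℕ) - 1 -
      (μ.colLen i.rev + stair (m + 2) i.rev)) = fun i => (complShifted n μ i : ℤ) := by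
    funext i
    have := colLen_le μ hlen i.rev
    have := i.2
    rw [stair_rev, complShifted]
    rw [Fin.val_rev] at *
    omega
  rw [altCoeff_hfam_compl _ n hs, hl, hfam_setMonomial_compl,
    altCoeff_hfam_pairMonomial (complShifted_strictAnti n μ (m + 2))]
  -- The complement in the `(m+2) × n` box has `(m+2)n - mn = 2n` boxes, the degree of `h_n ∘ e_2`.
  have h1 : ∑ i : Fin (m + 2), (μ.colLen i.rev : ℤ) = m * n := by
    rw [← Equiv.sum_comp Fin.revPerm]
    simp only [Fin.revPerm_apply, Fin.rev_rev]
    rw [← Nat.cast_sum, sum_colLen hfirst, hcard, Nat.cast_mul]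
  have h2 : ∀ i : Fin (m + 2), (complShifted n μ i : ℤ) =
      n - μ.colLen i.rev + stair (m + 2) i := fun i => by
    have := congrFun hl i
    have h3 := stair_add_stair_rev i
    push_cast at h3 this
    linarith
  simp only [h2, Finset.sum_add_distrib, Finset.sum_sub_distrib, h1]
  simp
  ring

theorem altCoeff_plethysm_row_row {μ : YoungDiagram} (hm : Even m) (hcard : μ.card = m * n)
    (hlen : μ.colLen 0 ≤ n) (hfirst : μ.rowLen 0 ≤ m + 2) :
    altCoeff (shifted n μ) (plethysm (rowShape n) (rowShape m) n) =
      if ∀ i < n, Even (μ.rowLen i) then 1 else 0 := by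
  have hp := plethysm_row_row_mem_dualPairs n (m + 2) n hm
  have h := dualPairs_shifted hlen hfirst hp
  rw [altCoeff_hfam_setMonomial hcard hlen hfirst hp.2.1, hcard, (hm.mul_right n).neg_one_pow,
    one_mul] at h
  rw [h]
  exact if_congr (forall_complShifted_iff_even hlen hfirst (hm.add even_two)) rfl rfl

theorem altCoeff_plethysm_col_row {μ : YoungDiagram} (hm : Odd m) (hcard : μ.card = m * n)
    (hlen : μ.colLen 0 ≤ n) (hfirst : μ.rowLen 0 ≤ m + 2) :
    altCoeff (shifted n μ) (plethysm (colShape n) (rowShape m) n) =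
      if ∀ i < n, Odd (μ.rowLen i) then 1 else 0 := by
  have hp := plethysm_col_row_mem_dualPairs n (m + 2) n hm
  have h := dualPairs_shifted hlen hfirst hp
  have h1 : ((-1 : MvPolynomial (Fin (m + 2)) ℤ) ^ n) = MvPolynomial.C ((-1) ^ n) := by simp
  have hs : (hfam (fun A : {A : Finset (Fin (m + 2)) // A.card = m} => setMonomial A.1)
      n).IsSymmetric := by
    have := (MvPolynomial.IsSymmetric.C ((-1) ^ n)).mul hp.2.1
    simpa [← mul_assoc, ← mul_pow] using this
  -- For odd `m` the duality sign `(-1)^(mn)` equals the sign `(-1)^n` of the second component, and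
  -- the two cancel.
  rw [h1, ← MvPolynomial.smul_eq_C_mul, map_smul, altCoeff_hfam_setMonomial hcard hlen hfirst hs,
    hcard, pow_mul, hm.neg_one_pow, smul_eq_mul] at h
  rw [mul_left_cancel₀ (pow_ne_zero n (by norm_num : (-1 : ℤ) ≠ 0)) h]
  exact if_congr (forall_complShifted_iff_odd hlen hfirst (hm.add_even even_two)) rfl rfl

end Evaluation

end Plethysm

end

theorem theorem3 (m n : ℕ) (hm : 0 < m) (hn : 0 < n) (lam : YoungDiagram)
    (hcard : lam.card = m * n) (hlen : lam.colLen 0 ≤ n) (hfirst : lam.rowLen 0 = m + 2) :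
    (Even m →
      ((∀ i < n, Even (lam.rowLen i)) →
        Plethysm.IsPlethysmCoeff (Plethysm.rowShape n) (Plethysm.rowShape m) lam 1) ∧
      (¬ (∀ i < n, Even (lam.rowLen i)) →
        Plethysm.IsPlethysmCoeff (Plethysm.rowShape n) (Plethysm.rowShape m) lam 0)) ∧
    (Odd m →
      ((∀ i < n, Odd (lam.rowLen i)) →
        Plethysm.IsPlethysmCoeff (Plethysm.colShape n) (Plethysm.rowShape m) lam 1) ∧
      (¬ (∀ i < n, Odd (lam.rowLen i)) →
        Plethysm.IsPlethysmCoeff (Plethysm.colShape n) (Plethysm.rowShape m) lam 0)) := by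
  refine ⟨fun he => ?_, fun ho => ?_⟩
  · have h := Plethysm.isPlethysmCoeff_row_row n m hlen
    rw [Plethysm.altCoeff_plethysm_row_row he hcard hlen hfirst.le] at h
    exact ⟨fun hl => by rwa [if_pos hl] at h, fun hl => by rwa [if_neg hl] at h⟩
  · have h := Plethysm.isPlethysmCoeff_col_row n m hlen
    rw [Plethysm.altCoeff_plethysm_col_row ho hcard hlen hfirst.le] at h
    exact ⟨fun hl => by rwa [if_pos hl] at h, fun hl => by rwa [if_neg hl] at h⟩
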